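/- Let $V(x)=e^{1/2-x^2/4}$, $u_0(x)=(2\pi)^{-1/4}e^{-x^2/4}$, $u_1(x)=x\,u_0(x)$ (the first two normalized Hermite functions), $L=-\partial_x^2+\tfrac14(x^2-6)$, and let $$X_c=\Big\{u\in H^1(\mathbb R):\ \int_{\mathbb R}(1+x^2)u^2\,dx<\infty,\ \int_{\mathbb R}V u\,dx=0\Big\}$$ (real-valued functions, with the norm of $H^1\cap L^2_1$). On $\mathbb R^-=(-\infty,0)$ let $$Hw=-z\,w_{zz}-3w_z+\tfrac14\partial_z(z^2w),\qquad \mathrm{Dom}(H)=\{w\in L^2(\mathbb R^-):\ Hw\in L^2(\mathbb R^-)\},$$ where $Hw$ is understood in the sense of distributions on $\mathbb R^-$ and $\mathrm{Dom}(H)$ carries the graph norm. **Theorem.** Let $u(0)\in X_c$ be of the form $$u(0)=a(0)u_0+b(0)u_1+y(0),\qquad y(0,x)=\int_{-\infty}^0u_0(x-z)\,w(0,z)\,dz,$$ with some $a(0),b(0)\in\mathbb R$ and $w(0)\in\mathrm{Dom}(H)$. Then there are $(a,b)\in C^1([0,\infty),\mathbb R^2)$ and $w\in C([0,\infty),\mathrm{Dom}(H))\cap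 C^1([0,\infty),L^2(\mathbb R^-))$ with these initial values such that $$u(t,x)=a(t)u_0(x)+b(t)u_1(x)+\int_{-\infty}^0u_0(x-z)\,w(t,z)\,dz$$ solves the linearized log-KdV equation $u_t=\partial_xLu$ for $t\ge0$; here a solution means that $u\in C([0,\infty),X_c)\cap C^1([0,\infty),L^2(\mathbb R))$, that each $u(t,\cdot)$ is of class $C^3$, and that the equation holds in $L^2(\mathbb R)$ and pointwise for all $t\ge0$, $x\in\mathbb R$ (with one-sided time derivatives at $t=0$). Moreover, for all $t\ge0$, $w$ satisfies $w_t=Hw$, $w(t,\cdot)$ has a representative continuous on $(-\infty,0]$, and $\dot a(t)=2w(t,0)$, $\dot b(t)=\tfrac12a(t)$. The triple $(a,b,w)$ is unique: any triple with the same regularity whose associated function $u$ is a solution with the same initial data $u(0)$ coincides with it for all $t\ge 0$. Finally, there is $b_\infty\in\mathbb R$ such that $$\lim_{t\to\infty}\|u(t)-b_\infty u_1\|_{L^2(\mathbb R)\cap L^\infty(\mathbb R)}=0.$$ -/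

import Mathlib

open MeasureTheory Filter Topology Set
open scoped ENNReal ContDiff

namespace LogKdV

noncomputable section

/-! ### The energy space and the linearized equation -/

/-- The standing wave `V(x) = exp(1/2 - x²/4)`. -/
def V (x : ℝ) : ℝ := Real.exp (1 / 2 - x ^ 2 / 4)

/-- The normalized Hermite function `u₀(x) = (2π)^{-1/4} exp(-x²/4)`. -/
def u₀ (x : ℝ) : ℝ := (√(√(2 * Real.pi)))⁻¹ * Real.exp (-x ^ 2 / 4)

/-- The normalized Hermite function `u₁(x) = (2√(2π))^{-1/2} H₁(x/√2) exp(-x²/4)`,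
where `H₁(z) = 2z`. -/
def u₁ (x : ℝ) : ℝ := (√(2 * √(2 * Real.pi)))⁻¹ * (2 * (x / √2)) * Real.exp (-x ^ 2 / 4)

/-- `g` is a weak derivative of `f` on the real line. -/
def IsWeakDeriv (f g : ℝ → ℝ) : Prop :=
  ∀ φ : ℝ → ℝ, ContDiff ℝ ∞ φ → HasCompactSupport φ →
    ∫ x, f x * deriv φ x = -∫ x, g x * φ x

/-- The Sobolev space `H¹(ℝ)` of real functions. -/
def H1 : Set (ℝ → ℝ) :=
  {f | MemLp f 2 volume ∧ ∃ g : ℝ → ℝ, MemLp g 2 volume ∧ IsWeakDeriv f g}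

/-- The weighted space `L²₁(ℝ)`, with weight `⟨x⟩ = (1 + x²)^{1/2}`. -/
def L21 : Set (ℝ → ℝ) :=
  {f | MemLp (fun x => √(1 + x ^ 2) * f x) 2 volume}

/-- The constrained energy space `X_c = {u ∈ H¹ ∩ L²₁ : ⟨V, u⟩ = 0}`. -/
def Xc : Set (ℝ → ℝ) :=
  {f | f ∈ H1 ∧ f ∈ L21 ∧ ∫ x, V x * f x = 0}

/-- The norm of `H¹ ∩ L²₁`, for differentiable functions. -/
def energyNorm (f : ℝ → ℝ) : ℝ≥0∞ :=
  eLpNorm f 2 volume + eLpNorm (deriv f) 2 volume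
    + eLpNorm (fun x => √(1 + x ^ 2) * f x) 2 volume

/-- The Schrödinger operator `L = -∂ₓ² + (x² - 6)/4`. -/
def L (f : ℝ → ℝ) (x : ℝ) : ℝ := -iteratedDeriv 2 f x + (x ^ 2 - 6) / 4 * f x

/-- `u(t, x)` (written `u t x`) solves `uₜ = ∂ₓ L u` for `t ≥ 0` in the constrained energy space:
`u ∈ C([0,∞), X_c) ∩ C¹([0,∞), L²(ℝ))`, and the equation holds both in `L²(ℝ)` and pointwise
(with one-sided time derivatives at `t = 0`). -/
structure IsSolution (u : ℝ → ℝ → ℝ) : Prop where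
  mem : ∀ t, 0 ≤ t → u t ∈ Xc
  smooth : ∀ t, 0 ≤ t → ContDiff ℝ 3 (u t)
  continuous : ∀ s, 0 ≤ s →
    Tendsto (fun t => energyNorm (fun x => u t x - u s x)) (𝓝[Ici 0] s) (𝓝 0)
  strong : ∃ U : ℝ → Lp ℝ 2 (volume : Measure ℝ), ContDiffOn ℝ 1 U (Ici 0) ∧
    ∀ t, 0 ≤ t → (U t =ᵐ[volume] u t) ∧
      ((derivWithin U (Ici 0) t : Lp ℝ 2 (volume : Measure ℝ)) =ᵐ[volume] deriv (L (u t)))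
  classical : ∀ t, 0 ≤ t → ∀ x,
    HasDerivWithinAt (fun s => u s x) (deriv (L (u t)) x) (Ici 0) t

/-! ### The operator `H` on the half-line -/

/-- The real Hilbert space `L²(ℝ⁻)`, `ℝ⁻ = (-∞, 0)`. -/
abbrev L2neg : Type := Lp ℝ 2 ((volume : Measure ℝ).restrict (Iio 0))

/-- The formal adjoint `φ ↦ -(zφ)'' + 3φ' - (z²/4)φ'` of
`H = -z∂_z² - 3∂_z + (1/4)∂_z(z² ·)`. -/
def Hadj (φ : ℝ → ℝ) (z : ℝ) : ℝ :=
  -iteratedDeriv 2 (fun y => y * φ y) z + 3 * deriv φ z - z ^ 2 / 4 * deriv φ z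

/-- `Hw = g` in the sense of distributions on `ℝ⁻`. -/
def HasH (w g : L2neg) : Prop :=
  ∀ φ : ℝ → ℝ, ContDiff ℝ ∞ φ → HasCompactSupport φ → tsupport φ ⊆ Iio 0 →
    ∫ z in Iio (0 : ℝ), w z * Hadj φ z = ∫ z in Iio (0 : ℝ), g z * φ z

/-- `Hw` is uniquely determined by `w`. -/
theorem HasH.unique {w g g' : L2neg} (h : HasH w g) (h' : HasH w g') : g = g' := by
  apply Lp.ext
  have hloc : LocallyIntegrable (fun z => g z - g' z)
      ((volume : Measure ℝ).restrict (Iio 0)) :=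
    ((Lp.memLp g).sub (Lp.memLp g')).locallyIntegrable (by norm_num)
  have key := isOpen_Iio.ae_eq_zero_of_integral_contDiff_smul_eq_zero (U := Iio (0 : ℝ))
    (f := fun z => g z - g' z) (μ := (volume : Measure ℝ).restrict (Iio 0))
    (hloc.locallyIntegrableOn _) (by
      intro φ hφ hc hs
      have e := (h φ hφ hc hs).symm.trans (h' φ hφ hc hs)
      have hb : MemLp φ 2 ((volume : Measure ℝ).restrict (Iio 0)) :=
        hφ.continuous.memLp_of_hasCompactSupport hc
      have i1 : Integrable (fun z => g z * φ z) ((volume : Measure ℝ).restrict (Iio 0)) :=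
        (Lp.memLp g).integrable_mul hb
      have i2 : Integrable (fun z => g' z * φ z) ((volume : Measure ℝ).restrict (Iio 0)) :=
        (Lp.memLp g').integrable_mul hb
      calc ∫ z in Iio (0 : ℝ), φ z • (g z - g' z)
          = ∫ z in Iio (0 : ℝ), (g z * φ z - g' z * φ z) := by
            congr 1; ext z; simp only [smul_eq_mul]; ring
        _ = 0 := by rw [integral_sub i1 i2, e, sub_self])
  filter_upwards [key, ae_restrict_mem measurableSet_Iio] with z hz hm
  linarith [hz hm]

/-- The maximal domain `Dom(H) = {w ∈ L²(ℝ⁻) : Hw ∈ L²(ℝ⁻)}`. -/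
def DomH : Set L2neg := {w | ∃ g : L2neg, HasH w g}

/-- `w ∈ C([0,∞), Dom(H))`, where `Dom(H)` carries the graph norm. -/
def ContIntoDomH (w : ℝ → L2neg) : Prop :=
  ContinuousOn w (Ici 0) ∧
    ∃ g : ℝ → L2neg, ContinuousOn g (Ici 0) ∧ ∀ t, 0 ≤ t → HasH (w t) (g t)

/-- `w(0) = c`: `w` has a representative that is continuous on `(-∞, 0]` with value `c` at `0`. -/
def HasTrace (w : L2neg) (c : ℝ) : Prop :=
  ∃ f : ℝ → ℝ, ContinuousOn f (Iic 0) ∧ (w =ᵐ[(volume : Measure ℝ).restrict (Iio 0)] f) ∧ f 0 = c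

/-! ### The convolution representation -/

/-- `a u₀ + b u₁ + y` with `y(x) = ∫_{-∞}^0 u₀(x - z) w(z) dz`. -/
def convForm (a b : ℝ) (w : L2neg) (x : ℝ) : ℝ :=
  a * u₀ x + b * u₁ x + ∫ z in Iio (0 : ℝ), u₀ (x - z) * w z

/-- `(a, b, w)` has the regularity `(a, b) ∈ C¹([0,∞), ℝ²)`,
`w ∈ C([0,∞), Dom(H)) ∩ C¹([0,∞), L²(ℝ⁻))`, and `a(t) u₀ + b(t) u₁ + y(t)` is a solution of the
linearized log-KdV equation. -/
structure IsConvSolution (a b : ℝ → ℝ) (w : ℝ → L2neg) : Prop where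
  contDiff_a : ContDiffOn ℝ 1 a (Ici 0)
  contDiff_b : ContDiffOn ℝ 1 b (Ici 0)
  cont_w : ContIntoDomH w
  contDiff_w : ContDiffOn ℝ 1 w (Ici 0)
  solution : IsSolution (fun t => convForm (a t) (b t) (w t))

end

end LogKdV

namespace LogKdV

/-! ### Contraction semigroups in a Hilbert space -/

section Semigroup

variable {X : Type*} [NormedAddCommGroup X] [InnerProductSpace ℝ X]

local notation "⟪" x ", " y "⟫" => inner ℝ x y

/-! The convolution turns `∂ₓL` into `H`. Applied in `x` to the kernel `u₀(x - z)`, `∂ₓL` equals the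
formal adjoint `H*` applied in `z`. Since `u₀(x - ·)` does not vanish at `z = 0`, moving `H*` onto
`w` leaves a boundary term proportional to `w(0) u₀(x)`. With `∂ₓL u₀ = u₁/2` and `∂ₓL u₁ = 0` this
gives `w_t = Hw`, `a' = 2w(0)`, `b' = a/2` (`HasH.deriv_L_convForm`).

Everything is expressed through `S = H⁻¹`. Since `Hw = (-(z w' + 2w) + z²w/4)'`, the equation `Hw =
g` is integrated twice, the second time with integrating factor `z exp(-z²/8)`. Square integrability
fixes both constants: `z⁻²` is not in `L²` near `0`, and `exp(z²/8)/z²` is not in `L²` near `-∞`. So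
`H` is injective without any boundary condition, and `w(0) = -γ(Hw)/2`, where `γ(g) = ∫ g
exp(-z²/8)` is `gaussCoef` (`HasH.sq_mul_ae_eq`, `HasH.hasTrace`).

On test functions `⟨φ, H*φ⟩ ≤ -‖φ‖²/2`. With the injectivity of `H`, this makes `H*φ ↦ φ` a densely
defined bounded map. The adjoint of its extension is `S`, defined on all of `L²` and dissipative
(`isDissipativeInverse_hInvL`). The bounded operators `(S - ε)⁻¹ = H(1 - εH)⁻¹` are the Yosida
approximations of `H`; their exponentials decay like `exp(-t/4)` uniformly in `ε ≤ 1` and converge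
as `ε → 0` (`exists_semigroup_orbit`). The limit orbit is `v = w_t`, with `w = S v`.

The weighted inequality `⟨φ, H*φ/(1 - z)⟩ ≤ -‖φ‖²/8` gives in the same way `(1 - z) S` bounded,
hence `z w ∈ L²` on the domain and `u ∈ L²₁`. The constraint `⟨V, u⟩ = 0` is exactly `a = -γ(w)`, so
`a` is slaved to `w`. As `(S w)_t = w`, the equation `b' = a/2` integrates to `b + γ(S w)/2 =
const`, and this constant is the limit of `b` because `w → 0`.

For uniqueness, the representation is injective: multiply by `exp(x²/4)`, let `x → ∞` to remove `a`
and `b`, and use uniqueness of the Laplace transform for `w` (`convForm_eq_zero`). So any solution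
obeys the modulation equations, and dissipativity of `H` concludes. -/

theorem denseRange_of_inner_eq_zero [CompleteSpace X] {M : Type*} [AddCommGroup M] [Module ℝ M]
    (A : M →ₗ[ℝ] X) (h : ∀ y, (∀ m, ⟪A m, y⟫ = 0) → y = 0) : DenseRange A := by
  have h1 : (LinearMap.range A)ᗮ = ⊥ := by
    rw [Submodule.eq_bot_iff]
    intro y hy
    refine h y fun m => ?_
    exact (Submodule.mem_orthogonal _ _).1 hy _ (LinearMap.mem_range_self A m)
  rw [← Submodule.topologicalClosure_eq_top_iff] at h1
  have h2 := congrArg (fun K : Submodule ℝ X => (K : Set X)) h1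
  simp only [Submodule.topologicalClosure_coe, LinearMap.coe_range, Submodule.top_coe] at h2
  exact dense_iff_closure_eq.2 h2

/-- Exponential decay of the norm from a differential inequality. -/
theorem norm_le_exp_mul_of_inner_le {w w' : ℝ → X} {k : ℝ}
    (hw : ∀ t, 0 ≤ t → HasDerivWithinAt w (w' t) (Ici 0) t)
    (hk : ∀ t, 0 ≤ t → ⟪w' t, w t⟫ ≤ -k * ‖w t‖ ^ 2) {t : ℝ} (ht : 0 ≤ t) :
    ‖w t‖ ≤ Real.exp (-k * t) * ‖w 0‖ := by
  have hd : ∀ s, 0 ≤ s → HasDerivWithinAt (fun s => Real.exp (2 * k * s) * ‖w s‖ ^ 2)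
      (Real.exp (2 * k * s) * (2 * k) * ‖w s‖ ^ 2 + Real.exp (2 * k * s) * (2 * ⟪w s, w' s⟫))
      (Ici 0) s := by
    intro s hs
    have h1 : HasDerivAt (fun s => Real.exp (2 * k * s)) (Real.exp (2 * k * s) * (2 * k)) s := by
      simpa using ((hasDerivAt_id s).const_mul (2 * k)).exp
    exact h1.hasDerivWithinAt.mul (hw s hs).norm_sq
  have hanti : AntitoneOn (fun s => Real.exp (2 * k * s) * ‖w s‖ ^ 2) (Ici 0) := by
    refine antitoneOn_of_deriv_nonpos (convex_Ici 0)
      (fun s hs => (hd s hs).continuousWithinAt) (fun s hs => ?_) (fun s hs => ?_)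
    · rw [interior_Ici] at hs
      exact ((hd s (le_of_lt hs)).hasDerivAt (Ici_mem_nhds hs)).differentiableAt.differentiableWithinAt
    · rw [interior_Ici] at hs
      rw [((hd s (le_of_lt hs)).hasDerivAt (Ici_mem_nhds hs)).deriv]
      have h1 := hk s (le_of_lt hs)
      rw [real_inner_comm] at h1
      have h2 := Real.exp_pos (2 * k * s)
      nlinarith
  have h := hanti (mem_Ici.2 le_rfl) (mem_Ici.2 ht) ht
  simp only [mul_zero, Real.exp_zero, one_mul] at h
  have h2 : Real.exp (2 * k * t) = Real.exp (k * t) ^ 2 := by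
    rw [← Real.exp_nat_mul]; congr 1; push_cast; ring
  rw [h2, ← mul_pow] at h
  have h3 := le_of_sq_le_sq h (norm_nonneg _)
  calc ‖w t‖ = Real.exp (-k * t) * (Real.exp (k * t) * ‖w t‖) := by
        rw [← mul_assoc, ← Real.exp_add]; simp
    _ ≤ _ := by gcongr

/-- The hypothesis on `S = A⁻¹` under which `A` generates a semigroup with exponential decay. -/
structure IsDissipativeInverse [CompleteSpace X] (S : X →L[ℝ] X) : Prop where
  inj : ∀ x, S x = 0 → x = 0
  inner_le : ∀ x, ⟪S x, x⟫ ≤ -(1 / 2) * ‖ContinuousLinearMap.adjoint S x‖ ^ 2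

variable [CompleteSpace X] {S : X →L[ℝ] X}

namespace IsDissipativeInverse

theorem inner_nonpos (hS : IsDissipativeInverse S) (x : X) : ⟪S x, x⟫ ≤ 0 :=
  (hS.inner_le x).trans (by nlinarith [sq_nonneg ‖ContinuousLinearMap.adjoint S x‖])

/-- For `x` orthogonal to the range, `⟪S (x + t y), x + t y⟫ ≤ 0` is a quadratic in `t` without
constant term. Its linear coefficient `⟪S x, y⟫` must vanish for every `y`, so `S x = 0`. -/
theorem denseRange (hS : IsDissipativeInverse S) : DenseRange S := by
  refine denseRange_of_inner_eq_zero (S : X →ₗ[ℝ] X) fun x hx => ?_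
  have hx : ∀ y, ⟪S y, x⟫ = 0 := hx
  refine hS.inj x ?_
  have key : ∀ y, ⟪S x, y⟫ = 0 := by
    intro y
    have h : ∀ t : ℝ, t * ⟪S x, y⟫ + t ^ 2 * ⟪S y, y⟫ ≤ 0 := by
      intro t
      have := hS.inner_nonpos (x + t • y)
      simp only [map_add, map_smul, inner_add_left, inner_add_right, inner_smul_left,
        inner_smul_right, hx, conj_trivial] at this
      nlinarith
    by_contra hne
    have h1 := hS.inner_nonpos y
    by_cases h0 : ⟪S y, y⟫ = 0
    · have h2 := h ⟪S x, y⟫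
      rw [h0] at h2
      exact hne (by nlinarith [sq_nonneg ⟪S x, y⟫])
    -- This is the vertex of the parabola, where its value is positive unless the linear coefficient
    -- is zero.
    · have h2 := h (-⟪S x, y⟫ / (2 * ⟪S y, y⟫))
      have h3 : -⟪S x, y⟫ / (2 * ⟪S y, y⟫) * ⟪S x, y⟫
          + (-⟪S x, y⟫ / (2 * ⟪S y, y⟫)) ^ 2 * ⟪S y, y⟫ = ⟪S x, y⟫ ^ 2 / (4 * (-⟪S y, y⟫)) := by
        field_simp; ring
      rw [h3] at h2
      have h4 : 0 < ⟪S x, y⟫ ^ 2 / (4 * (-⟪S y, y⟫)) := by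
        have : 0 < -⟪S y, y⟫ := by
          rcases lt_or_eq_of_le h1 with h | h
          · linarith
          · exact absurd h h0
        positivity
      linarith
  exact inner_self_eq_zero.1 (key (S x))

omit [CompleteSpace X] in
theorem norm_sub_sq (x : X) (ε : ℝ) :
    ‖S x - ε • x‖ ^ 2 = ‖S x‖ ^ 2 - 2 * ε * ⟪S x, x⟫ + ε ^ 2 * ‖x‖ ^ 2 := by
  rw [norm_sub_sq_real, inner_smul_right, norm_smul, Real.norm_eq_abs, mul_pow, sq_abs]
  ring

/-- Dissipativity gives `‖S x - ε x‖ ≥ ε ‖x‖` and a trivial orthogonal complement of the range. With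
`A = S⁻¹`, the inverse is the Yosida approximation `A (1 - ε A)⁻¹`. -/
theorem exists_unit (hS : IsDissipativeInverse S) {ε : ℝ} (hε : 0 < ε) :
    ∃ u : (X →L[ℝ] X)ˣ, (u : X →L[ℝ] X) = S - ε • 1 := by
  have hb : Function.Bijective (S - ε • (1 : X →L[ℝ] X)) := by
    rw [ContinuousLinearMap.bijective_iff_dense_range_and_antilipschitz]
    constructor
    · have hd := denseRange_of_inner_eq_zero ((S - ε • (1 : X →L[ℝ] X) : X →L[ℝ] X) : X →ₗ[ℝ] X)
        (fun y hy => by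
          have h1 : ⟪S y - ε • y, y⟫ = 0 := hy y
          rw [inner_sub_left, inner_smul_left, real_inner_self_eq_norm_sq] at h1
          have h2 := hS.inner_nonpos y
          simp only [conj_trivial] at h1
          have h3 : ‖y‖ ^ 2 ≤ 0 := by
            by_contra h
            push Not at h
            nlinarith [mul_pos hε h]
          simpa using le_antisymm h3 (sq_nonneg _))
      rw [SetLike.ext'_iff]
      exact hd.closure_range
    · refine ⟨ε⁻¹.toNNReal, ContinuousLinearMap.antilipschitz_of_bound _ fun x => ?_⟩
      rw [Real.coe_toNNReal _ (by positivity)]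
      have h1 := norm_sub_sq (S := S) x ε
      have h2 := hS.inner_nonpos x
      have h3 : (ε * ‖x‖) ^ 2 ≤ ‖S x - ε • x‖ ^ 2 := by
        rw [h1, mul_pow]
        nlinarith [sq_nonneg ‖S x‖, mul_nonneg hε.le (neg_nonneg.2 h2)]
      have h4 := le_of_sq_le_sq h3 (norm_nonneg _)
      have h5 : (S - ε • (1 : X →L[ℝ] X)) x = S x - ε • x := rfl
      rw [h5]
      calc ‖x‖ = ε⁻¹ * (ε * ‖x‖) := by field_simp
        _ ≤ _ := by gcongr
  have hu := ContinuousLinearMap.isUnit_iff_bijective.2 hb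
  exact ⟨hu.unit, hu.unit_spec⟩

end IsDissipativeInverse

end Semigroup

/-! ### Yosida approximations and the limit semigroup. -/

section SemigroupLimit

variable {X : Type*} [NormedAddCommGroup X] [InnerProductSpace ℝ X] [CompleteSpace X]
  {S : X →L[ℝ] X}

local notation "⟪" x ", " y "⟫" => inner ℝ x y

open NormedSpace (exp)

namespace IsDissipativeInverse

section Resolvent

variable {ε : ℝ} {u : (X →L[ℝ] X)ˣ} (hu : (u : X →L[ℝ] X) = S - ε • 1)

include hu

omit [CompleteSpace X] in
theorem apply_inv (x : X) : S (u⁻¹.val x) - ε • u⁻¹.val x = x := by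
  have := congrArg (fun A : X →L[ℝ] X => A x) u.mul_inv
  rw [hu] at this
  exact this

omit [CompleteSpace X] in
theorem inv_apply (x : X) : u⁻¹.val (S x - ε • x) = x := by
  have := congrArg (fun A : X →L[ℝ] X => A x) u.inv_mul
  rw [hu] at this
  exact this

omit [CompleteSpace X] in
theorem inv_map (x : X) : u⁻¹.val (S x) = S (u⁻¹.val x) := by
  have h1 := apply_inv hu x
  have h2 := inv_apply hu x
  rw [map_sub, map_smul] at h2
  rw [sub_eq_iff_eq_add] at h1 h2
  rw [h1, h2]

/-- `S (S - ε)⁻¹` is the resolvent `(1 - ε A)⁻¹` of `A = S⁻¹`. It contracts because the cross term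
in `‖S y - ε y‖²` has the favourable sign. -/
theorem norm_map_inv_le (hS : IsDissipativeInverse S) (hε : 0 < ε) (x : X) :
    ‖S (u⁻¹.val x)‖ ≤ ‖x‖ := by
  have h1 := norm_sub_sq (S := S) (u⁻¹.val x) ε
  rw [apply_inv hu] at h1
  have h2 := hS.inner_nonpos (u⁻¹.val x)
  refine le_of_sq_le_sq ?_ (norm_nonneg _)
  nlinarith [sq_nonneg (ε * ‖u⁻¹.val x‖), mul_nonneg hε.le (neg_nonneg.2 h2)]

/-- Write `x = S* y - ε y`. Then the left side is `⟪S y, y⟫ - ε ‖y‖²`, at most `-‖S* y‖²/2 - ε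
‖y‖²`, while `‖x‖² ≤ 2 ‖S* y‖² + 2 ε² ‖y‖²`. The rate `1/4` is uniform because `ε² ≤ ε` for `ε ≤ 1`.
-/
theorem inner_inv_le (hS : IsDissipativeInverse S) (hε : 0 < ε) (hε1 : ε ≤ 1) (x : X) :
    ⟪u⁻¹.val x, x⟫ ≤ -(1 / 4) * ‖x‖ ^ 2 := by
  set y := ContinuousLinearMap.adjoint u⁻¹.val x with hy
  have hx : x = ContinuousLinearMap.adjoint S y - ε • y := by
    refine ext_inner_right ℝ fun z => ?_
    rw [inner_sub_left, ContinuousLinearMap.adjoint_inner_left, inner_smul_left,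
      ContinuousLinearMap.adjoint_inner_left, ContinuousLinearMap.adjoint_inner_left]
    have h := inv_apply hu z
    rw [map_sub, map_smul] at h
    nth_rewrite 1 [← h]
    rw [inner_sub_right, inner_smul_right]
    rfl
  have h1 : ⟪u⁻¹.val x, x⟫ = ⟪S y, y⟫ - ε * ‖y‖ ^ 2 := by
    rw [← ContinuousLinearMap.adjoint_inner_right, ← hy]
    nth_rewrite 1 [hx]
    rw [inner_sub_left, inner_smul_left, ContinuousLinearMap.adjoint_inner_left,
      real_inner_self_eq_norm_sq, real_inner_comm]
    rfl
  have h2 := hS.inner_le y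
  have h3 : ‖x‖ ≤ ‖ContinuousLinearMap.adjoint S y‖ + ε * ‖y‖ := by
    nth_rewrite 1 [hx]
    refine (norm_sub_le _ _).trans ?_
    rw [norm_smul, Real.norm_of_nonneg hε.le]
  rw [h1]
  have h4 : ‖x‖ ^ 2 ≤ (‖ContinuousLinearMap.adjoint S y‖ + ε * ‖y‖) ^ 2 := by gcongr
  have h5 : (ε * ‖y‖) ^ 2 ≤ ε * ‖y‖ ^ 2 := by
    rw [mul_pow]
    gcongr
    nlinarith
  nlinarith [sq_nonneg (‖ContinuousLinearMap.adjoint S y‖ - ε * ‖y‖)]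

theorem norm_exp_le (hS : IsDissipativeInverse S) (hε : 0 < ε) (hε1 : ε ≤ 1) {t : ℝ}
    (ht : 0 ≤ t) (x : X) :
    ‖exp (t • u⁻¹.val) x‖ ≤ Real.exp (-(1 / 4) * t) * ‖x‖ := by
  have h := norm_le_exp_mul_of_inner_le (w := fun t : ℝ => exp (t • u⁻¹.val) x)
    (w' := fun t : ℝ => u⁻¹.val (exp (t • u⁻¹.val) x)) (k := 1 / 4)
    (fun s _ => ((hasDerivAt_exp_smul_const' u⁻¹.val s).clm_apply
      (hasDerivAt_const s x)).hasDerivWithinAt.congr_deriv (by simp))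
    (fun s _ => inner_inv_le hu hS hε hε1 _) ht
  simpa using h

theorem norm_exp_le' (hS : IsDissipativeInverse S) (hε : 0 < ε) (hε1 : ε ≤ 1) {t : ℝ}
    (ht : 0 ≤ t) (x : X) : ‖exp (t • u⁻¹.val) x‖ ≤ ‖x‖ := by
  refine (norm_exp_le hu hS hε hε1 ht x).trans ?_
  refine mul_le_of_le_one_left (norm_nonneg _) ?_
  rw [Real.exp_le_one_iff]
  linarith

/-- The approximants converge on the range of `S²`. -/
theorem norm_exp_sub_exp_le (hS : IsDissipativeInverse S) (hε : 0 < ε) (hε1 : ε ≤ 1)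
    {δ : ℝ} {v : (X →L[ℝ] X)ˣ} (hv : (v : X →L[ℝ] X) = S - δ • 1) (hδ : 0 < δ) (hδ1 : δ ≤ 1)
    {t : ℝ} (ht : 0 ≤ t) (h : X) :
    ‖exp (t • v⁻¹.val) (S (S h)) - exp (t • u⁻¹.val) (S (S h))‖ ≤ |δ - ε| * ‖h‖ * t := by
  have hcomm : Commute u⁻¹.val v⁻¹.val := by
    have h1 : Commute u v := by
      have : (u * v : (X →L[ℝ] X)ˣ) = v * u := by
        ext x
        rw [Units.val_mul, Units.val_mul, hu, hv]
        change S (S x - δ • x) - ε • (S x - δ • x) = S (S x - ε • x) - δ • (S x - ε • x)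
        simp only [map_sub, map_smul, smul_sub]
        rw [smul_comm δ ε]
        abel
      exact this
    have h2 := congrArg Units.val (h1.inv_inv).eq
    exact h2
  have hcv : ∀ s : ℝ, Commute u⁻¹.val (exp (s • v⁻¹.val)) := fun s =>
    (hcomm.smul_right s).exp_right
  -- Resolvent identity. On the range of `S²` the two inverses on the right are absorbed by two
  -- factors `S`, leaving two contractions.
  have hdiff : ∀ x, v⁻¹.val x - u⁻¹.val x = (δ - ε) • v⁻¹.val (u⁻¹.val x) := by
    intro x
    nth_rewrite 1 [← apply_inv hu x]
    rw [map_sub, map_smul, inv_map hv, sub_smul]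
    have := apply_inv hv (u⁻¹.val x)
    rw [sub_eq_iff_eq_add] at this
    rw [this]
    abel
  -- Interpolation between the two exponentials; the derivative of `F` contains only the difference
  -- of the generators.
  set F : ℝ → X := fun s => exp ((t - s) • u⁻¹.val) (exp (s • v⁻¹.val) (S (S h))) with hF
  have hder : ∀ s ∈ Icc 0 t, HasDerivWithinAt F
      (exp ((t - s) • u⁻¹.val) (exp (s • v⁻¹.val) (v⁻¹.val (S (S h)) - u⁻¹.val (S (S h)))))
      (Icc 0 t) s := by
    intro s _
    have h1 : HasDerivAt (fun s : ℝ => exp ((t - s) • u⁻¹.val))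
        ((-1 : ℝ) • (exp ((t - s) • u⁻¹.val) * u⁻¹.val)) s :=
      HasDerivAt.scomp s (hasDerivAt_exp_smul_const u⁻¹.val (t - s))
        ((hasDerivAt_id s).const_sub t)
    have h2 : HasDerivAt (fun s : ℝ => exp (s • v⁻¹.val) (S (S h)))
        (exp (s • v⁻¹.val) (v⁻¹.val (S (S h)))) s :=
      ((hasDerivAt_exp_smul_const v⁻¹.val s).clm_apply
      (hasDerivAt_const s (S (S h)))).congr_deriv (by simp)
    refine (h1.clm_apply h2).hasDerivWithinAt.congr_deriv ?_
    have h3 : u⁻¹.val (exp (s • v⁻¹.val) (S (S h))) = exp (s • v⁻¹.val) (u⁻¹.val (S (S h))) :=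
      congrArg (fun A : X →L[ℝ] X => A (S (S h))) (hcv s).eq
    have h4 : (exp ((t - s) • u⁻¹.val) * u⁻¹.val) (exp (s • v⁻¹.val) (S (S h)))
        = exp ((t - s) • u⁻¹.val) (u⁻¹.val (exp (s • v⁻¹.val) (S (S h)))) := rfl
    rw [smul_apply, h4, h3, neg_one_smul, map_sub, map_sub]
    abel
  have hb := norm_image_sub_le_of_norm_deriv_le_segment' (C := |δ - ε| * ‖h‖) hder (by
    intro s hs
    refine (norm_exp_le' hu hS hε hε1 (by linarith [hs.2]) _).trans ?_
    refine (norm_exp_le' hv hS hδ hδ1 hs.1 _).trans ?_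
    rw [hdiff, norm_smul, Real.norm_eq_abs]
    refine mul_le_mul_of_nonneg_left ?_ (abs_nonneg _)
    rw [inv_map hu, inv_map hv]
    refine (norm_map_inv_le hv hS hδ _).trans ?_
    rw [inv_map hu]
    exact norm_map_inv_le hu hS hε _) t ⟨ht, le_rfl⟩
  simpa [hF] using hb

end Resolvent

/-- Existence for `w_t = S⁻¹ w`, written for `v = w_t`, `w = S v`. -/
theorem exists_semigroup_orbit (hS : IsDissipativeInverse S) (g : X) :
    ∃ v : ℝ → X, Continuous v ∧ v 0 = g ∧
      (∀ t, 0 ≤ t → HasDerivWithinAt (fun s => S (v s)) (v t) (Ici 0) t) ∧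
      (∀ t, 0 ≤ t → ‖v t‖ ≤ Real.exp (-(1 / 4) * t) * ‖g‖) := by
  set r : ℕ → ℝ := fun n => 1 / ((n : ℝ) + 1) with hr
  have hr0 : ∀ n, 0 < r n := fun n => Nat.one_div_pos_of_nat
  have hr1 : ∀ n, r n ≤ 1 := fun n => by
    rw [hr, div_le_one (by positivity)]
    simp
  have hrt : Tendsto r atTop (𝓝 0) := tendsto_one_div_add_atTop_nhds_zero_nat
  choose u hu using fun n => hS.exists_unit (hr0 n)
  set E : ℕ → ℝ → X → X := fun n t x => exp (t • (u n)⁻¹.val) x with hE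
  have hEc : ∀ n t x, 0 ≤ t → ‖E n t x‖ ≤ ‖x‖ := fun n t x ht =>
    norm_exp_le' (hu n) hS (hr0 n) (hr1 n) ht x
  -- A three-epsilon argument: replace `x` by a nearby element of the dense range of `S²`, with
  -- errors controlled by contractivity.
  have hcauchy : ∀ x T, UniformCauchySeqOn (fun n t => E n t x) atTop (Icc 0 T) := by
    intro x T
    rw [Metric.uniformCauchySeqOn_iff]
    intro η hη
    have hd : DenseRange (fun h => S (S h)) :=
      DenseRange.comp hS.denseRange hS.denseRange S.continuous
    obtain ⟨h, hh⟩ := hd.exists_dist_lt x (show 0 < η / 4 by positivity)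
    have hcr := Metric.cauchySeq_iff.1 hrt.cauchySeq
    obtain ⟨N, hN⟩ := hcr (η / (4 * (‖h‖ * |T| + 1))) (by positivity)
    refine ⟨N, fun m hm n hn t ht => ?_⟩
    have h1 := norm_exp_sub_exp_le (hu n) hS (hr0 n) (hr1 n) (hu m) (hr0 m) (hr1 m) ht.1 h
    have h2 : |r m - r n| < η / (4 * (‖h‖ * |T| + 1)) := hN m hm n hn
    have h3 : |r m - r n| * ‖h‖ * t ≤ η / 4 := by
      calc |r m - r n| * ‖h‖ * t ≤ η / (4 * (‖h‖ * |T| + 1)) * ‖h‖ * |T| := by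
            gcongr
            exact ht.1
            exact ht.2.trans (le_abs_self T)
        _ = η / 4 * (‖h‖ * |T| / (‖h‖ * |T| + 1)) := by field_simp
        _ ≤ η / 4 * 1 := by
            gcongr
            rw [div_le_one (by positivity)]
            linarith
        _ = η / 4 := mul_one _
    have h4 : ‖E m t x - E m t (S (S h))‖ ≤ η / 4 := by
      have : E m t x - E m t (S (S h)) = E m t (x - S (S h)) := by simp [hE]
      rw [this]
      refine (hEc m t _ ht.1).trans ?_
      rw [← dist_eq_norm]; exact hh.le
    have h5 : ‖E n t x - E n t (S (S h))‖ ≤ η / 4 := by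
      have : E n t x - E n t (S (S h)) = E n t (x - S (S h)) := by simp [hE]
      rw [this]
      refine (hEc n t _ ht.1).trans ?_
      rw [← dist_eq_norm]; exact hh.le
    rw [dist_eq_norm]
    have h6 : E m t x - E n t x = (E m t x - E m t (S (S h)))
        + (E m t (S (S h)) - E n t (S (S h))) - (E n t x - E n t (S (S h))) := by abel
    rw [h6]
    have h7 : ‖E m t (S (S h)) - E n t (S (S h))‖ ≤ η / 4 := h1.trans h3
    calc _ ≤ ‖E m t x - E m t (S (S h))‖ + ‖E m t (S (S h)) - E n t (S (S h))‖
          + ‖E n t x - E n t (S (S h))‖ := (norm_sub_le _ _).trans (by gcongr; exact norm_add_le _ _)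
      _ < η := by linarith
  have hlim : ∀ t, ∃ y, 0 ≤ t → Tendsto (fun n => E n t g) atTop (𝓝 y) := by
    intro t
    by_cases ht : 0 ≤ t
    · obtain ⟨y, hy⟩ := cauchySeq_tendsto_of_complete
        ((hcauchy g t).cauchySeq (x := t) ⟨ht, le_rfl⟩)
      exact ⟨y, fun _ => hy⟩
    · exact ⟨0, fun h => absurd h ht⟩
  choose v₀ hv₀ using hlim
  have hEcont : ∀ n, Continuous (fun t => E n t g) := fun n =>
    continuous_iff_continuousAt.2 fun s => ((hasDerivAt_exp_smul_const (u n)⁻¹.val s).clm_apply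
      (hasDerivAt_const s g)).continuousAt
  have hv₀c : ContinuousOn v₀ (Ici 0) := by
    intro t ht
    have h1 : ContinuousOn v₀ (Icc 0 (t + 1)) :=
      ((hcauchy g (t + 1)).tendstoUniformlyOn_of_tendsto fun s hs => hv₀ s hs.1).continuousOn
        (Frequently.of_forall fun n => (hEcont n).continuousOn)
    refine (h1 t ⟨ht, by linarith⟩).mono_of_mem_nhdsWithin ?_
    rw [← Ici_inter_Iic]
    exact inter_mem self_mem_nhdsWithin (mem_nhdsWithin_of_mem_nhds (Iic_mem_nhds (by linarith)))
  -- Freezing negative times at `0` makes the orbit continuous on the whole line.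
  set v : ℝ → X := fun t => v₀ (max t 0) with hv
  have hvc : Continuous v := hv₀c.comp_continuous (by fun_prop) fun t => mem_Ici.2 (le_max_right _ _)
  have hvl : ∀ t, 0 ≤ t → Tendsto (fun n => E n t g) atTop (𝓝 (v t)) := fun t ht => by
    rw [hv]; simp only [max_eq_left ht]; exact hv₀ t ht
  -- The limit is taken in the integrated equation: `(S - ε) E` has derivative `E`, so only bounded
  -- operators occur, and `v` itself need not be differentiable.
  have hint : ∀ t, 0 ≤ t → S (v t) = S g + ∫ s in (0 : ℝ)..t, v s := by
    intro t ht
    have h1 : ∀ n, S (E n t g) - r n • E n t g = (S g - r n • g) + ∫ s in (0 : ℝ)..t, E n s g := by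
      intro n
      have hd : ∀ s ∈ uIcc 0 t, HasDerivAt (fun s => S (E n s g) - r n • E n s g) (E n s g) s := by
        intro s _
        have h2 : HasDerivAt (fun s => E n s g) ((u n)⁻¹.val (E n s g)) s :=
          ((hasDerivAt_exp_smul_const' (u n)⁻¹.val s).clm_apply
            (hasDerivAt_const s g)).congr_deriv (by simp [hE])
        refine ((S.hasFDerivAt.comp_hasDerivAt s h2).sub (h2.const_smul (r n))).congr_deriv ?_
        exact apply_inv (hu n) _
      rw [intervalIntegral.integral_eq_sub_of_hasDerivAt hd
        ((hEcont n).intervalIntegrable _ _)]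
      simp [hE]
    have h2 : Tendsto (fun n => S (E n t g) - r n • E n t g) atTop (𝓝 (S (v t) - (0 : ℝ) • v t)) :=
      ((S.continuous.tendsto _).comp (hvl t ht)).sub (hrt.smul (hvl t ht))
    have h3 : Tendsto (fun n => (S g - r n • g) + ∫ s in (0 : ℝ)..t, E n s g) atTop
        (𝓝 ((S g - (0 : ℝ) • g) + ∫ s in (0 : ℝ)..t, v s)) := by
      refine (tendsto_const_nhds.sub (hrt.smul_const g)).add ?_
      refine intervalIntegral.tendsto_integral_filter_of_dominated_convergence (fun _ => ‖g‖)
        (Eventually.of_forall fun n => (hEcont n).aestronglyMeasurable)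
        (Eventually.of_forall fun n => Eventually.of_forall fun s hs => ?_)
        intervalIntegrable_const (Eventually.of_forall fun s hs => ?_)
      · rw [uIoc_of_le ht] at hs
        exact hEc n s g hs.1.le
      · rw [uIoc_of_le ht] at hs
        exact hvl s hs.1.le
    simp only [h1] at h2
    simpa using tendsto_nhds_unique h2 h3
  refine ⟨v, hvc, ?_, fun t ht => ?_, fun t ht => ?_⟩
  · refine tendsto_nhds_unique (hvl 0 le_rfl) ?_
    simp [hE]
  · have h1 : HasDerivAt (fun s => S g + ∫ r in (0 : ℝ)..s, v r) (v t) t :=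
      (intervalIntegral.integral_hasDerivAt_right (hvc.intervalIntegrable _ _)
        (hvc.stronglyMeasurableAtFilter _ _) hvc.continuousAt).const_add _
    exact h1.hasDerivWithinAt.congr (fun s hs => hint s hs) (hint t ht)
  · exact le_of_tendsto (hvl t ht).norm (Eventually.of_forall fun n =>
      norm_exp_le (hu n) hS (hr0 n) (hr1 n) ht g)

end IsDissipativeInverse

end SemigroupLimit

/-! ### Test functions on the negative half-line -/

/-- Test functions supported in the open negative half-line. -/
def IsTest (φ : ℝ → ℝ) : Prop :=
  ContDiff ℝ ∞ φ ∧ ∃ a b : ℝ, b < 0 ∧ ∀ z, z ∉ Icc a b → φ z = 0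

namespace IsTest

variable {φ ψ : ℝ → ℝ}

theorem of_tsupport (h : ContDiff ℝ ∞ φ) (hc : HasCompactSupport φ) (hs : tsupport φ ⊆ Iio 0) :
    IsTest φ := by
  refine ⟨h, ?_⟩
  rcases (tsupport φ).eq_empty_or_nonempty with he | hne
  · refine ⟨-1, -1, by norm_num, fun z _ => ?_⟩
    exact image_eq_zero_of_notMem_tsupport (by simp [he])
  · obtain ⟨b, hb, hb'⟩ := IsCompact.exists_isGreatest hc hne
    obtain ⟨a, ha, ha'⟩ := IsCompact.exists_isLeast hc hne
    refine ⟨a, b, hs hb, fun z hz => image_eq_zero_of_notMem_tsupport fun hzs => hz ?_⟩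
    exact ⟨ha' hzs, hb' hzs⟩

theorem hasCompactSupport (h : IsTest φ) : HasCompactSupport φ := by
  obtain ⟨_, a, b, _, h0⟩ := h
  exact HasCompactSupport.intro isCompact_Icc h0

theorem tsupport_subset (h : IsTest φ) : tsupport φ ⊆ Iio 0 := by
  obtain ⟨_, a, b, hb, h0⟩ := h
  have h1 : tsupport φ ⊆ Icc a b := closure_minimal (fun z hz => by
    by_contra hzi
    exact hz (h0 z hzi)) isClosed_Icc
  exact h1.trans fun z hz => lt_of_le_of_lt hz.2 hb

theorem eq_zero (h : IsTest φ) {z : ℝ} (hz : 0 ≤ z) : φ z = 0 := by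
  obtain ⟨_, a, b, hb, h0⟩ := h
  exact h0 z fun hz' => by linarith [hz'.2]

theorem continuous (h : IsTest φ) : Continuous φ := h.1.continuous

theorem hasDerivAt (h : IsTest φ) (z : ℝ) : HasDerivAt φ (deriv φ z) z :=
  (h.1.differentiable (by simp) z).hasDerivAt

theorem deriv (h : IsTest φ) : IsTest (deriv φ) := by
  obtain ⟨hc, a, b, hb, h0⟩ := h
  refine ⟨(contDiff_infty_iff_deriv.1 hc).2, a, b, hb, fun z hz => ?_⟩
  have : φ =ᶠ[𝓝 z] fun _ => 0 := by
    filter_upwards [isClosed_Icc.isOpen_compl.mem_nhds hz] with y hy using h0 y hy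
  rw [this.deriv_eq]
  simp

theorem mul_left (h : IsTest φ) {q : ℝ → ℝ} (hq : ContDiff ℝ ∞ q) :
    IsTest (fun z => q z * φ z) := by
  obtain ⟨hc, a, b, hb, h0⟩ := h
  exact ⟨hq.mul hc, a, b, hb, fun z hz => by simp [h0 z hz]⟩

theorem add (h : IsTest φ) (h' : IsTest ψ) : IsTest (fun z => φ z + ψ z) := by
  obtain ⟨hc, a, b, hb, h0⟩ := h
  obtain ⟨hc', a', b', hb', h0'⟩ := h'
  refine ⟨hc.add hc', min a a', max b b', max_lt hb hb', fun z hz => ?_⟩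
  beta_reduce
  rw [h0 z fun h => hz ⟨(min_le_left _ _).trans h.1, h.2.trans (le_max_left _ _)⟩,
    h0' z fun h => hz ⟨(min_le_right _ _).trans h.1, h.2.trans (le_max_right _ _)⟩, add_zero]

theorem const_mul (h : IsTest φ) (c : ℝ) : IsTest (fun z => c * φ z) :=
  h.mul_left contDiff_const

theorem integrable (h : IsTest φ) : Integrable φ :=
  h.continuous.integrable_of_hasCompactSupport h.hasCompactSupport

theorem setIntegral_eq (h : IsTest φ) (f : ℝ → ℝ) :
    ∫ z in Iio (0 : ℝ), f z * φ z = ∫ z, f z * φ z :=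
  setIntegral_eq_integral_of_forall_compl_eq_zero fun z hz => by
    rw [h.eq_zero (not_lt.1 hz), mul_zero]

/-- To the right of the support the primitive from `0` sees only zeros; to the left it is minus the
full integral, which vanishes by `h0`. -/
theorem primitive (h : IsTest ψ) (h0 : ∫ z, ψ z = 0) :
    IsTest (fun z => ∫ t in (0 : ℝ)..z, ψ t) ∧
      _root_.deriv (fun z => ∫ t in (0 : ℝ)..z, ψ t) = ψ := by
  have hd : ∀ z, HasDerivAt (fun z => ∫ t in (0 : ℝ)..z, ψ t) (ψ z) z := fun z =>
    intervalIntegral.integral_hasDerivAt_right (h.continuous.intervalIntegrable _ _)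
      (h.continuous.stronglyMeasurableAtFilter _ _) h.continuous.continuousAt
  have hd' : _root_.deriv (fun z => ∫ t in (0 : ℝ)..z, ψ t) = ψ := funext fun z => (hd z).deriv
  refine ⟨⟨?_, ?_⟩, hd'⟩
  · rw [contDiff_infty_iff_deriv, hd']
    exact ⟨fun z => (hd z).differentiableAt, h.1⟩
  · obtain ⟨_, a, b, hb, hz0⟩ := id h
    refine ⟨a, b, hb, fun z hz => ?_⟩
    rcases lt_or_ge b z with hbz | hbz
    · refine intervalIntegral.integral_zero_ae (Eventually.of_forall fun t ht => ?_)
      refine hz0 t fun hti => ?_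
      rcases le_total 0 z with h1 | h1
      · rw [uIoc_of_le h1] at ht
        linarith [ht.1, hti.2]
      · rw [uIoc_of_ge h1] at ht
        linarith [ht.1, hti.2]
    · have hza : z < a := not_le.1 fun h1 => hz ⟨h1, hbz⟩
      beta_reduce
      rw [intervalIntegral.integral_symm, intervalIntegral.integral_of_le (by linarith),
        setIntegral_eq_integral_of_forall_compl_eq_zero, h0, neg_zero]
      intro t ht
      refine hz0 t fun hti => ht ⟨by linarith [hti.1], by linarith [hti.2]⟩

end IsTest

theorem exists_isTest_integral_eq_one : ∃ ψ : ℝ → ℝ, IsTest ψ ∧ ∫ z, ψ z = 1 := by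
  -- The support is `[-3, -1]`, at positive distance from `0`.
  let B : ContDiffBump (-2 : ℝ) := ⟨1 / 2, 1, by norm_num, by norm_num⟩
  refine ⟨B.normed volume, ⟨B.contDiff_normed, -3, -1, by norm_num, fun z hz => ?_⟩,
    B.integral_normed⟩
  by_contra h
  have h1 : z ∈ Function.support (B.normed volume) := h
  rw [B.support_normed_eq, Real.ball_eq_Ioo] at h1
  refine hz ⟨?_, ?_⟩
  · have := h1.1; simp only [B] at this; linarith
  · have := h1.2; simp only [B] at this; linarith

/-- A functional on test functions that vanishes on derivatives is a multiple of the integral. -/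
theorem exists_const_of_vanish_deriv (l : (ℝ → ℝ) → ℝ)
    (hl : ∀ φ ψ, IsTest φ → IsTest ψ → ∀ c : ℝ,
      l (fun z => φ z + c * ψ z) = l φ + c * l ψ)
    (h0 : ∀ φ, IsTest φ → l (deriv φ) = 0) :
    ∃ C : ℝ, ∀ ψ, IsTest ψ → l ψ = C * ∫ z, ψ z := by
  obtain ⟨ψ₀, hψ₀, hi⟩ := exists_isTest_integral_eq_one
  refine ⟨l ψ₀, fun ψ hψ => ?_⟩
  -- Removing the mean turns `ψ` into the derivative of a test function.
  have ht : IsTest (fun z => ψ z + (-∫ z, ψ z) * ψ₀ z) := hψ.add (hψ₀.const_mul _)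
  have hz : ∫ z, (ψ z + (-∫ z, ψ z) * ψ₀ z) = 0 := by
    rw [integral_add hψ.integrable (hψ₀.integrable.const_mul _), integral_const_mul, hi]
    ring
  obtain ⟨h1, h2⟩ := ht.primitive hz
  have h3 := h0 _ h1
  rw [h2, hl ψ ψ₀ hψ hψ₀] at h3
  linarith

/-- Du Bois-Reymond: a function with zero weak derivative is constant. -/
theorem ae_eq_const_of_weakDeriv_eq_zero {F : ℝ → ℝ} (hF : LocallyIntegrable F
      ((volume : Measure ℝ).restrict (Iio 0)))
    (h : ∀ φ, IsTest φ → ∫ z in Iio (0 : ℝ), F z * deriv φ z = 0) :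
    ∃ C : ℝ, ∀ᵐ z ∂(volume : Measure ℝ).restrict (Iio 0), F z = C := by
  have hint : ∀ φ, IsTest φ → Integrable (fun z => F z * φ z)
      ((volume : Measure ℝ).restrict (Iio 0)) := fun φ hφ => by
    have := hF.integrable_smul_left_of_hasCompactSupport hφ.continuous hφ.hasCompactSupport
    simpa [mul_comm] using this
  obtain ⟨C, hC⟩ := exists_const_of_vanish_deriv (fun φ => ∫ z in Iio (0 : ℝ), F z * φ z)
    (fun φ ψ hφ hψ c => by
      rw [← integral_const_mul, ← integral_add (hint φ hφ) ((hint ψ hψ).const_mul c)]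
      congr 1; ext z; ring) h
  refine ⟨C, ?_⟩
  have hloc : LocallyIntegrable (fun z => F z - C) ((volume : Measure ℝ).restrict (Iio 0)) :=
    hF.sub (locallyIntegrable_const C)
  have key := isOpen_Iio.ae_eq_zero_of_integral_contDiff_smul_eq_zero (U := Iio (0 : ℝ))
    (f := fun z => F z - C) (μ := (volume : Measure ℝ).restrict (Iio 0))
    (hloc.locallyIntegrableOn _) (by
      intro φ hφ hc hs
      have ht := IsTest.of_tsupport hφ hc hs
      have e := hC φ ht
      have e2 : ∫ z in Iio (0 : ℝ), φ z = ∫ z, φ z := by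
        simpa using ht.setIntegral_eq (fun _ => 1)
      calc ∫ z in Iio (0 : ℝ), φ z • (F z - C)
          = ∫ z in Iio (0 : ℝ), (F z * φ z - C * φ z) := by
            congr 1; ext z; simp only [smul_eq_mul]; ring
        _ = 0 := by
            rw [integral_sub (hint φ ht) (ht.integrable.integrableOn.const_mul C),
              integral_const_mul, e, e2, sub_self])
  filter_upwards [key, ae_restrict_mem measurableSet_Iio] with z hz hm
  linarith [hz hm]

/-! ### Decaying functions and integration by parts -/

/-- Decay at the rate `(1 + z²)⁻²`. -/
def Decays (ψ : ℝ → ℝ) : Prop := ∃ M, ∀ z, |ψ z| ≤ M * ((1 + z ^ 2) ^ 2)⁻¹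

namespace Decays

variable {ψ : ℝ → ℝ}

/-- The rate `(1 + z²)⁻²` is chosen so that a factor of quadratic growth, in particular the
primitive of an `L²` function, still leaves the integrable bound `(1 + z²)⁻¹`. -/
theorem mul_bound (h : Decays ψ) {f : ℝ → ℝ} {s : Set ℝ}
    (hf : ∃ B, ∀ z ∈ s, |f z| ≤ B * (1 + z ^ 2)) :
    ∃ K, ∀ z ∈ s, |f z * ψ z| ≤ K * (1 + z ^ 2)⁻¹ := by
  obtain ⟨M, hM⟩ := h
  obtain ⟨B, hB⟩ := hf
  refine ⟨B * M, fun z hz => ?_⟩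
  rw [abs_mul]
  have h1 : 0 < 1 + z ^ 2 := by positivity
  calc |f z| * |ψ z| ≤ (B * (1 + z ^ 2)) * (M * ((1 + z ^ 2) ^ 2)⁻¹) := by
        have := hB z hz
        gcongr
        · exact (abs_nonneg _).trans this
        · exact hM z
    _ = B * M * (1 + z ^ 2)⁻¹ := by field_simp

theorem integrableOn_mul (h : Decays ψ) (hc : Continuous ψ) {f : ℝ → ℝ} {s : Set ℝ}
    (hs : MeasurableSet s) (hm : AEStronglyMeasurable f (volume.restrict s))
    (hf : ∃ B, ∀ z ∈ s, |f z| ≤ B * (1 + z ^ 2)) : IntegrableOn (fun z => f z * ψ z) s := by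
  obtain ⟨K, hK⟩ := h.mul_bound hf
  refine Integrable.mono' (integrable_inv_one_add_sq.const_mul K).integrableOn
    (hm.mul hc.aestronglyMeasurable) ?_
  filter_upwards [ae_restrict_mem hs] with z hz using hK z hz

theorem integrable (h : Decays ψ) (hc : Continuous ψ) : Integrable ψ := by
  have := h.integrableOn_mul hc (f := fun _ => 1) (s := univ) MeasurableSet.univ
    aestronglyMeasurable_const ⟨1, fun z _ => by simp; positivity⟩
  simpa using this

theorem memLp_two (h : Decays ψ) (hc : Continuous ψ) : MemLp ψ 2 volume := by
  rw [memLp_two_iff_integrable_sq hc.aestronglyMeasurable]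
  have := h.integrableOn_mul hc (f := ψ) (s := univ) MeasurableSet.univ
    hc.aestronglyMeasurable (by
      obtain ⟨M, hM⟩ := h
      refine ⟨M, fun z _ => (hM z).trans ?_⟩
      have hM0 : 0 ≤ M := by
        have := (abs_nonneg _).trans (hM 0)
        simpa using this
      gcongr
      have h1 : 1 ≤ 1 + z ^ 2 := by nlinarith [sq_nonneg z]
      exact (inv_le_one_of_one_le₀ (one_le_pow₀ h1)).trans h1)
  simpa [pow_two] using this

end Decays

theorem IsTest.decays {φ : ℝ → ℝ} (h : IsTest φ) : Decays φ := by
  have h1 : Continuous (fun z => (1 + z ^ 2) ^ 2 * φ z) := by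
    have := h.continuous; fun_prop
  obtain ⟨M, hM⟩ := h1.bounded_above_of_compact_support (h.hasCompactSupport.mul_left)
  refine ⟨M, fun z => ?_⟩
  have := hM z
  rw [Real.norm_eq_abs, abs_mul, abs_of_nonneg (by positivity)] at this
  rw [← div_eq_mul_inv, le_div_iff₀ (by positivity), mul_comm]
  exact this

/-- The primitive `∫₀ᶻ g` of a function on the negative half-line. -/
noncomputable def prim (g : ℝ → ℝ) (z : ℝ) : ℝ := ∫ t in (0 : ℝ)..z, (Iio (0 : ℝ)).indicator g t

section Prim

variable {g : ℝ → ℝ} (hg : MemLp g 2 ((volume : Measure ℝ).restrict (Iio 0)))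

include hg

theorem locallyIntegrable_indicator : LocallyIntegrable ((Iio (0 : ℝ)).indicator g) volume :=
  ((memLp_indicator_iff_restrict measurableSet_Iio).2 hg).locallyIntegrable (by norm_num)

theorem intervalIntegrable_indicator (a b : ℝ) :
    IntervalIntegrable ((Iio (0 : ℝ)).indicator g) volume a b :=
  intervalIntegrable_iff.2
    (((locallyIntegrable_indicator hg).integrableOn_isCompact isCompact_uIcc).mono_set
      uIoc_subset_uIcc)

theorem continuous_prim : Continuous (prim g) :=
  intervalIntegral.continuous_primitive
    (fun _ _ => intervalIntegrable_indicator hg _ _) 0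

/-- Integrate `|G| ≤ 1 + G²`. The resulting linear growth is weakened to quadratic, which `Decays`
absorbs. -/
theorem prim_bound : ∃ B, ∀ z, |prim g z| ≤ B * (1 + z ^ 2) := by
  have h2 := (memLp_indicator_iff_restrict (f := g) (p := 2) (μ := volume)
    (measurableSet_Iio (a := (0 : ℝ)))).2 hg
  set G := (Iio (0 : ℝ)).indicator g with hG
  have hi : Integrable (fun t => G t ^ 2) := h2.integrable_sq
  set I := ∫ t, G t ^ 2 with hI
  have hI0 : 0 ≤ I := integral_nonneg fun t => sq_nonneg _
  refine ⟨1 + I, fun z => ?_⟩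
  have h1 : |prim g z| ≤ ∫ t in uIoc 0 z, |G t| := by
    simp only [← Real.norm_eq_abs]
    exact intervalIntegral.norm_integral_le_integral_norm_uIoc
  have hfin : volume (uIoc 0 z) ≠ ⊤ := by simp
  have h3 : ∫ t in uIoc 0 z, |G t| ≤ ∫ t in uIoc 0 z, (1 + G t ^ 2) := by
    refine setIntegral_mono ?_ ?_ fun t => ?_
    · exact (intervalIntegrable_indicator hg 0 z).def'.abs
    · exact (integrableOn_const hfin).add hi.integrableOn
    · nlinarith [sq_abs (G t), sq_nonneg (|G t| - 1), abs_nonneg (G t)]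
  have h4 : ∫ t in uIoc 0 z, (1 + G t ^ 2) ≤ |z| + I := by
    rw [integral_add (f := fun _ => (1 : ℝ)) (integrableOn_const hfin).integrable hi.integrableOn.integrable]
    gcongr
    · simp [measureReal_def]
    · exact setIntegral_le_integral hi (Eventually.of_forall fun t => sq_nonneg _)
  have h5 : |z| ≤ 1 + z ^ 2 := by nlinarith [sq_abs z, sq_nonneg (|z| - 1), abs_nonneg z]
  nlinarith [sq_nonneg z, mul_nonneg hI0 (sq_nonneg z)]

/-- Integration by parts against the primitive of an `L²` function. -/
theorem integral_prim_mul_eq {ψ η : ℝ → ℝ} (hψ : ∀ z, HasDerivAt ψ (η z) z) (hη : Continuous η)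
    (hdψ : Decays ψ) (hdη : Decays η) :
    ∫ z in Iio (0 : ℝ), prim g z * η z = -∫ z in Iio (0 : ℝ), g z * ψ z := by
  have hψc : Continuous ψ := continuous_iff_continuousAt.2 fun z => (hψ z).continuousAt
  have hb := prim_bound hg
  have hi1 : IntegrableOn (fun z => prim g z * η z) (Iic 0) :=
    hdη.integrableOn_mul hη measurableSet_Iic (continuous_prim hg).aestronglyMeasurable
      (by obtain ⟨B, hB⟩ := hb; exact ⟨B, fun z _ => hB z⟩)
  set G := (Iio (0 : ℝ)).indicator g with hG
  have h2 : MemLp G 2 volume := (memLp_indicator_iff_restrict measurableSet_Iio).2 hg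
  have hi2 : Integrable (fun z => G z * ψ z) := h2.integrable_mul (hdψ.memLp_two hψc)
  have hint : ∀ a b : ℝ, IntervalIntegrable G volume a b := fun a b =>
    intervalIntegrable_indicator hg a b
  -- `prim g` is differentiable only almost everywhere, hence the integration by parts for
  -- absolutely continuous functions. The boundary term at `0` vanishes because `prim g 0 = 0`.
  have key : ∀ z : ℝ, ∫ s in z..0, prim g s * η s
      = -(prim g z * ψ z) - ∫ s in z..0, G s * ψ s := by
    intro z
    have hac : AbsolutelyContinuousOnInterval (prim g) z 0 :=
      (hint z 0).absolutelyContinuousOnInterval_intervalIntegral (c := 0) (by simp)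
    have hψ1 : ContDiff ℝ 1 ψ := by
      rw [contDiff_one_iff_deriv]
      refine ⟨fun z => (hψ z).differentiableAt, ?_⟩
      have : deriv ψ = η := funext fun z => (hψ z).deriv
      rwa [this]
    have hac' : AbsolutelyContinuousOnInterval ψ z 0 :=
      hψ1.contDiffOn.absolutelyContinuousOnInterval
    have h3 := hac.integral_mul_deriv_eq_deriv_mul hac'
    have h4 : prim g 0 = 0 := by simp [prim]
    have h5 : ∀ s, deriv ψ s = η s := fun s => (hψ s).deriv
    simp only [h5, h4, zero_mul, zero_sub] at h3
    rw [h3]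
    congr 1
    refine intervalIntegral.integral_congr_ae ?_
    filter_upwards [LocallyIntegrable.ae_hasDerivAt_integral (locallyIntegrable_indicator hg)] with s hs _
    have : deriv (prim g) s = G s := (hs 0).deriv
    rw [this]
  have t1 := intervalIntegral_tendsto_integral_Iic 0 hi1 tendsto_id
  have t2 := intervalIntegral_tendsto_integral_Iic 0 hi2.integrableOn tendsto_id
  have t3 : Tendsto (fun z => prim g z * ψ z) atBot (𝓝 0) := by
    obtain ⟨K, hK⟩ := hdψ.mul_bound (s := univ) (f := prim g)
      (by obtain ⟨B, hB⟩ := hb; exact ⟨B, fun z _ => hB z⟩)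
    refine squeeze_zero_norm (fun z => hK z (mem_univ _)) ?_
    rw [← mul_zero K]
    refine Tendsto.const_mul K (tendsto_inv_atTop_zero.comp ?_)
    refine tendsto_atTop_add_const_left _ _ ?_
    simpa [Function.comp_def] using
      (tendsto_pow_atTop (α := ℝ) two_ne_zero).comp tendsto_abs_atBot_atTop
  have t4 := t3.neg.sub t2
  simp only [id, key] at t1
  have t5 := tendsto_nhds_unique t1 t4
  rw [← integral_Iic_eq_integral_Iio, t5, integral_Iic_eq_integral_Iio, neg_zero, zero_sub]
  congr 1
  refine setIntegral_congr_fun measurableSet_Iio fun z hz => ?_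
  simp [hG, indicator_of_mem hz]

end Prim

noncomputable section

local notation "μneg" => Measure.restrict (volume : Measure ℝ) (Iio (0 : ℝ))

local notation "⟪" x ", " y "⟫" => inner ℝ x y

/-! ### Gaussian bounds -/

theorem one_add_sq_pow_mul_exp_le (n : ℕ) :
    ∃ C, 0 ≤ C ∧ ∀ z : ℝ, (1 + z ^ 2) ^ n * Real.exp (-z ^ 2 / 8) ≤ C := by
  refine ⟨8 ^ n * n.factorial * Real.exp (1 / 8), by positivity, fun z => ?_⟩
  have h := Real.pow_div_factorial_le_exp (x := (1 + z ^ 2) / 8) (by positivity) n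
  rw [div_le_iff₀ (by positivity), div_pow, div_le_iff₀ (by positivity)] at h
  calc (1 + z ^ 2) ^ n * Real.exp (-z ^ 2 / 8)
      ≤ (Real.exp ((1 + z ^ 2) / 8) * n.factorial * 8 ^ n) * Real.exp (-z ^ 2 / 8) := by gcongr
    _ = 8 ^ n * n.factorial * (Real.exp ((1 + z ^ 2) / 8) * Real.exp (-z ^ 2 / 8)) := by ring
    _ = 8 ^ n * n.factorial * Real.exp (1 / 8) := by
        rw [← Real.exp_add]; congr 2; ring

theorem decays_of_le_gaussian {ψ : ℝ → ℝ} (n : ℕ) {M : ℝ} (hM : 0 ≤ M)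
    (h : ∀ z, |ψ z| ≤ M * (1 + z ^ 2) ^ n * Real.exp (-z ^ 2 / 8)) : Decays ψ := by
  obtain ⟨C, _, hC⟩ := one_add_sq_pow_mul_exp_le (n + 2)
  refine ⟨M * C, fun z => (h z).trans ?_⟩
  rw [mul_assoc M C, mul_assoc M]
  refine mul_le_mul_of_nonneg_left ?_ hM
  rw [← div_eq_mul_inv, le_div_iff₀ (by positivity)]
  refine le_trans (le_of_eq ?_) (hC z)
  ring

theorem decays_exp : Decays (fun z => Real.exp (-z ^ 2 / 8)) :=
  decays_of_le_gaussian 0 zero_le_one fun z => by simp [abs_of_pos (Real.exp_pos _)]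

theorem decays_mul_exp : Decays (fun z => z * Real.exp (-z ^ 2 / 8)) :=
  decays_of_le_gaussian 1 zero_le_one fun z => by
    rw [abs_mul, abs_of_pos (Real.exp_pos _)]
    gcongr
    nlinarith [sq_abs z, sq_nonneg (|z| - 1), abs_nonneg z]

theorem hasDerivAt_exp_neg_sq (z : ℝ) :
    HasDerivAt (fun z : ℝ => Real.exp (-z ^ 2 / 8)) (-(z / 4) * Real.exp (-z ^ 2 / 8)) z := by
  have h : HasDerivAt (fun z : ℝ => -z ^ 2 / 8) (-(z / 4)) z :=
    ((hasDerivAt_pow 2 z).neg.div_const 8).congr_deriv (by push_cast; ring)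
  exact h.exp.congr_deriv (by ring)

/-! ### The distributional equation `Hw = g` -/

theorem Hadj_eq {φ : ℝ → ℝ} (hφ : ContDiff ℝ ∞ φ) (z : ℝ) :
    Hadj φ z = -z * deriv (deriv φ) z + deriv φ z - z ^ 2 / 4 * deriv φ z := by
  have hd : ∀ y, HasDerivAt φ (deriv φ y) y := fun y =>
    (hφ.differentiable (by simp) y).hasDerivAt
  have hd2 : ∀ y, HasDerivAt (deriv φ) (deriv (deriv φ) y) y := fun y =>
    ((contDiff_infty_iff_deriv.1 hφ).2.differentiable (by simp) y).hasDerivAt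
  have h1 : deriv (fun y => y * φ y) = fun y => φ y + y * deriv φ y := funext fun y => by
    refine (((hasDerivAt_id y).mul (hd y)).congr_deriv ?_).deriv
    simp
  have h2 : iteratedDeriv 2 (fun y => y * φ y) z = 2 * deriv φ z + z * deriv (deriv φ) z := by
    rw [iteratedDeriv_succ, iteratedDeriv_one, h1]
    refine (((hd z).add ((hasDerivAt_id z).mul (hd2 z))).congr_deriv ?_).deriv
    simp
    ring
  rw [Hadj, h2]
  ring

theorem IsTest.Hadj {φ : ℝ → ℝ} (h : IsTest φ) : IsTest (Hadj φ) := by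
  have h1 : LogKdV.Hadj φ = fun z => (-z) * _root_.deriv (_root_.deriv φ) z + (1 - z ^ 2 / 4) * _root_.deriv φ z :=
    funext fun z => by rw [Hadj_eq h.1]; ring
  rw [h1]
  exact (h.deriv.deriv.mul_left contDiff_neg).add (h.deriv.mul_left (show ContDiff ℝ ∞ (fun z : ℝ => 1 - z ^ 2 / 4) by fun_prop))

theorem IsTest.memLp {φ : ℝ → ℝ} (h : IsTest φ) : MemLp φ 2 μneg :=
  (h.decays.memLp_two h.continuous).restrict _

theorem integrable_mul_of_decays (w : L2neg) {ψ : ℝ → ℝ} (h : Decays ψ) (hc : Continuous ψ) :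
    Integrable (fun z => w z * ψ z) μneg :=
  (Lp.memLp w).integrable_mul ((h.memLp_two hc).restrict _)

theorem IsTest.integrable_mul {φ : ℝ → ℝ} (h : IsTest φ) (w : L2neg) :
    Integrable (fun z => w z * φ z) μneg :=
  integrable_mul_of_decays w h.decays h.continuous

theorem IsTest.integrable_prim_mul {φ : ℝ → ℝ} (h : IsTest φ) (g : L2neg) :
    Integrable (fun z => prim g z * φ z) μneg :=
  h.decays.integrableOn_mul h.continuous measurableSet_Iio
    (continuous_prim (Lp.memLp g)).aestronglyMeasurable
      (by obtain ⟨B, hB⟩ := prim_bound (Lp.memLp g); exact ⟨B, fun z _ => hB z⟩)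

/-- The integrand in the representation formula of solutions of `Hw = g`. -/
def repIntegrand (C : ℝ) (g : ℝ → ℝ) (s : ℝ) : ℝ := (C + prim g s) * (s * Real.exp (-s ^ 2 / 8))

theorem continuous_repIntegrand (C : ℝ) (g : L2neg) : Continuous (repIntegrand C g) := by
  have := continuous_prim (Lp.memLp g)
  unfold repIntegrand
  fun_prop

/-- The primitive of `repIntegrand` vanishing at `0`. -/
def repPrim (C : ℝ) (g : ℝ → ℝ) (z : ℝ) : ℝ := ∫ s in (0 : ℝ)..z, repIntegrand C g s

theorem hasDerivAt_repPrim (C : ℝ) (g : L2neg) (z : ℝ) :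
    HasDerivAt (repPrim C g) (repIntegrand C g z) z :=
  intervalIntegral.integral_hasDerivAt_right
    ((continuous_repIntegrand C g).intervalIntegrable _ _)
    ((continuous_repIntegrand C g).stronglyMeasurableAtFilter _ _)
    (continuous_repIntegrand C g).continuousAt

theorem continuous_repPrim (C : ℝ) (g : L2neg) : Continuous (repPrim C g) :=
  continuous_iff_continuousAt.2 fun z => (hasDerivAt_repPrim C g z).continuousAt

/-- First integration of `Hw = g`. -/
theorem HasH.exists_first_integral {w g : L2neg} (h : HasH w g) :
    ∃ C : ℝ, ∀ ψ, IsTest ψ →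
      ∫ z in Iio (0 : ℝ), (w z * (-z * deriv ψ z + ψ z - z ^ 2 / 4 * ψ z) + prim g z * ψ z)
        = -C * ∫ z, ψ z := by
  have hT : ∀ ψ, IsTest ψ → IsTest (fun z => -z * deriv ψ z + ψ z - z ^ 2 / 4 * ψ z) := by
    intro ψ hψ
    have := (hψ.deriv.mul_left contDiff_neg).add (hψ.mul_left
      (show ContDiff ℝ ∞ (fun z : ℝ => 1 - z ^ 2 / 4) by fun_prop))
    convert this using 2 with z
    ring
  have hi : ∀ ψ, IsTest ψ → Integrable (fun z => w z * (-z * deriv ψ z + ψ z - z ^ 2 / 4 * ψ z)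
      + prim g z * ψ z) μneg := fun ψ hψ => ((hT ψ hψ).integrable_mul w).add
      (hψ.integrable_prim_mul g)
  -- On `ψ = φ'` the functional equals `∫ w H*φ - ∫ g φ`, which is zero by the equation; a
  -- functional vanishing on all derivatives is a constant.
  obtain ⟨C, hC⟩ := exists_const_of_vanish_deriv (fun ψ => ∫ z in Iio (0 : ℝ),
    (w z * (-z * deriv ψ z + ψ z - z ^ 2 / 4 * ψ z) + prim g z * ψ z)) (by
      intro φ ψ hφ hψ c
      rw [← integral_const_mul, ← integral_add (hi φ hφ) ((hi ψ hψ).const_mul c)]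
      congr 1; ext z
      have : deriv (fun z => φ z + c * ψ z) z = deriv φ z + c * deriv ψ z :=
        ((hφ.hasDerivAt z).add ((hψ.hasDerivAt z).const_mul c)).deriv
      rw [this]
      ring) (by
      intro φ hφ
      rw [integral_add ((hT _ hφ.deriv).integrable_mul w) (hφ.deriv.integrable_prim_mul g),
        integral_prim_mul_eq (Lp.memLp g) hφ.hasDerivAt hφ.deriv.continuous hφ.decays
          hφ.deriv.decays, ← h φ hφ.1 hφ.hasCompactSupport hφ.tsupport_subset, ← sub_eq_add_neg,
        sub_eq_zero]
      congr 1; ext z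
      rw [Hadj_eq hφ.1])
  exact ⟨-C, fun ψ hψ => by rw [hC ψ hψ, neg_neg]⟩

/-- Second integration of `Hw = g`. -/
theorem HasH.exists_second_integral {w g : L2neg} (h : HasH w g) :
    ∃ C K : ℝ, ∀ᵐ z ∂μneg, z ^ 2 * w z * Real.exp (-z ^ 2 / 8) + repPrim C g z = K := by
  obtain ⟨C, hC⟩ := h.exists_first_integral
  refine ⟨C, ae_eq_const_of_weakDeriv_eq_zero ?_ fun η hη => ?_⟩
  · refine LocallyIntegrable.add ?_ (continuous_repPrim C g).locallyIntegrable
    have hw : LocallyIntegrable w μneg := (Lp.memLp w).locallyIntegrable (by norm_num)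
    have hc : Continuous (fun z : ℝ => z ^ 2 * Real.exp (-z ^ 2 / 8)) := by fun_prop
    rw [locallyIntegrable_iff] at hw ⊢
    intro k hk
    have := (hw k hk).mul_continuousOn hc.continuousOn hk
    refine this.congr (Eventually.of_forall fun z => ?_)
    ring
  -- Testing with `z exp(-z²/8) η`, the integrating factor, cancels every term in which `w`
  -- multiplies `η` and leaves `w z² exp(-z²/8) η'`.
  · have hψ : IsTest (fun z => z * Real.exp (-z ^ 2 / 8) * η z) :=
      hη.mul_left (by fun_prop)
    have h1 := hC _ hψ
    have hd : ∀ z, deriv (fun z => z * Real.exp (-z ^ 2 / 8) * η z) z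
        = Real.exp (-z ^ 2 / 8) * (η z + z * deriv η z - z ^ 2 / 4 * η z) := by
      intro z
      refine ((((hasDerivAt_id z).mul (hasDerivAt_exp_neg_sq z)).mul
        (hη.hasDerivAt z)).congr_deriv ?_).deriv
      simp
      ring
    have i1 : Integrable (fun z => w z * (z ^ 2 * Real.exp (-z ^ 2 / 8) * deriv η z)) μneg :=
      (hη.deriv.mul_left (show ContDiff ℝ ∞ (fun z : ℝ => z ^ 2 * Real.exp (-z ^ 2 / 8))
        by fun_prop)).integrable_mul w
    have i2 : Integrable (fun z => prim g z * (z * Real.exp (-z ^ 2 / 8) * η z)) μneg :=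
      hψ.integrable_prim_mul g
    have hsplit : ∫ z in Iio (0 : ℝ), (w z * (z ^ 2 * Real.exp (-z ^ 2 / 8) * deriv η z))
        = ∫ z in Iio (0 : ℝ), repIntegrand C g z * η z := by
      have e1 : ∫ z in Iio (0 : ℝ), repIntegrand C g z * η z
          = C * (∫ z in Iio (0 : ℝ), z * Real.exp (-z ^ 2 / 8) * η z)
            + ∫ z in Iio (0 : ℝ), prim g z * (z * Real.exp (-z ^ 2 / 8) * η z) := by
        rw [← integral_const_mul, ← integral_add (hψ.integrable.integrableOn.const_mul C) i2]
        congr 1; ext z; unfold repIntegrand; ring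
      have e2 : ∫ z in Iio (0 : ℝ), z * Real.exp (-z ^ 2 / 8) * η z
          = ∫ z, z * Real.exp (-z ^ 2 / 8) * η z := hη.setIntegral_eq _
      rw [e1, e2]
      have e3 : ∀ z, w z * (-z * deriv (fun z => z * Real.exp (-z ^ 2 / 8) * η z) z
          + z * Real.exp (-z ^ 2 / 8) * η z - z ^ 2 / 4 * (z * Real.exp (-z ^ 2 / 8) * η z))
          + prim g z * (z * Real.exp (-z ^ 2 / 8) * η z)
          = prim g z * (z * Real.exp (-z ^ 2 / 8) * η z)
            - w z * (z ^ 2 * Real.exp (-z ^ 2 / 8) * deriv η z) := by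
        intro z; rw [hd]; ring
      simp only [e3] at h1
      rw [integral_sub i2 i1] at h1
      linarith
    have hpi : ∫ z, (repIntegrand C g z * η z + repPrim C g z * deriv η z) = 0 := by
      refine integral_eq_zero_of_hasDerivAt_of_integrable
        (f := fun z => repPrim C g z * η z)
        (fun z => (hasDerivAt_repPrim C g z).mul (hη.hasDerivAt z)) ?_ ?_
      · refine Continuous.integrable_of_hasCompactSupport ?_ ?_
        · have := continuous_repIntegrand C g
          have := continuous_repPrim C g
          have := hη.continuous
          have := hη.deriv.continuous
          fun_prop
        · exact (hη.hasCompactSupport.mul_left).add (hη.deriv.hasCompactSupport.mul_left)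
      · exact ((continuous_repPrim C g).mul hη.continuous).integrable_of_hasCompactSupport
          hη.hasCompactSupport.mul_left
    have j1 : Integrable (fun z => repIntegrand C g z * η z) :=
      ((continuous_repIntegrand C g).mul hη.continuous).integrable_of_hasCompactSupport
          hη.hasCompactSupport.mul_left
    have j2 : Integrable (fun z => repPrim C g z * deriv η z) :=
      ((continuous_repPrim C g).mul hη.deriv.continuous).integrable_of_hasCompactSupport
          hη.deriv.hasCompactSupport.mul_left
    rw [integral_add j1 j2, ← hη.setIntegral_eq, ← hη.deriv.setIntegral_eq, ← hsplit,
      ← integral_add i1 j2.integrableOn] at hpi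
    refine Eq.trans ?_ hpi
    congr 1; ext z; ring

/-! ### Representation of solutions of `Hw = g` -/

/-- Chebyshev's inequality on an interval. It is used to exclude a `z⁻²` singularity at `0`, on a
short interval, and a nonzero limit of the flux at `-∞`, on a long one. -/
theorem sq_mul_length_le_norm_sq (w : L2neg) {m α β : ℝ} (hm : 0 ≤ m) (hαβ : α ≤ β) (hβ : β ≤ 0)
    (h : ∀ᵐ z ∂μneg, z ∈ Ioo α β → m ≤ |w z|) : m ^ 2 * (β - α) ≤ ‖w‖ ^ 2 := by
  have h1 : ‖w‖ ^ 2 = ∫ z in Iio (0 : ℝ), w z ^ 2 := by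
    rw [← real_inner_self_eq_norm_sq, L2.inner_def]
    congr 1; ext z; simp [pow_two]
  have hi : IntegrableOn (fun z => w z ^ 2) (Iio 0) := (Lp.memLp w).integrable_sq
  have hsub : Ioo α β ⊆ Iio 0 := fun z hz => lt_of_lt_of_le hz.2 hβ
  have h2 : ∫ z in Ioo α β, w z ^ 2 ≤ ∫ z in Iio (0 : ℝ), w z ^ 2 :=
    setIntegral_mono_set hi (Eventually.of_forall fun z => sq_nonneg _) hsub.eventuallyLE
  have h3 : ∫ z in Ioo α β, m ^ 2 = m ^ 2 * (β - α) := by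
    simp [measureReal_def, ENNReal.toReal_ofReal (sub_nonneg.2 hαβ), mul_comm]
  rw [h1, ← h3]
  refine le_trans (setIntegral_mono_on_ae (integrableOn_const (by simp)) (hi.mono_set hsub)
    measurableSet_Ioo ?_) h2
  rw [ae_restrict_iff' measurableSet_Iio] at h
  filter_upwards [h] with z hz hzm
  rw [← sq_abs (w z)]
  exact pow_le_pow_left₀ hm (hz (hsub hzm) hzm) 2

/-- The value of the flux at `0`. -/
def gaussCoef (g : ℝ → ℝ) : ℝ := ∫ z in Iio (0 : ℝ), g z * Real.exp (-z ^ 2 / 8)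

theorem integrableOn_repIntegrand (C : ℝ) (g : L2neg) (b : ℝ) :
    IntegrableOn (repIntegrand C g) (Iic b) := by
  refine decays_mul_exp.integrableOn_mul (f := fun z => C + prim g z) (by fun_prop)
    measurableSet_Iic (continuous_const.add (continuous_prim (Lp.memLp g))).aestronglyMeasurable ?_
  obtain ⟨B, hB⟩ := prim_bound (Lp.memLp g)
  refine ⟨|C| + B, fun z _ => ?_⟩
  calc |C + prim g z| ≤ |C| + |prim g z| := abs_add_le _ _
    _ ≤ |C| * (1 + z ^ 2) + B * (1 + z ^ 2) := by
        gcongr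
        · nlinarith [abs_nonneg C, sq_nonneg z, mul_nonneg (abs_nonneg C) (sq_nonneg z)]
        · exact hB z
    _ = _ := by ring

theorem integral_repIntegrand (C : ℝ) (g : L2neg) :
    ∫ s in Iio (0 : ℝ), repIntegrand C g s = -4 * C + 4 * gaussCoef g := by
  have hd : ∀ z : ℝ, HasDerivAt (fun z : ℝ => -4 * Real.exp (-z ^ 2 / 8))
      (z * Real.exp (-z ^ 2 / 8)) z := fun z =>
    ((hasDerivAt_exp_neg_sq z).const_mul (-4)).congr_deriv (by ring)
  have hdec : Decays (fun z : ℝ => -4 * Real.exp (-z ^ 2 / 8)) :=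
    decays_of_le_gaussian 0 (M := 4) (by norm_num) fun z => by
      simp [abs_mul, abs_of_pos (Real.exp_pos _)]
  have hc : Continuous (fun z : ℝ => z * Real.exp (-z ^ 2 / 8)) := by fun_prop
  have h1 := integral_prim_mul_eq (Lp.memLp g) hd hc hdec decays_mul_exp
  have h2 : ∫ z in Iio (0 : ℝ), z * Real.exp (-z ^ 2 / 8) = -4 := by
    rw [← integral_Iic_eq_integral_Iio, integral_Iic_of_hasDerivAt_of_tendsto' (m := 0)
      (fun z _ => hd z) (decays_mul_exp.integrable hc).integrableOn]
    · simp
    · refine tendsto_zero_of_hasDerivAt_of_integrableOn_Iic (a := 0) (fun z _ => hd z)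
        (decays_mul_exp.integrable hc).integrableOn (hdec.integrable (by fun_prop)).integrableOn
  have i1 : Integrable (fun z => C * (z * Real.exp (-z ^ 2 / 8))) μneg :=
    ((decays_mul_exp.integrable hc).integrableOn.const_mul C)
  have i2 : Integrable (fun z => prim g z * (z * Real.exp (-z ^ 2 / 8))) μneg :=
    decays_mul_exp.integrableOn_mul hc measurableSet_Iio
      (continuous_prim (Lp.memLp g)).aestronglyMeasurable
      (by obtain ⟨B, hB⟩ := prim_bound (Lp.memLp g); exact ⟨B, fun z _ => hB z⟩)
  unfold repIntegrand gaussCoef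
  simp only [add_mul]
  rw [integral_add i1 i2, h1, integral_const_mul, h2]
  have h3 : ∫ z in Iio (0 : ℝ), g z * (-4 * Real.exp (-z ^ 2 / 8))
      = -4 * ∫ z in Iio (0 : ℝ), g z * Real.exp (-z ^ 2 / 8) := by
    rw [← integral_const_mul]
    congr 1; ext z; ring
  rw [h3]
  ring

theorem tendsto_repPrim_atBot (C : ℝ) (g : L2neg) :
    Tendsto (repPrim C g) atBot (𝓝 (4 * C - 4 * gaussCoef g)) := by
  have h := intervalIntegral_tendsto_integral_Iic 0 (integrableOn_repIntegrand C g 0) tendsto_id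
  rw [integral_Iic_eq_integral_Iio, integral_repIntegrand] at h
  have h2 := h.neg
  simp only [id, ← intervalIntegral.integral_symm] at h2
  rw [show 4 * C - 4 * gaussCoef g = -(-4 * C + 4 * gaussCoef g) by ring]
  exact h2

/-- Both constants of integration are forced by `w ∈ L²`. If `K ≠ 0`, then `w ~ K/z²` near `0`; if
`C` is not `gaussCoef g`, then `repPrim` has a nonzero limit at `-∞` and `w` grows like
`exp(z²/8)/z²`. -/
theorem HasH.sq_mul_ae_eq {w g : L2neg} (h : HasH w g) :
    ∀ᵐ z ∂μneg, z ^ 2 * w z * Real.exp (-z ^ 2 / 8) = -repPrim (gaussCoef g) g z := by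
  obtain ⟨C, K, hCK⟩ := h.exists_second_integral
  have hK : K = 0 := by
    by_contra hK
    have hpos : 0 < |K| := abs_pos.2 hK
    have h0 : Tendsto (repPrim C g) (𝓝 0) (𝓝 0) := by
      have := (continuous_repPrim C g).tendsto 0
      simpa [repPrim] using this
    obtain ⟨r₀, hr₀, hr⟩ := Metric.tendsto_nhds_nhds.1 h0 (|K| / 2) (by positivity)
    -- On `(-r, 0)` one has `|w| ≥ |K|/(2r²)`, so `‖w‖² ≥ K²/(4r³)`. The bounds `r ≤ 1` and `r ≤
    -- K²/(8(‖w‖² + 1))` contradict this.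
    set r := min r₀ (min 1 (K ^ 2 / (8 * (‖w‖ ^ 2 + 1)))) with hrdef
    have hrpos : 0 < r := by positivity
    have hb := sq_mul_length_le_norm_sq w (m := |K| / (2 * r ^ 2)) (α := -r) (β := 0)
      (by positivity) (by linarith) le_rfl (by
        filter_upwards [hCK] with z hz hzm
        have h1 : |repPrim C g z| < |K| / 2 := by
          have : dist z 0 < r₀ := by
            rw [Real.dist_eq, sub_zero, abs_of_neg hzm.2]
            have := min_le_left r₀ (min 1 (K ^ 2 / (8 * (‖w‖ ^ 2 + 1))))
            linarith [hzm.1]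
          simpa using hr this
        have h2 : |K| ≤ |z ^ 2 * w z * Real.exp (-z ^ 2 / 8)| + |repPrim C g z| := by
          nth_rewrite 1 [← hz]; exact abs_add_le _ _
        have h3 : |z ^ 2 * w z * Real.exp (-z ^ 2 / 8)| ≤ r ^ 2 * |w z| := by
          rw [abs_mul, abs_mul, abs_of_nonneg (sq_nonneg z), abs_of_pos (Real.exp_pos _)]
          have h4 : Real.exp (-z ^ 2 / 8) ≤ 1 := Real.exp_le_one_iff.2 (by nlinarith [sq_nonneg z])
          have h5 : z ^ 2 ≤ r ^ 2 := by nlinarith [hzm.1, hzm.2]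
          calc z ^ 2 * |w z| * Real.exp (-z ^ 2 / 8) ≤ r ^ 2 * |w z| * 1 := by gcongr
            _ = _ := mul_one _
        rw [div_le_iff₀ (by positivity)]
        linarith)
    have h6 : (|K| / (2 * r ^ 2)) ^ 2 * (0 - -r) = K ^ 2 / (4 * r ^ 3) := by
      rw [div_pow, sq_abs]; field_simp; ring
    rw [h6, div_le_iff₀ (by positivity)] at hb
    have h7 : r ≤ K ^ 2 / (8 * (‖w‖ ^ 2 + 1)) := (min_le_right _ _).trans (min_le_right _ _)
    have h8 : r ≤ 1 := (min_le_right _ _).trans (min_le_left _ _)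
    rw [le_div_iff₀ (by positivity)] at h7
    have h9 : r ^ 3 ≤ r := by
      calc r ^ 3 = r * r ^ 2 := by ring
        _ ≤ r * 1 := by gcongr; exact pow_le_one₀ hrpos.le h8
        _ = r := mul_one r
    have h10 : ‖w‖ ^ 2 * (4 * r ^ 3) ≤ ‖w‖ ^ 2 * (4 * r) := by gcongr
    have h11 : 0 < K ^ 2 := by positivity
    nlinarith
  subst hK
  have hC : C = gaussCoef g := by
    by_contra hne
    set Q := 4 * C - 4 * gaussCoef g with hQ
    have hQ0 : Q ≠ 0 := by
      intro h0
      exact hne (by linarith)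
    have hpos : 0 < |Q| := abs_pos.2 hQ0
    have hlim := (tendsto_repPrim_atBot C g).abs.eventually
      (lt_mem_nhds (show |Q| / 2 < |Q| by linarith))
    obtain ⟨R, hR⟩ := eventually_atBot.1 hlim
    -- Far out `|repPrim| > |Q|/2`, and `z² exp(-z²/8) ≤ 8`, so `|w| ≥ |Q|/16` on an interval of
    -- arbitrary length `n`.
    obtain ⟨n, hn⟩ := exists_nat_gt (‖w‖ ^ 2 / (|Q| / 16) ^ 2)
    set β := min R 0 with hβ
    have hb := sq_mul_length_le_norm_sq w (m := |Q| / 16) (α := β - n) (β := β)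
      (by positivity) (by linarith [(Nat.cast_nonneg n : (0 : ℝ) ≤ n)]) (min_le_right _ _) (by
        filter_upwards [hCK] with z hz hzm
        have h1 := hR z (hzm.2.le.trans (min_le_left _ _))
        have h2 : |repPrim C g z| = z ^ 2 * Real.exp (-z ^ 2 / 8) * |w z| := by
          have : repPrim C g z = -(z ^ 2 * w z * Real.exp (-z ^ 2 / 8)) := by linarith
          rw [this, abs_neg, abs_mul, abs_mul, abs_of_nonneg (sq_nonneg z),
            abs_of_pos (Real.exp_pos _)]
          ring
        have h3 : z ^ 2 * Real.exp (-z ^ 2 / 8) ≤ 8 := by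
          have h4 := Real.add_one_le_exp (z ^ 2 / 8)
          have h5 : Real.exp (z ^ 2 / 8) * Real.exp (-z ^ 2 / 8) = 1 := by
            rw [← Real.exp_add, show z ^ 2 / 8 + -z ^ 2 / 8 = 0 by ring, Real.exp_zero]
          nlinarith [Real.exp_pos (-z ^ 2 / 8)]
        have h6 : z ^ 2 * Real.exp (-z ^ 2 / 8) * |w z| ≤ 8 * |w z| := by gcongr
        rw [h2] at h1
        linarith)
    rw [div_lt_iff₀ (by positivity)] at hn
    have : (|Q| / 16) ^ 2 * (β - (β - n)) = n * (|Q| / 16) ^ 2 := by ring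
    linarith
  filter_upwards [hCK] with z hz
  rw [hC] at hz
  linarith

/-- The continuous representative of `H⁻¹ g`. -/
def hInv (g : ℝ → ℝ) (z : ℝ) : ℝ :=
  if z = 0 then -gaussCoef g / 2
  else -repPrim (gaussCoef g) g z * Real.exp (z ^ 2 / 8) / z ^ 2

theorem HasH.ae_eq_hInv {w g : L2neg} (h : HasH w g) : w =ᵐ[μneg] hInv g := by
  filter_upwards [h.sq_mul_ae_eq, ae_restrict_mem measurableSet_Iio] with z hz hm
  have hm0 : z ≠ 0 := ne_of_lt hm
  rw [hInv, if_neg hm0, ← hz, eq_div_iff (by positivity), mul_assoc, ← Real.exp_add,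
    show -z ^ 2 / 8 + z ^ 2 / 8 = 0 by ring, Real.exp_zero]
  ring

theorem HasH.injective {w w' g : L2neg} (h : HasH w g) (h' : HasH w' g) : w = w' :=
  Lp.ext (h.ae_eq_hInv.trans h'.ae_eq_hInv.symm)

/-- Numerator and denominator `z² exp(-z²/8)` both vanish at `0`. By L'Hôpital the quotient behaves
like `-(C + prim g z)/(2 - z²/4)`, where `prim g` vanishes at `0`. -/
theorem tendsto_hInv_zero (g : L2neg) : Tendsto (hInv g) (𝓝[<] 0) (𝓝 (-gaussCoef g / 2)) := by
  set C := gaussCoef g with hC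
  have h1 : Tendsto (fun z => -repPrim C g z / (z ^ 2 * Real.exp (-z ^ 2 / 8))) (𝓝[<] 0)
      (𝓝 (-C / 2)) := by
    have hf' : ∀ z : ℝ, HasDerivAt (fun z => -repPrim C g z) (-repIntegrand C g z) z := fun z =>
      (hasDerivAt_repPrim C g z).neg
    have hg' : ∀ z : ℝ, HasDerivAt (fun z : ℝ => z ^ 2 * Real.exp (-z ^ 2 / 8))
        ((2 * z - z ^ 3 / 4) * Real.exp (-z ^ 2 / 8)) z := fun z =>
      ((hasDerivAt_pow 2 z).mul (hasDerivAt_exp_neg_sq z)).congr_deriv (by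
        push_cast; ring)
    refine HasDerivAt.lhopital_zero_left_on_Ioo (a := -1) (b := 0) (by norm_num)
      (fun z _ => hf' z) (fun z _ => hg' z) ?_ ?_ ?_ ?_
    · intro z hz
      have h2 : 2 * z - z ^ 3 / 4 < 0 := by
        nlinarith [hz.1, hz.2, mul_pos (neg_pos.2 hz.2) (by nlinarith [hz.1, hz.2] : 0 < 8 - z ^ 2)]
      exact (mul_neg_of_neg_of_pos h2 (Real.exp_pos _)).ne
    · have h00 : repPrim C g 0 = 0 := by simp [repPrim]
      have := (((continuous_repPrim C g).tendsto 0).neg).mono_left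
        (nhdsWithin_le_nhds (s := Iio (0 : ℝ)))
      simpa [h00] using this
    · have : Continuous (fun z : ℝ => z ^ 2 * Real.exp (-z ^ 2 / 8)) := by fun_prop
      have := (this.tendsto 0).mono_left (nhdsWithin_le_nhds (s := Iio (0 : ℝ)))
      simpa using this
    · have h3 : Tendsto (fun z => -(C + prim g z) / (2 - z ^ 2 / 4)) (𝓝[<] 0) (𝓝 (-C / 2)) := by
        have hc : ContinuousAt (fun z => -(C + prim g z) / (2 - z ^ 2 / 4)) 0 := by
          refine ContinuousAt.div ?_ (by fun_prop) (by norm_num)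
          exact (continuous_const.add (continuous_prim (Lp.memLp g))).neg.continuousAt
        have := hc.tendsto.mono_left (nhdsWithin_le_nhds (s := Iio (0 : ℝ)))
        simpa [prim] using this
      refine h3.congr' ?_
      filter_upwards [Ioo_mem_nhdsLT (show (-1 : ℝ) < 0 by norm_num)] with z hz
      have hz0 : z ≠ 0 := ne_of_lt hz.2
      have h4 : 2 - z ^ 2 / 4 ≠ 0 := by nlinarith [hz.1, hz.2]
      have h5 : 2 * z - z ^ 3 / 4 = z * (2 - z ^ 2 / 4) := by ring
      have h6 := (Real.exp_pos (-z ^ 2 / 8)).ne'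
      rw [h5, repIntegrand, div_eq_div_iff h4 (by positivity)]
      ring
  refine h1.congr' ?_
  filter_upwards [self_mem_nhdsWithin] with z hz
  have hz0 : z ≠ 0 := ne_of_lt hz
  rw [hInv, if_neg hz0, div_eq_div_iff (by positivity) (by positivity)]
  have h6 : Real.exp (z ^ 2 / 8) * Real.exp (-z ^ 2 / 8) = 1 := by
    rw [← Real.exp_add, show z ^ 2 / 8 + -z ^ 2 / 8 = 0 by ring, Real.exp_zero]
  linear_combination repPrim C g z * z ^ 2 * h6

theorem continuousOn_hInv (g : L2neg) : ContinuousOn (hInv g) (Iic 0) := by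
  intro z hz
  rcases (mem_Iic.1 hz).lt_or_eq with h | rfl
  · have hz0 : z ≠ 0 := ne_of_lt h
    have hc : ContinuousAt (fun z => -repPrim (gaussCoef g) g z * Real.exp (z ^ 2 / 8) / z ^ 2) z := by
      refine ContinuousAt.div ?_ (by fun_prop) (by positivity)
      exact (continuous_repPrim _ g).neg.continuousAt.mul (by fun_prop)
    refine (hc.congr ?_).continuousWithinAt
    filter_upwards [isOpen_ne.mem_nhds hz0] with y hy
    rw [hInv, if_neg hy]
  · rw [← continuousWithinAt_Iio_iff_Iic]
    have := tendsto_hInv_zero g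
    rw [ContinuousWithinAt]
    convert this using 2
    simp [hInv]

theorem HasH.hasTrace {w g : L2neg} (h : HasH w g) : HasTrace w (-gaussCoef g / 2) :=
  ⟨hInv g, continuousOn_hInv g, h.ae_eq_hInv, by simp [hInv]⟩

/-- Green's identity, with the boundary term at `0`. -/
theorem HasH.green {w g : L2neg} (h : HasH w g) {ψ : ℝ → ℝ} (hψ : ContDiff ℝ ∞ ψ)
    (h0 : Decays ψ) (h1 : Decays (deriv ψ)) (h1z : Decays (fun z => z * deriv ψ z))
    (h2 : Decays (Hadj ψ)) (hHc : Continuous (Hadj ψ)) :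
    ∫ z in Iio (0 : ℝ), w z * Hadj ψ z
      = (∫ z in Iio (0 : ℝ), g z * ψ z) - gaussCoef g * ψ 0 := by
  set C := gaussCoef g with hC
  have hψ' := (contDiff_infty_iff_deriv.1 hψ).2
  have hd : ∀ y, HasDerivAt ψ (deriv ψ y) y := fun y =>
    (hψ.differentiable (by simp) y).hasDerivAt
  have hd2 : ∀ y, HasDerivAt (deriv ψ) (deriv (deriv ψ) y) y := fun y =>
    (hψ'.differentiable (by simp) y).hasDerivAt
  have i1 : Integrable (fun z => w z * Hadj ψ z) μneg := integrable_mul_of_decays w h2 hHc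
  have i1' : Integrable (fun z => hInv g z * Hadj ψ z) μneg := i1.congr (by
    filter_upwards [h.ae_eq_hInv] with z hz; rw [hz])
  have i2 : Integrable (fun z => prim g z * deriv ψ z) μneg :=
    h1.integrableOn_mul hψ'.continuous measurableSet_Iio
      (continuous_prim (Lp.memLp g)).aestronglyMeasurable
      (by obtain ⟨B, hB⟩ := prim_bound (Lp.memLp g); exact ⟨B, fun z _ => hB z⟩)
  have i3 : Integrable (fun z => C * deriv ψ z) μneg :=
    (h1.integrable hψ'.continuous).integrableOn.const_mul C
  have i4 : Integrable (fun z => -(hInv g z * (z * deriv ψ z))) μneg :=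
    ((integrable_mul_of_decays w h1z (continuous_id.mul hψ'.continuous)).congr (by
      filter_upwards [h.ae_eq_hInv] with z hz; rw [hz])).neg
  -- By the first integral of `Hw = g`, the derivative of `-z w ψ'` is `w H*ψ + (C + prim g) ψ'`.
  -- The primitive itself vanishes at `0` and at `-∞`; the boundary term of the identity comes from
  -- `∫ C ψ' = C ψ(0)`.
  have hder : ∀ z ∈ Iio (0 : ℝ), HasDerivAt (fun z => -(hInv g z * (z * deriv ψ z)))
      (hInv g z * Hadj ψ z + (C * deriv ψ z + prim g z * deriv ψ z)) z := by
    intro z hz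
    have hz0 : z ≠ 0 := ne_of_lt hz
    have hexp : HasDerivAt (fun z : ℝ => Real.exp (z ^ 2 / 8)) (z / 4 * Real.exp (z ^ 2 / 8)) z := by
      have : HasDerivAt (fun z : ℝ => z ^ 2 / 8) (z / 4) z :=
        ((hasDerivAt_pow 2 z).div_const 8).congr_deriv (by push_cast; ring)
      exact this.exp.congr_deriv (by ring)
    have hm := (((hasDerivAt_repPrim C g z).mul hexp).mul (hd2 z)).mul (hasDerivAt_inv hz0)
    have heq : (fun z => -(hInv g z * (z * deriv ψ z))) =ᶠ[𝓝 z]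
        fun y => repPrim C g y * Real.exp (y ^ 2 / 8) * deriv ψ y * y⁻¹ := by
      filter_upwards [isOpen_ne.mem_nhds hz0] with y hy
      have hy' : y ≠ 0 := hy
      rw [hInv, if_neg hy', ← hC]
      field_simp
    refine (hm.congr_of_eventuallyEq heq).congr_deriv ?_
    rw [Hadj_eq hψ, hInv, if_neg hz0, ← hC, repIntegrand]
    have h6 : Real.exp (-z ^ 2 / 8) = (Real.exp (z ^ 2 / 8))⁻¹ := by
      rw [← Real.exp_neg]; congr 1; ring
    rw [h6]
    simp only [Pi.mul_apply]
    field_simp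
    ring
  have isum := i1'.add (i3.add i2)
  have hcont : ContinuousWithinAt (fun z => -(hInv g z * (z * deriv ψ z))) (Iic 0) 0 :=
    (((continuousOn_hInv g) 0 (mem_Iic.2 le_rfl)).mul
      (continuous_id.mul hψ'.continuous).continuousWithinAt).neg
  have hsub : Iic (-1 : ℝ) ⊆ Iio 0 := Iic_subset_Iio.2 (by norm_num)
  have hlim : Tendsto (fun z => -(hInv g z * (z * deriv ψ z))) atBot (𝓝 0) :=
    tendsto_zero_of_hasDerivAt_of_integrableOn_Iic (a := -1)
      (fun z hz => hder z (hsub hz)) (IntegrableOn.mono_set isum hsub)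
      (IntegrableOn.mono_set i4 hsub)
  have hfin := integral_Iic_of_hasDerivAt_of_tendsto hcont hder
    ((integrableOn_Iic_iff_integrableOn_Iio (by simp)).2 isum) hlim
  have e1 : ∫ z in Iio (0 : ℝ), hInv g z * Hadj ψ z = ∫ z in Iio (0 : ℝ), w z * Hadj ψ z :=
    integral_congr_ae (by filter_upwards [h.ae_eq_hInv] with z hz; rw [hz])
  have e2 : ∫ z in Iio (0 : ℝ), deriv ψ z = ψ 0 := by
    rw [← integral_Iic_eq_integral_Iio, integral_Iic_of_hasDerivAt_of_tendsto' (fun z _ => hd z)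
      (h1.integrable hψ'.continuous).integrableOn
      (tendsto_zero_of_hasDerivAt_of_integrableOn_Iic (a := 0) (fun z _ => hd z)
      (h1.integrable hψ'.continuous).integrableOn (h0.integrable hψ.continuous).integrableOn),
      sub_zero]
  have i5 : Integrable (fun z => C * deriv ψ z + prim g z * deriv ψ z) μneg := i3.add i2
  rw [integral_Iic_eq_integral_Iio, integral_add i1' i5, integral_add i3 i2, e1,
    integral_const_mul, e2, integral_prim_mul_eq (Lp.memLp g) hd hψ'.continuous h0 h1] at hfin
  simp only [zero_mul, mul_zero, neg_zero, sub_zero] at hfin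
  linarith

/-! ### Coercivity and the inverse of `H` -/

theorem integral_deriv_eq_zero_of_isTest {F F' : ℝ → ℝ} (hd : ∀ z ∈ Iio (0 : ℝ), HasDerivAt F (F' z) z)
    {φ : ℝ → ℝ} (hφ : IsTest φ) (hF : ∀ z, φ z = 0 → F z = 0)
    (hc : ContinuousWithinAt F (Iic 0) 0) (hi : IntegrableOn F' (Iio 0)) :
    ∫ z in Iio (0 : ℝ), F' z = 0 := by
  have hlim : Tendsto F atBot (𝓝 0) := by
    obtain ⟨_, a, b, hb, h0⟩ := hφ
    refine tendsto_const_nhds.congr' ?_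
    filter_upwards [eventually_lt_atBot a] with z hz
    exact (hF z (h0 z fun h => absurd h.1 (not_le.2 hz))).symm
  have := integral_Iic_of_hasDerivAt_of_tendsto hc hd
    ((integrableOn_Iic_iff_integrableOn_Iio (by simp)).2 hi) hlim
  rw [integral_Iic_eq_integral_Iio] at this
  rw [this, hF 0 (hφ.eq_zero le_rfl), sub_zero]

/-- Dissipativity of the formal adjoint of `H` on test functions. -/
theorem integral_mul_Hadj_le {φ : ℝ → ℝ} (h : IsTest φ) :
    ∫ z in Iio (0 : ℝ), φ z * Hadj φ z ≤ -(1 / 2) * ∫ z in Iio (0 : ℝ), φ z * φ z := by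
  have hc := h.continuous
  have hc' := h.deriv.continuous
  have hc'' := h.deriv.deriv.continuous
  have hH := h.Hadj.continuous
  have hI : ∀ q : ℝ → ℝ, Continuous q → IntegrableOn (fun z => φ z * q z) (Iio 0) := fun q hq =>
    ((hc.mul hq).integrable_of_hasCompactSupport h.hasCompactSupport.mul_right).integrableOn
  set F : ℝ → ℝ := fun z => -z * φ z * deriv φ z + φ z ^ 2 - z ^ 2 * φ z ^ 2 / 8 + z * φ z ^ 2 / 2
    with hF
  -- Up to exact derivatives, `φ H*φ` is `z (φ'² + φ²/4)`. Completing the square produces `z (φ' -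
  -- φ/2)² ≤ 0` and the cross term `z φ φ'`, which integrates to `-φ²/2`.
  set F' : ℝ → ℝ := fun z => φ z * Hadj φ z - z * (deriv φ z - φ z / 2) ^ 2 + 1 / 2 * (φ z * φ z)
    with hF'
  have hd : ∀ z, HasDerivAt F (F' z) z := by
    intro z
    have d1 := h.hasDerivAt z
    have d2 := h.deriv.hasDerivAt z
    have dz := hasDerivAt_id' z
    refine ((((dz.neg.mul d1).mul d2).add (d1.pow 2)).sub
      (((dz.pow 2).mul (d1.pow 2)).div_const 8)|>.add
      ((dz.mul (d1.pow 2)).div_const 2)).congr_deriv ?_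
    simp only [hF', Hadj_eq h.1, Pi.mul_apply, Pi.neg_apply, Pi.pow_apply]
    push_cast
    ring
  have i1 := hI _ hH
  have i2 := hI _ hc
  have i3 : IntegrableOn (fun z => z * (deriv φ z - φ z / 2) ^ 2) (Iio 0) := by
    refine Integrable.integrableOn (Continuous.integrable_of_hasCompactSupport (by fun_prop) ?_)
    obtain ⟨_, a, b, hb, h0⟩ := id h
    refine HasCompactSupport.intro (K := tsupport φ) h.hasCompactSupport fun z hz => ?_
    have e1 := image_eq_zero_of_notMem_tsupport hz
    have e2 : deriv φ z = 0 := image_eq_zero_of_notMem_tsupport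
      fun hz' => hz (tsupport_deriv_subset hz')
    simp [e1, e2]
  have hz := integral_deriv_eq_zero_of_isTest (F := F) (F' := F') (fun z _ => hd z) h
    (fun z hz => by simp [hF, hz]) (hd 0).continuousAt.continuousWithinAt
    ((i1.sub i3).add (i2.const_mul (1 / 2)))
  have e : ∫ z in Iio (0 : ℝ), F' z = (∫ z in Iio (0 : ℝ), φ z * Hadj φ z)
      - (∫ z in Iio (0 : ℝ), z * (deriv φ z - φ z / 2) ^ 2)
      + 1 / 2 * ∫ z in Iio (0 : ℝ), φ z * φ z := by
    have i13 : Integrable (fun z => φ z * Hadj φ z - z * (deriv φ z - φ z / 2) ^ 2) μneg :=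
      i1.sub i3
    rw [← integral_const_mul, ← integral_sub i1 i3, ← integral_add i13 (i2.const_mul (1 / 2))]
  have hneg : ∫ z in Iio (0 : ℝ), z * (deriv φ z - φ z / 2) ^ 2 ≤ 0 :=
    setIntegral_nonpos measurableSet_Iio fun z hz =>
      mul_nonpos_of_nonpos_of_nonneg (le_of_lt hz) (sq_nonneg _)
  linarith

/-- Weighted dissipativity of the formal adjoint of `H` on test functions. -/
theorem integral_weighted_mul_Hadj_le {φ : ℝ → ℝ} (h : IsTest φ) :
    ∫ z in Iio (0 : ℝ), φ z * (Hadj φ z / (1 - z)) ≤ -(1 / 8) * ∫ z in Iio (0 : ℝ), φ z * φ z := by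
  have hc := h.continuous
  have hc' := h.deriv.continuous
  have hH := h.Hadj.continuous
  set F : ℝ → ℝ := fun z => -(z / (1 - z)) * φ z * deriv φ z
    + (1 / (1 - z) ^ 2 + 1 / (1 - z) - z ^ 2 / (4 * (1 - z))) * φ z ^ 2 / 2 with hF
  -- The nonpositive remainder. The coefficient of `φ²` inside the parentheses simplifies to `(1 -
  -- z)⁻³ + (3/8) (1 - z)⁻²`; the constant `1/8` is what is left when `(1 - z)⁻² → 0`.
  set R : ℝ → ℝ := fun z => z / (1 - z) * deriv φ z ^ 2
    - (1 / (1 - z) ^ 3 + 1 / (2 * (1 - z) ^ 2) + (1 - 1 / (1 - z) ^ 2) / 8 - 1 / 8) * φ z ^ 2 with hR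
  set F' : ℝ → ℝ := fun z => φ z * (Hadj φ z / (1 - z)) - R z + 1 / 8 * (φ z * φ z) with hF'
  have hd : ∀ z ∈ Iio (0 : ℝ), HasDerivAt F (F' z) z := by
    intro z hz
    have h1z : 1 - z ≠ 0 := by have : z < 0 := hz; linarith
    have d1 := h.hasDerivAt z
    have d2 := h.deriv.hasDerivAt z
    have dz := hasDerivAt_id' z
    have dq : HasDerivAt (fun z : ℝ => 1 - z) (-1) z := dz.const_sub 1
    have dA : HasDerivAt (fun z : ℝ => -(z / (1 - z))) (-(1 / (1 - z) ^ 2)) z :=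
      (dz.div dq h1z).neg.congr_deriv (by simp)
    have dB : HasDerivAt (fun z : ℝ => 1 / (1 - z) ^ 2 + 1 / (1 - z) - z ^ 2 / (4 * (1 - z)))
        (2 / (1 - z) ^ 3 + 1 / (1 - z) ^ 2 - (2 * z - z ^ 2) / (4 * (1 - z) ^ 2)) z := by
      refine ((((hasDerivAt_const z (1 : ℝ)).div (dq.pow 2) (pow_ne_zero 2 h1z)).add
        ((hasDerivAt_const z (1 : ℝ)).div dq h1z)).sub
        ((dz.pow 2).div (dq.const_mul 4) (mul_ne_zero four_ne_zero h1z))).congr_deriv ?_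
      simp only [Pi.pow_apply]
      field_simp
      ring
    refine (((dA.mul d1).mul d2).add ((dB.mul (d1.pow 2)).div_const 2)).congr_deriv ?_
    simp only [hF', hR, Hadj_eq h.1, Pi.mul_apply, Pi.pow_apply]
    push_cast
    field_simp
    ring
  have hco : ContinuousOn (fun z : ℝ => (1 - z)⁻¹) (Iic 0) :=
    ContinuousOn.inv₀ (by fun_prop) fun z hz => by
      have : z ≤ 0 := hz
      linarith
  have hI : ∀ q : ℝ → ℝ, ContinuousOn q (Iic 0) → (∀ z, z ∉ tsupport φ → q z = 0) →
      IntegrableOn q (Iio 0) := by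
    intro q hq hq0
    have hsub : tsupport φ ⊆ Iio 0 := h.tsupport_subset
    have h1 : IntegrableOn q (tsupport φ) :=
      (hq.mono (hsub.trans Iio_subset_Iic_self)).integrableOn_compact h.hasCompactSupport
    exact (integrableOn_iff_integrable_of_support_subset (fun z hz => by
      by_contra hzs; exact hz (hq0 z hzs))).1 h1 |>.integrableOn
  have e1 : ∀ z, z ∉ tsupport φ → φ z = 0 := fun z hz => image_eq_zero_of_notMem_tsupport hz
  have e2 : ∀ z, z ∉ tsupport φ → deriv φ z = 0 := fun z hz =>
    image_eq_zero_of_notMem_tsupport fun hz' => hz (tsupport_deriv_subset hz')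
  have i1 : IntegrableOn (fun z => φ z * (Hadj φ z / (1 - z))) (Iio 0) :=
    hI _ (hc.continuousOn.mul (hH.continuousOn.mul hco))
      fun z hz => by simp [e1 z hz]
  have i2 : IntegrableOn (fun z => φ z * φ z) (Iio 0) :=
    hI _ (by fun_prop) fun z hz => by simp [e1 z hz]
  have i3 : IntegrableOn R (Iio 0) := by
    refine hI _ ?_ fun z hz => by simp [hR, e1 z hz, e2 z hz]
    have : R = fun z => z * (1 - z)⁻¹ * deriv φ z ^ 2 - ((1 - z)⁻¹ ^ 3 + (1 - z)⁻¹ ^ 2 / 2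
        + (1 - (1 - z)⁻¹ ^ 2) / 8 - 1 / 8) * φ z ^ 2 := by
      ext z
      simp only [hR, div_eq_mul_inv, mul_inv, inv_pow]
      ring
    rw [this]
    fun_prop
  have hcF : ContinuousWithinAt F (Iic 0) 0 := by
    have : F = fun z => -(z * (1 - z)⁻¹) * φ z * deriv φ z
        + ((1 - z)⁻¹ ^ 2 + (1 - z)⁻¹ - z ^ 2 * (1 - z)⁻¹ / 4) * φ z ^ 2 / 2 := by
      ext z
      simp only [hF, div_eq_mul_inv, mul_inv, inv_pow]
      ring
    have hF2 : ContinuousOn F (Iic 0) := by rw [this]; fun_prop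
    exact hF2 0 (mem_Iic.2 le_rfl)
  have hz := integral_deriv_eq_zero_of_isTest (F := F) (F' := F') hd h
    (fun z hz => by simp [hF, hz]) hcF ((i1.sub i3).add (i2.const_mul (1 / 8)))
  have e : ∫ z in Iio (0 : ℝ), F' z = (∫ z in Iio (0 : ℝ), φ z * (Hadj φ z / (1 - z)))
      - (∫ z in Iio (0 : ℝ), R z) + 1 / 8 * ∫ z in Iio (0 : ℝ), φ z * φ z := by
    have i13 : Integrable (fun z => φ z * (Hadj φ z / (1 - z)) - R z) μneg := i1.sub i3
    rw [← integral_const_mul, ← integral_sub i1 i3, ← integral_add i13 (i2.const_mul (1 / 8))]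
  have hneg : ∫ z in Iio (0 : ℝ), R z ≤ 0 := by
    refine setIntegral_nonpos measurableSet_Iio fun z hz => ?_
    have hz' : z < 0 := hz
    have hp : 0 < 1 - z := by linarith
    have h1 : z / (1 - z) * deriv φ z ^ 2 ≤ 0 :=
      mul_nonpos_of_nonpos_of_nonneg (div_nonpos_of_nonpos_of_nonneg hz'.le hp.le) (sq_nonneg _)
    have h2 : 0 ≤ 1 / (1 - z) ^ 3 + 1 / (2 * (1 - z) ^ 2) + (1 - 1 / (1 - z) ^ 2) / 8 - 1 / 8 := by
      have : 1 / (1 - z) ^ 3 + 1 / (2 * (1 - z) ^ 2) + (1 - 1 / (1 - z) ^ 2) / 8 - 1 / 8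
          = 1 / (1 - z) ^ 3 + 3 / 8 * (1 / (1 - z) ^ 2) := by field_simp; ring
      rw [this]; positivity
    have := mul_nonneg h2 (sq_nonneg (φ z))
    simp only [hR]
    linarith
  linarith

/-- The space of test functions. -/
def testSpace : Submodule ℝ (ℝ → ℝ) where
  carrier := {φ | IsTest φ}
  add_mem' := IsTest.add
  zero_mem' := ⟨contDiff_const, -1, -1, by norm_num, fun _ _ => rfl⟩
  smul_mem' c _ h := h.const_mul c

theorem Hadj_add {φ ψ : ℝ → ℝ} (hφ : IsTest φ) (hψ : IsTest ψ) :
    Hadj (φ + ψ) = Hadj φ + Hadj ψ := by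
  have h1 : deriv (φ + ψ) = deriv φ + deriv ψ := funext fun y =>
    ((hφ.hasDerivAt y).add (hψ.hasDerivAt y)).deriv
  have h2 : deriv (deriv φ + deriv ψ) = deriv (deriv φ) + deriv (deriv ψ) := funext fun y =>
    ((hφ.deriv.hasDerivAt y).add (hψ.deriv.hasDerivAt y)).deriv
  ext z
  rw [Hadj_eq (φ := φ + ψ) (hφ.1.add hψ.1), Pi.add_apply, Hadj_eq hφ.1, Hadj_eq hψ.1, h1, h2]
  simp only [Pi.add_apply]
  ring

theorem Hadj_smul {φ : ℝ → ℝ} (hφ : IsTest φ) (c : ℝ) : Hadj (c • φ) = c • Hadj φ := by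
  have h1 : deriv (c • φ) = c • deriv φ := funext fun y => ((hφ.hasDerivAt y).const_smul c).deriv
  have h2 : deriv (c • deriv φ) = c • deriv (deriv φ) := funext fun y =>
    ((hφ.deriv.hasDerivAt y).const_smul c).deriv
  ext z
  have h3 : IsTest (c • φ) := hφ.const_mul c
  rw [Hadj_eq h3.1, Pi.smul_apply, Hadj_eq hφ.1, h1, h2]
  simp only [Pi.smul_apply, smul_eq_mul]
  ring

theorem memLp_div_one_sub {f : ℝ → ℝ} (hf : MemLp f 2 μneg) :
    MemLp (fun z => f z / (1 - z)) 2 μneg := by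
  refine hf.mono ?_ ?_
  · have hm : Measurable (fun z : ℝ => (1 - z)⁻¹) := by fun_prop
    simpa only [div_eq_mul_inv] using! hf.aestronglyMeasurable.mul hm.aestronglyMeasurable
  · filter_upwards [ae_restrict_mem measurableSet_Iio] with z hz
    have hz' : z < 0 := hz
    rw [norm_div]
    refine div_le_self (norm_nonneg _) ?_
    rw [Real.norm_of_nonneg (by linarith)]
    linarith

/-- Test functions as elements of `L²`. -/
def testEmb : testSpace →ₗ[ℝ] L2neg where
  toFun φ := (IsTest.memLp φ.2).toLp φ.1
  map_add' _ _ := rfl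
  map_smul' _ _ := rfl

/-- The formal adjoint of `H` on test functions. -/
def testHadj : testSpace →ₗ[ℝ] L2neg where
  toFun φ := (IsTest.Hadj φ.2).memLp.toLp (Hadj φ.1)
  map_add' φ ψ := by
    rw [← MemLp.toLp_add]
    exact MemLp.toLp_congr _ _ (Eventually.of_forall fun z => congrFun (Hadj_add φ.2 ψ.2) z)
  map_smul' c φ := by
    rw [RingHom.id_apply, ← MemLp.toLp_const_smul]
    exact MemLp.toLp_congr _ _ (Eventually.of_forall fun z => congrFun (Hadj_smul φ.2 c) z)

/-- The formal adjoint of `H` on test functions, divided by the weight `1 - z`. -/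
def testHadjW : testSpace →ₗ[ℝ] L2neg where
  toFun φ := (memLp_div_one_sub (IsTest.Hadj φ.2).memLp).toLp _
  map_add' φ ψ := by
    rw [← MemLp.toLp_add]
    refine MemLp.toLp_congr _ _ (Eventually.of_forall fun z => ?_)
    have := congrFun (Hadj_add φ.2 ψ.2) z
    simp only [Pi.add_apply, Submodule.coe_add] at this ⊢
    rw [this, add_div]
  map_smul' c φ := by
    rw [RingHom.id_apply, ← MemLp.toLp_const_smul]
    refine MemLp.toLp_congr _ _ (Eventually.of_forall fun z => ?_)
    have := congrFun (Hadj_smul φ.2 c) z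
    simp only [Pi.smul_apply, Submodule.coe_smul, smul_eq_mul] at this ⊢
    rw [this, mul_div_assoc]

theorem inner_toLp_right {f : ℝ → ℝ} (hf : MemLp f 2 μneg) (w : L2neg) :
    ⟪w, hf.toLp f⟫ = ∫ z in Iio (0 : ℝ), w z * f z := by
  rw [L2.inner_def]
  refine integral_congr_ae ?_
  filter_upwards [hf.coeFn_toLp] with z hz
  rw [hz]
  simp [mul_comm]

theorem inner_toLp_toLp {f g : ℝ → ℝ} (hf : MemLp f 2 μneg) (hg : MemLp g 2 μneg) :
    ⟪hf.toLp f, hg.toLp g⟫ = ∫ z in Iio (0 : ℝ), f z * g z := by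
  rw [inner_toLp_right]
  refine integral_congr_ae ?_
  filter_upwards [hf.coeFn_toLp] with z hz
  rw [hz]

theorem inner_testEmb (w : L2neg) (φ : testSpace) :
    ⟪w, testEmb φ⟫ = ∫ z in Iio (0 : ℝ), w z * φ.1 z :=
  inner_toLp_right (IsTest.memLp φ.2) w

theorem inner_testHadj (w : L2neg) (φ : testSpace) :
    ⟪w, testHadj φ⟫ = ∫ z in Iio (0 : ℝ), w z * Hadj φ.1 z :=
  inner_toLp_right (IsTest.Hadj φ.2).memLp w

theorem inner_testHadjW (w : L2neg) (φ : testSpace) :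
    ⟪w, testHadjW φ⟫ = ∫ z in Iio (0 : ℝ), w z * (Hadj φ.1 z / (1 - z)) :=
  inner_toLp_right (memLp_div_one_sub (IsTest.Hadj φ.2).memLp) w

/-- Division by the weight `1 - z` is symmetric. -/
theorem inner_div_testHadj (y : L2neg) (φ : testSpace) :
    ⟪(memLp_div_one_sub (Lp.memLp y)).toLp _, testHadj φ⟫ = ⟪y, testHadjW φ⟫ := by
  rw [inner_testHadjW]
  refine (inner_toLp_toLp (memLp_div_one_sub (Lp.memLp y)) (IsTest.Hadj φ.2).memLp).trans ?_
  congr 1; ext z; ring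

theorem hasH_iff {w g : L2neg} :
    HasH w g ↔ ∀ φ : testSpace, ⟪w, testHadj φ⟫ = ⟪g, testEmb φ⟫ := by
  constructor
  · intro h φ
    have hφ : IsTest φ.1 := φ.2
    rw [inner_testHadj, inner_testEmb]
    exact h φ.1 hφ.1 hφ.hasCompactSupport hφ.tsupport_subset
  · intro h φ h1 h2 h3
    have := h ⟨φ, IsTest.of_tsupport h1 h2 h3⟩
    rwa [inner_testHadj, inner_testEmb] at this

theorem HasH.sub {w g w' g' : L2neg} (h : HasH w g) (h' : HasH w' g') :
    HasH (w - w') (g - g') := by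
  rw [hasH_iff] at h h' ⊢
  intro φ
  rw [inner_sub_left, inner_sub_left, h, h']

theorem hasH_zero : HasH 0 0 := by
  rw [hasH_iff]
  intro φ
  simp

theorem inner_testEmb_testHadj_le (φ : testSpace) :
    ⟪testEmb φ, testHadj φ⟫ ≤ -(1 / 2) * ‖testEmb φ‖ ^ 2 := by
  have hφ : IsTest φ.1 := φ.2
  have h1 : ⟪testEmb φ, testEmb φ⟫ = _ := inner_toLp_toLp hφ.memLp hφ.memLp
  have h2 : ⟪testEmb φ, testHadj φ⟫ = _ := inner_toLp_toLp hφ.memLp hφ.Hadj.memLp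
  rw [← real_inner_self_eq_norm_sq, h1, h2]
  exact integral_mul_Hadj_le hφ

theorem inner_testEmb_testHadjW_le (φ : testSpace) :
    ⟪testEmb φ, testHadjW φ⟫ ≤ -(1 / 8) * ‖testEmb φ‖ ^ 2 := by
  have hφ : IsTest φ.1 := φ.2
  have h1 : ⟪testEmb φ, testEmb φ⟫ = _ := inner_toLp_toLp hφ.memLp hφ.memLp
  have h2 : ⟪testEmb φ, testHadjW φ⟫ = _ :=
    inner_toLp_toLp hφ.memLp (memLp_div_one_sub hφ.Hadj.memLp)
  rw [← real_inner_self_eq_norm_sq, h1, h2]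
  exact integral_weighted_mul_Hadj_le hφ

theorem norm_le_of_inner_le {X : Type*} [NormedAddCommGroup X] [InnerProductSpace ℝ X] {x y : X}
    {c : ℝ} (hc : 0 < c) (h : ⟪x, y⟫ ≤ -c * ‖x‖ ^ 2) : ‖x‖ ≤ c⁻¹ * ‖y‖ := by
  have h1 := neg_le_of_abs_le (abs_real_inner_le_norm x y)
  rw [← div_eq_inv_mul, le_div_iff₀ hc]
  by_contra hlt
  push Not at hlt
  have h2 : 0 < ‖x‖ := by
    by_contra h0
    have : ‖x‖ = 0 := le_antisymm (not_lt.1 h0) (norm_nonneg _)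
    rw [this, zero_mul] at hlt
    exact absurd hlt (not_lt.2 (norm_nonneg y))
  nlinarith [mul_lt_mul_of_pos_left hlt h2]

/-- Orthogonality of `y` to this range says precisely that `H y = 0` in the sense of distributions.
-/
theorem denseRange_testHadj : DenseRange testHadj :=
  denseRange_of_inner_eq_zero _ fun y hy => by
    refine HasH.injective (g := 0) (hasH_iff.2 fun φ => ?_) hasH_zero
    rw [real_inner_comm, hy, inner_zero_left]

/-- The weight is moved to the other factor: `y / (1 - z)` is then a distributional solution of `H =
0`, hence zero. -/
theorem denseRange_testHadjW : DenseRange testHadjW :=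
  denseRange_of_inner_eq_zero _ fun y hy => by
    have hm := memLp_div_one_sub (Lp.memLp y)
    have h0 : hm.toLp _ = 0 := by
      refine HasH.injective (g := 0) (hasH_iff.2 fun φ => ?_) hasH_zero
      rw [inner_zero_left, inner_div_testHadj, real_inner_comm]
      exact hy φ
    ext
    have h1 : hm.toLp _ =ᵐ[μneg] (0 : L2neg) := by rw [h0]
    filter_upwards [h1, hm.coeFn_toLp, ae_restrict_mem measurableSet_Iio,
      Lp.coeFn_zero ℝ 2 μneg] with z e1 e2 hz e3
    have hz' : 1 - z ≠ 0 := by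
      have : z < 0 := hz
      linarith
    rw [e1, e3] at e2
    rw [e3]
    exact (div_eq_zero_iff.1 e2.symm).resolve_right hz'

/-- The inverse of `H`. -/
def hInvL : L2neg →L[ℝ] L2neg :=
  ContinuousLinearMap.adjoint (testEmb.extendOfNorm testHadj)

/-- The inverse of `H`, multiplied by the weight `1 - z`. -/
def hInvW : L2neg →L[ℝ] L2neg :=
  ContinuousLinearMap.adjoint (testEmb.extendOfNorm testHadjW)

/-- Dissipativity bounds `‖φ‖` by `2 ‖H*φ‖`. Together with density of the range of `H*` this makes
the extension genuine. -/
theorem extend_testHadj (φ : testSpace) :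
    testEmb.extendOfNorm testHadj (testHadj φ) = testEmb φ :=
  LinearMap.extendOfNorm_eq denseRange_testHadj
    ⟨_, fun φ => norm_le_of_inner_le (by norm_num) (inner_testEmb_testHadj_le φ)⟩ φ

theorem extend_testHadjW (φ : testSpace) :
    testEmb.extendOfNorm testHadjW (testHadjW φ) = testEmb φ :=
  LinearMap.extendOfNorm_eq denseRange_testHadjW
    ⟨_, fun φ => norm_le_of_inner_le (by norm_num) (inner_testEmb_testHadjW_le φ)⟩ φ

theorem hasH_hInvL (g : L2neg) : HasH (hInvL g) g := by
  rw [hasH_iff]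
  intro φ
  rw [hInvL, ContinuousLinearMap.adjoint_inner_left, extend_testHadj]

theorem HasH.eq_hInvL {w g : L2neg} (h : HasH w g) : w = hInvL g :=
  h.injective (hasH_hInvL g)

/-- Dividing `hInvW g` by the weight gives a solution of `Hw = g`, which is unique. Consequently `z
w ∈ L²` for `w` in the domain, with norm controlled by `‖Hw‖`; the weighted space `L²₁` needs this.
-/
theorem hInvW_ae_eq (g : L2neg) : hInvW g =ᵐ[μneg] fun z => (1 - z) * hInvL g z := by
  have hm := memLp_div_one_sub (Lp.memLp (hInvW g))
  have h0 : hm.toLp _ = hInvL g := by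
    refine HasH.eq_hInvL (hasH_iff.2 fun φ => ?_)
    have h1 : ⟪hInvW g, testHadjW φ⟫ = ⟪g, testEmb φ⟫ := by
      rw [hInvW, ContinuousLinearMap.adjoint_inner_left, extend_testHadjW]
    rw [inner_div_testHadj, h1]
  have h1 : hm.toLp _ =ᵐ[μneg] hInvL g := by rw [h0]
  filter_upwards [h1, hm.coeFn_toLp, ae_restrict_mem measurableSet_Iio] with z e1 e2 hz
  have hz' : 1 - z ≠ 0 := by
    have : z < 0 := hz
    linarith
  rw [← e1, e2]
  field_simp

theorem isDissipativeInverse_hInvL : IsDissipativeInverse hInvL where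
  inj g h := by
    have h1 := hasH_hInvL g
    rw [h] at h1
    exact h1.unique hasH_zero
  inner_le := by
    have hadj : ContinuousLinearMap.adjoint hInvL = testEmb.extendOfNorm testHadj := by
      rw [hInvL, ContinuousLinearMap.adjoint_adjoint]
    intro x
    rw [← ContinuousLinearMap.adjoint_inner_right, hadj]
    -- The inequality is closed in `x`, and on the dense set `x = H*φ` it is the dissipativity of
    -- `H*`, because the adjoint of `hInvL` maps `H*φ` to `φ`.
    refine denseRange_testHadj.induction_on
      (p := fun x => ⟪x, testEmb.extendOfNorm testHadj x⟫
        ≤ -(1 / 2) * ‖testEmb.extendOfNorm testHadj x‖ ^ 2) x ?_ fun φ => ?_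
    · exact isClosed_le (by fun_prop) (by fun_prop)
    · rw [extend_testHadj, real_inner_comm]
      exact inner_testEmb_testHadj_le φ

/-! ### Convolution with decaying kernels -/

/-- Peetre's inequality, which transfers decay of a kernel to its translates. -/
theorem one_add_sq_le (x z : ℝ) : 1 + z ^ 2 ≤ 2 * (1 + x ^ 2) * (1 + (x - z) ^ 2) := by
  nlinarith [sq_nonneg (2 * x - z), sq_nonneg (x * (x - z)), sq_nonneg (x - z), sq_nonneg x]

namespace Decays

variable {k : ℝ → ℝ}

theorem bound_nonneg {M : ℝ} (hM : ∀ z, |k z| ≤ M * ((1 + z ^ 2) ^ 2)⁻¹) : 0 ≤ M := by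
  have := (abs_nonneg _).trans (hM 0)
  simpa using this

/-- Uniform decay of the translates of a decaying kernel. -/
theorem exists_translate_bound (h : Decays k) :
    ∃ M, 0 ≤ M ∧ ∀ x z, |k (x - z)| ≤ M * (1 + x ^ 2) ^ 2 * ((1 + z ^ 2) ^ 2)⁻¹ := by
  obtain ⟨M, hM⟩ := h
  have hM0 := bound_nonneg hM
  refine ⟨4 * M, by positivity, fun x z => (hM (x - z)).trans ?_⟩
  rw [← div_eq_mul_inv, ← div_eq_mul_inv, div_le_div_iff₀ (by positivity) (by positivity)]
  have h1 : (1 + z ^ 2) ^ 2 ≤ (2 * (1 + x ^ 2) * (1 + (x - z) ^ 2)) ^ 2 := by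
    gcongr
    exact one_add_sq_le x z
  calc M * (1 + z ^ 2) ^ 2 ≤ M * (2 * (1 + x ^ 2) * (1 + (x - z) ^ 2)) ^ 2 := by gcongr
    _ = _ := by ring

theorem translate (h : Decays k) (x : ℝ) : Decays (fun z => k (x - z)) := by
  obtain ⟨M, _, hM⟩ := h.exists_translate_bound
  exact ⟨_, hM x⟩

theorem memLp_translate (h : Decays k) (hc : Continuous k) (x : ℝ) :
    MemLp (fun z => k (x - z)) 2 μneg :=
  ((h.translate x).memLp_two (by fun_prop)).restrict _

end Decays

/-- The convolution of `k` with a function on the negative half-line. -/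
def conv (k : ℝ → ℝ) (w : L2neg) (x : ℝ) : ℝ := ∫ z in Iio (0 : ℝ), k (x - z) * w z

section Conv

variable {k k' : ℝ → ℝ}

/-- Pairing with a fixed `L²` translate gives linearity, time derivatives and uniform bounds of the
convolution at once. -/
theorem conv_eq_inner (h : Decays k) (hc : Continuous k) (w : L2neg) (x : ℝ) :
    conv k w x = ⟪w, (h.memLp_translate hc x).toLp _⟫ := by
  rw [inner_toLp_right, conv]
  congr 1; ext z; ring

theorem integrable_conv (h : Decays k) (hc : Continuous k) (w : L2neg) (x : ℝ) :
    Integrable (fun z => k (x - z) * w z) μneg := by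
  simpa only [mul_comm] using integrable_mul_of_decays w (h.translate x) (by fun_prop)

theorem conv_add (h : Decays k) (hc : Continuous k) (w w' : L2neg) (x : ℝ) :
    conv k (w + w') x = conv k w x + conv k w' x := by
  simp only [conv_eq_inner h hc, inner_add_left]

theorem conv_smul (h : Decays k) (hc : Continuous k) (c : ℝ) (w : L2neg) (x : ℝ) :
    conv k (c • w) x = c * conv k w x := by
  simp only [conv_eq_inner h hc, inner_smul_left]
  rfl

theorem hasDerivWithinAt_conv_time (h : Decays k) (hc : Continuous k) {w : ℝ → L2neg} {w' : L2neg}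
    {s : Set ℝ} {t : ℝ} (hw : HasDerivWithinAt w w' s t) (x : ℝ) :
    HasDerivWithinAt (fun t => conv k (w t) x) (conv k w' x) s t := by
  simp only [conv_eq_inner h hc]
  simpa using hw.inner ℝ (hasDerivWithinAt_const t s ((h.memLp_translate hc x).toLp _))

theorem hasDerivAt_conv (h : Decays k) (hk : ∀ y, HasDerivAt k (k' y) y) (h' : Decays k')
    (hc' : Continuous k') (w : L2neg) (x : ℝ) : HasDerivAt (conv k w) (conv k' w x) x := by
  have hc : Continuous k := continuous_iff_continuousAt.2 fun y => (hk y).continuousAt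
  obtain ⟨M, hM0, hM⟩ := h'.exists_translate_bound
  have hi : Integrable (fun z : ℝ => ((1 + z ^ 2) ^ 2)⁻¹ * |w z|) μneg := by
    have hd : Decays (fun z : ℝ => ((1 + z ^ 2) ^ 2)⁻¹) :=
      ⟨1, fun z => by rw [abs_of_nonneg (by positivity), one_mul]⟩
    have hcd : Continuous (fun z : ℝ => ((1 + z ^ 2) ^ 2)⁻¹) :=
      Continuous.inv₀ (by fun_prop) fun z => by positivity
    refine (integrable_mul_of_decays w hd hcd).abs.congr (Eventually.of_forall fun z => ?_)
    beta_reduce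
    rw [abs_mul, abs_of_nonneg (by positivity : 0 ≤ ((1 + z ^ 2) ^ 2)⁻¹), mul_comm]
  refine (hasDerivAt_integral_of_dominated_loc_of_deriv_le (s := Metric.ball x 1)
    (F := fun y z => k (y - z) * w z) (F' := fun y z => k' (y - z) * w z)
    (bound := fun z => M * (1 + (|x| + 1) ^ 2) ^ 2 * (((1 + z ^ 2) ^ 2)⁻¹ * |w z|))
    (Metric.ball_mem_nhds x one_pos)
    (Eventually.of_forall fun y => (integrable_conv h hc w y).aestronglyMeasurable)
    (integrable_conv h hc w x) (integrable_conv h' hc' w x).aestronglyMeasurable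
    (Eventually.of_forall fun z y hy => ?_) (hi.const_mul _)
    (Eventually.of_forall fun z y _ => ?_)).2
  · rw [norm_mul, Real.norm_eq_abs, Real.norm_eq_abs, ← mul_assoc]
    refine mul_le_mul_of_nonneg_right ((hM y z).trans ?_) (abs_nonneg _)
    have h1 : |y| ≤ |x| + 1 := by
      have h2 : |y - x| < 1 := hy
      have h3 := abs_sub_abs_le_abs_sub y x
      linarith
    have h2 : y ^ 2 ≤ (|x| + 1) ^ 2 := by
      rw [← sq_abs y]; gcongr
    gcongr
  · exact (((hk (y - z)).comp_sub_const y z)).mul_const (w z)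

theorem continuous_conv (h : Decays k) (hk : ∀ y, HasDerivAt k (k' y) y) (h' : Decays k')
    (hc' : Continuous k') (w : L2neg) : Continuous (conv k w) :=
  continuous_iff_continuousAt.2 fun x => (hasDerivAt_conv h hk h' hc' w x).continuousAt

theorem exists_abs_conv_le (h : Decays k) (hc : Continuous k) :
    ∃ B, 0 ≤ B ∧ ∀ w x, |conv k w x| ≤ B * ‖w‖ := by
  have hi := (h.memLp_two hc).integrable_sq
  refine ⟨√(∫ y, k y ^ 2), Real.sqrt_nonneg _, fun w x => ?_⟩
  rw [conv_eq_inner h hc, mul_comm]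
  refine (abs_real_inner_le_norm _ _).trans (mul_le_mul_of_nonneg_left ?_ (norm_nonneg _))
  refine Real.le_sqrt_of_sq_le ?_
  rw [← real_inner_self_eq_norm_sq, inner_toLp_toLp]
  have h1 : ∫ z, k (x - z) ^ 2 = ∫ y, k y ^ 2 := integral_sub_left_eq_self (fun y => k y ^ 2) volume x
  rw [← h1]
  simp only [← pow_two]
  exact setIntegral_le_integral (hi.comp_sub_left x) (Eventually.of_forall fun z => sq_nonneg _)

/-- **Young's inequality** `‖k * w‖₂ ≤ ‖k‖₁ ‖w‖₂`. -/
theorem integral_conv_sq_le (h : Decays k) (hc : Continuous k) (w : L2neg)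
    (hm : AEStronglyMeasurable (conv k w) volume) :
    Integrable (fun x => conv k w x ^ 2) ∧
      ∫ x, conv k w x ^ 2 ≤ (∫ y, |k y|) ^ 2 * ‖w‖ ^ 2 := by
  set K := ∫ y, |k y| with hK
  have hki : Integrable (fun y => |k y|) := (h.integrable hc).abs
  have hwi : Integrable (fun z => w z ^ 2) μneg := (Lp.memLp w).integrable_sq
  have hnorm : ‖w‖ ^ 2 = ∫ z in Iio (0 : ℝ), w z ^ 2 := by
    rw [← real_inner_self_eq_norm_sq, L2.inner_def]
    congr 1; ext z; simp [pow_two]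
  -- Pointwise `(k * w)² ≤ ‖k‖₁ (|k| * w²)` by Cauchy–Schwarz, and the right side has integral
  -- `‖k‖₁² ‖w‖²`.
  set Φ : ℝ → ℝ := convolution (fun z => w z ^ 2) (fun y => |k y|) (ContinuousLinearMap.mul ℝ ℝ) μneg
    with hΦ
  have hΦi : Integrable Φ :=
    (hwi.convolution_integrand (ContinuousLinearMap.mul ℝ ℝ) hki).integral_prod_left
  have hΦI : ∫ x, Φ x = ‖w‖ ^ 2 * K := by
    rw [hΦ, integral_convolution _ hwi hki, hnorm]
    rfl
  have hpt : ∀ x, conv k w x ^ 2 ≤ K * Φ x := by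
    intro x
    obtain ⟨M, _, hM⟩ := h.exists_translate_bound
    have hkx : Integrable (fun z => |k (x - z)|) μneg := (hki.comp_sub_left x).integrableOn
    have i2 : Integrable (fun z => |k (x - z)| * w z ^ 2) μneg := by
      refine hwi.bdd_mul (c := M * (1 + x ^ 2) ^ 2) hkx.aestronglyMeasurable
        (Eventually.of_forall fun z => ?_)
      rw [Real.norm_eq_abs, abs_abs]
      refine (hM x z).trans (mul_le_of_le_one_right (by positivity) ?_)
      exact inv_le_one_of_one_le₀ (one_le_pow₀ (by nlinarith [sq_nonneg z]))
    have e2 : Φ x = ∫ z in Iio (0 : ℝ), |k (x - z)| * w z ^ 2 := by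
      rw [hΦ, convolution_def]
      congr 1; ext z
      simp [mul_comm]
    have hKx : ∫ z in Iio (0 : ℝ), |k (x - z)| ≤ K := by
      rw [hK, ← integral_sub_left_eq_self (fun y => |k y|) volume x]
      exact setIntegral_le_integral (hki.comp_sub_left x) (Eventually.of_forall fun z => abs_nonneg _)
    have hΦ0 : 0 ≤ Φ x := by
      rw [e2]
      exact integral_nonneg fun z => by positivity
    have hK0 : 0 ≤ ∫ z in Iio (0 : ℝ), |k (x - z)| := integral_nonneg fun z => abs_nonneg _
    -- Cauchy–Schwarz with weight `|k(x - z)|`, read off from the discriminant of a nonnegative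
    -- quadratic in `s`.
    have hCS : ∀ s : ℝ, 0 ≤ (∫ z in Iio (0 : ℝ), |k (x - z)|) * (s * s)
        + 2 * (∫ z in Iio (0 : ℝ), |k (x - z)| * |w z|) * s + Φ x := by
      intro s
      have i3 : Integrable (fun z => |k (x - z)| * |w z|) μneg := by
        simpa only [abs_mul] using (integrable_conv h hc w x).abs
      have : ∫ z in Iio (0 : ℝ), |k (x - z)| * (s + |w z|) ^ 2
          = (∫ z in Iio (0 : ℝ), |k (x - z)|) * (s * s)
          + 2 * (∫ z in Iio (0 : ℝ), |k (x - z)| * |w z|) * s + Φ x := by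
        rw [e2]
        have i4 : Integrable (fun z => |k (x - z)| * (s * s)
          + 2 * s * (|k (x - z)| * |w z|)) μneg := (hkx.mul_const (s * s)).add (i3.const_mul (2 * s))
        rw [← integral_mul_const, mul_right_comm 2 _ s, ← integral_const_mul,
          ← integral_add (hkx.mul_const (s * s)) (i3.const_mul (2 * s)), ← integral_add i4 i2]
        congr 1; ext z
        rw [← sq_abs (w z)]
        ring
      rw [← this]
      exact integral_nonneg fun z => by positivity
    have hdisc := discrim_le_zero hCS
    rw [discrim] at hdisc
    have habs : |conv k w x| ≤ ∫ z in Iio (0 : ℝ), |k (x - z)| * |w z| := by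
      refine (abs_integral_le_integral_abs).trans (le_of_eq ?_)
      simp only [abs_mul]
    calc conv k w x ^ 2 ≤ (∫ z in Iio (0 : ℝ), |k (x - z)| * |w z|) ^ 2 := by
          rw [← sq_abs]; gcongr
      _ ≤ (∫ z in Iio (0 : ℝ), |k (x - z)|) * Φ x := by nlinarith
      _ ≤ K * Φ x := by gcongr
  have hint : Integrable (fun x => conv k w x ^ 2) := by
    refine (hΦi.const_mul K).mono' (hm.pow 2) (Eventually.of_forall fun x => ?_)
    rw [Real.norm_of_nonneg (sq_nonneg _)]
    exact hpt x
  refine ⟨hint, (integral_mono hint (hΦi.const_mul K) hpt).trans (le_of_eq ?_)⟩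
  rw [integral_const_mul, hΦI]
  ring

theorem memLp_conv (h : Decays k) (hk : ∀ y, HasDerivAt k (k' y) y) (h' : Decays k')
    (hc' : Continuous k') (w : L2neg) : MemLp (conv k w) 2 volume := by
  have hc : Continuous k := continuous_iff_continuousAt.2 fun y => (hk y).continuousAt
  have hm := (continuous_conv h hk h' hc' w).aestronglyMeasurable (μ := volume)
  rw [memLp_two_iff_integrable_sq hm]
  exact (integral_conv_sq_le h hc w hm).1

theorem norm_sq_toLp {f : ℝ → ℝ} (hf : MemLp f 2 volume) : ‖hf.toLp f‖ ^ 2 = ∫ x, f x ^ 2 := by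
  rw [← real_inner_self_eq_norm_sq, L2.inner_def]
  refine integral_congr_ae ?_
  filter_upwards [hf.coeFn_toLp] with x hx
  rw [hx]
  simp [pow_two]

/-- Convolution with `k` as a bounded operator. -/
def convL (h : Decays k) (hk : ∀ y, HasDerivAt k (k' y) y) (h' : Decays k')
    (hc' : Continuous k') : L2neg →L[ℝ] Lp ℝ 2 (volume : Measure ℝ) :=
  LinearMap.mkContinuous
    { toFun := fun w => (memLp_conv h hk h' hc' w).toLp _
      map_add' := fun w w' => by
        have hc : Continuous k := continuous_iff_continuousAt.2 fun y => (hk y).continuousAt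
        rw [← MemLp.toLp_add]
        exact MemLp.toLp_congr _ _ (Eventually.of_forall fun x => conv_add h hc w w' x)
      map_smul' := fun c w => by
        have hc : Continuous k := continuous_iff_continuousAt.2 fun y => (hk y).continuousAt
        rw [RingHom.id_apply, ← MemLp.toLp_const_smul]
        exact MemLp.toLp_congr _ _ (Eventually.of_forall fun x => conv_smul h hc c w x) }
    (∫ y, |k y|) fun w => by
      have hc : Continuous k := continuous_iff_continuousAt.2 fun y => (hk y).continuousAt
      refine le_of_sq_le_sq ?_ (mul_nonneg (integral_nonneg fun y => abs_nonneg _) (norm_nonneg _))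
      refine le_trans (le_of_eq (norm_sq_toLp (memLp_conv h hk h' hc' w))) ?_
      rw [mul_pow]
      exact (integral_conv_sq_le h hc w (continuous_conv h hk h' hc' w).aestronglyMeasurable).2

theorem coeFn_convL (h : Decays k) (hk : ∀ y, HasDerivAt k (k' y) y) (h' : Decays k')
    (hc' : Continuous k') (w : L2neg) : convL h hk h' hc' w =ᵐ[volume] conv k w :=
  (memLp_conv h hk h' hc' w).coeFn_toLp

end Conv

open Polynomial

/-! ### Polynomials times the Gaussian -/

/-- `P(y) exp(-y²/4)`. -/
def polyG (P : ℝ[X]) (y : ℝ) : ℝ := P.eval y * Real.exp (-y ^ 2 / 4)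

/-- The derivative of `polyG P` is `polyG (polyD P)`. -/
def polyD (P : ℝ[X]) : ℝ[X] := derivative P - C (1 / 2) * X * P

theorem hasDerivAt_polyG (P : ℝ[X]) (y : ℝ) : HasDerivAt (polyG P) (polyG (polyD P) y) y := by
  have h : HasDerivAt (fun y : ℝ => -y ^ 2 / 4) (-(y / 2)) y :=
    ((hasDerivAt_pow 2 y).neg.div_const 4).congr_deriv (by push_cast; ring)
  refine ((P.hasDerivAt y).mul h.exp).congr_deriv ?_
  simp only [polyG, polyD, eval_sub, eval_mul, eval_C, eval_X]
  ring

theorem deriv_polyG (P : ℝ[X]) : deriv (polyG P) = polyG (polyD P) :=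
  funext fun y => (hasDerivAt_polyG P y).deriv

theorem continuous_polyG (P : ℝ[X]) : Continuous (polyG P) :=
  continuous_iff_continuousAt.2 fun y => (hasDerivAt_polyG P y).continuousAt

theorem contDiff_polyG (P : ℝ[X]) : ContDiff ℝ ∞ (polyG P) := by
  have h : ∀ n : ℕ, ∀ P : ℝ[X], ContDiff ℝ n (polyG P) := by
    intro n
    induction n with
    | zero => exact fun P => contDiff_zero.2 (continuous_polyG P)
    | succ n ih =>
      intro P
      rw [show ((n + 1 : ℕ) : ℕ∞ω) = (n : ℕ∞ω) + 1 by norm_cast, contDiff_succ_iff_deriv]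
      refine ⟨fun y => (hasDerivAt_polyG P y).differentiableAt, by simp, ?_⟩
      rw [deriv_polyG]
      exact ih _
  exact contDiff_infty.2 fun n => h n P

theorem polynomial_bound (P : ℝ[X]) : ∃ (n : ℕ) (M : ℝ), 0 ≤ M ∧
    ∀ y : ℝ, |P.eval y| ≤ M * (1 + y ^ 2) ^ n := by
  induction P using Polynomial.induction_on' with
  | add p q hp hq =>
    obtain ⟨n, M, hM, h⟩ := hp
    obtain ⟨m, N, hN, h'⟩ := hq
    refine ⟨n + m, M + N, by positivity, fun y => ?_⟩
    have h1 : (1 : ℝ) ≤ 1 + y ^ 2 := by nlinarith [sq_nonneg y]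
    rw [eval_add]
    calc |eval y p + eval y q| ≤ |eval y p| + |eval y q| := abs_add_le _ _
      _ ≤ M * (1 + y ^ 2) ^ n + N * (1 + y ^ 2) ^ m := add_le_add (h y) (h' y)
      _ ≤ M * (1 + y ^ 2) ^ (n + m) + N * (1 + y ^ 2) ^ (n + m) := by
          gcongr <;> first | exact h1 | omega
      _ = _ := by ring
  | monomial n a =>
    refine ⟨n, |a|, abs_nonneg a, fun y => ?_⟩
    rw [eval_monomial, abs_mul, abs_pow]
    gcongr
    nlinarith [sq_abs y, sq_nonneg (|y| - 1), abs_nonneg y]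

theorem decays_polyG (P : ℝ[X]) : Decays (polyG P) := by
  obtain ⟨n, M, hM, h⟩ := polynomial_bound P
  refine decays_of_le_gaussian n hM fun y => ?_
  rw [polyG, abs_mul, abs_of_pos (Real.exp_pos _)]
  have h1 : -y ^ 2 / 4 ≤ -y ^ 2 / 8 := by nlinarith [sq_nonneg y]
  gcongr
  exact h y

theorem memLp_polyG (P : ℝ[X]) : MemLp (polyG P) 2 volume :=
  (decays_polyG P).memLp_two (continuous_polyG P)

theorem integrable_polyG_mul (P Q : ℝ[X]) : Integrable (fun y => polyG P y * polyG Q y) :=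
  (memLp_polyG P).integrable_mul (memLp_polyG Q)

/-! ### The convolution representation -/

/-- `a P G + b Q G + (P G) * w` with the Gaussian `G = exp(-x²/4)`. -/
def gform (P Q : ℝ[X]) (a b : ℝ) (w : L2neg) (x : ℝ) : ℝ :=
  a * polyG P x + b * polyG Q x + conv (polyG P) w x

theorem hasDerivAt_gform (P Q : ℝ[X]) (a b : ℝ) (w : L2neg) (x : ℝ) :
    HasDerivAt (gform P Q a b w) (gform (polyD P) (polyD Q) a b w x) x :=
  (((hasDerivAt_polyG P x).const_mul a).add ((hasDerivAt_polyG Q x).const_mul b)).add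
    (hasDerivAt_conv (decays_polyG P) (hasDerivAt_polyG P) (decays_polyG _) (continuous_polyG _) w x)

theorem deriv_gform (P Q : ℝ[X]) (a b : ℝ) (w : L2neg) :
    deriv (gform P Q a b w) = gform (polyD P) (polyD Q) a b w :=
  funext fun x => (hasDerivAt_gform P Q a b w x).deriv

theorem contDiff_gform (n : ℕ) (P Q : ℝ[X]) (a b : ℝ) (w : L2neg) :
    ContDiff ℝ n (gform P Q a b w) := by
  induction n generalizing P Q with
  | zero => exact contDiff_zero.2 (continuous_iff_continuousAt.2 fun x =>
      (hasDerivAt_gform P Q a b w x).continuousAt)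
  | succ n ih =>
    rw [show ((n + 1 : ℕ) : ℕ∞ω) = (n : ℕ∞ω) + 1 by norm_cast, contDiff_succ_iff_deriv]
    refine ⟨fun y => (hasDerivAt_gform P Q a b w y).differentiableAt, by simp, ?_⟩
    rw [deriv_gform]
    exact ih _ _

theorem continuous_gform (P Q : ℝ[X]) (a b : ℝ) (w : L2neg) : Continuous (gform P Q a b w) :=
  (contDiff_gform 0 P Q a b w).continuous

/-- `gform` as a bounded operator into `L²(ℝ)`. -/
def gformL (P Q : ℝ[X]) : ℝ × ℝ × L2neg →L[ℝ] Lp ℝ 2 (volume : Measure ℝ) :=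
  (ContinuousLinearMap.fst ℝ ℝ (ℝ × L2neg)).smulRight ((memLp_polyG P).toLp _)
  + ((ContinuousLinearMap.fst ℝ ℝ L2neg).comp
      (ContinuousLinearMap.snd ℝ ℝ (ℝ × L2neg))).smulRight ((memLp_polyG Q).toLp _)
  + ((convL (decays_polyG P) (hasDerivAt_polyG P) (decays_polyG _) (continuous_polyG _)).comp
      (ContinuousLinearMap.snd ℝ ℝ L2neg)).comp (ContinuousLinearMap.snd ℝ ℝ (ℝ × L2neg))

theorem coeFn_gformL (P Q : ℝ[X]) (a b : ℝ) (w : L2neg) :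
    gformL P Q (a, b, w) =ᵐ[volume] gform P Q a b w := by
  have h : gformL P Q (a, b, w) = a • (memLp_polyG P).toLp _ + b • (memLp_polyG Q).toLp _
      + convL (decays_polyG P) (hasDerivAt_polyG P) (decays_polyG _) (continuous_polyG _) w := rfl
  rw [h]
  filter_upwards [Lp.coeFn_add (a • (memLp_polyG P).toLp _ + b • (memLp_polyG Q).toLp _)
      (convL (decays_polyG P) (hasDerivAt_polyG P) (decays_polyG _) (continuous_polyG _) w),
    Lp.coeFn_add (a • (memLp_polyG P).toLp _) (b • (memLp_polyG Q).toLp _),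
    Lp.coeFn_smul a ((memLp_polyG P).toLp _), Lp.coeFn_smul b ((memLp_polyG Q).toLp _),
    (memLp_polyG P).coeFn_toLp, (memLp_polyG Q).coeFn_toLp,
    coeFn_convL (decays_polyG P) (hasDerivAt_polyG P) (decays_polyG _) (continuous_polyG _) w]
    with x h1 h2 h3 h4 h5 h6 h7
  rw [h1, Pi.add_apply, h2, Pi.add_apply, h3, h4, Pi.smul_apply, Pi.smul_apply, h5, h6, h7]
  rfl

theorem memLp_gform (P Q : ℝ[X]) (a b : ℝ) (w : L2neg) : MemLp (gform P Q a b w) 2 volume :=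
  (memLp_congr_ae (coeFn_gformL P Q a b w)).1 (Lp.memLp _)

theorem eLpNorm_gform (P Q : ℝ[X]) (a b : ℝ) (w : L2neg) :
    eLpNorm (gform P Q a b w) 2 volume = ‖gformL P Q (a, b, w)‖ₑ := by
  rw [Lp.enorm_def]
  exact (eLpNorm_congr_ae (coeFn_gformL P Q a b w)).symm

theorem gform_sub (P Q : ℝ[X]) (a b a' b' : ℝ) (w w' : L2neg) (x : ℝ) :
    gform P Q a b w x - gform P Q a' b' w' x = gform P Q (a - a') (b - b') (w - w') x := by
  have h1 : conv (polyG P) (w - w') x = conv (polyG P) w x - conv (polyG P) w' x := by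
    simp only [conv_eq_inner (decays_polyG P) (continuous_polyG P), inner_sub_left]
  simp only [gform, h1]
  ring

/-- The normalization constant of `u₀`. -/
def cG : ℝ := (√(√(2 * Real.pi)))⁻¹

theorem cG_pos : 0 < cG := by unfold cG; positivity

theorem u₀_eq : u₀ = polyG (C cG) := by
  ext x; simp [u₀, polyG, cG]

theorem u₁_eq : u₁ = polyG (C cG * X) := by
  ext x
  have h1 : √(2 * √(2 * Real.pi)) = √2 * √(√(2 * Real.pi)) := Real.sqrt_mul (by norm_num) _
  have h2 : √2 * √2 = 2 := Real.mul_self_sqrt (by norm_num)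
  have h3 : √2 ≠ 0 := by positivity
  have h4 : √(√(2 * Real.pi)) ≠ 0 := by positivity
  simp only [u₁, polyG, cG, h1, eval_mul, eval_C, eval_X]
  field_simp
  rw [show √2 ^ 2 = 2 by rw [pow_two, h2]]

theorem convForm_eq (a b : ℝ) (w : L2neg) :
    convForm a b w = gform (C cG) (C cG * X) a b w := by
  ext x
  rw [convForm, gform, ← u₀_eq, ← u₁_eq, conv]

theorem L_gform (P Q : ℝ[X]) (a b : ℝ) (w : L2neg) :
    L (gform P Q a b w) = fun x => -gform (polyD (polyD P)) (polyD (polyD Q)) a b w x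
      + (x ^ 2 - 6) / 4 * gform P Q a b w x := by
  ext x
  rw [L, iteratedDeriv_succ, iteratedDeriv_one, deriv_gform, deriv_gform]

theorem deriv_L_gform (P Q : ℝ[X]) (a b : ℝ) (w : L2neg) (x : ℝ) :
    deriv (L (gform P Q a b w)) x
      = -gform (polyD (polyD (polyD P))) (polyD (polyD (polyD Q))) a b w x
        + x / 2 * gform P Q a b w x
        + (x ^ 2 - 6) / 4 * gform (polyD P) (polyD Q) a b w x := by
  rw [L_gform]
  have h1 : HasDerivAt (fun x : ℝ => (x ^ 2 - 6) / 4) (x / 2) x :=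
    (((hasDerivAt_pow 2 x).sub_const 6).div_const 4).congr_deriv (by push_cast; ring)
  refine (((hasDerivAt_gform (polyD (polyD P)) (polyD (polyD Q)) a b w x).neg.add
    (h1.mul (hasDerivAt_gform P Q a b w x))).congr_deriv ?_).deriv
  ring

/-- The operator `∂ₓL` in the convolution representation. -/
theorem HasH.deriv_L_convForm {w g : L2neg} (h : HasH w g) (a b x : ℝ) :
    deriv (L (convForm a b w)) x = convForm (-gaussCoef g) (a / 2) g x := by
  rw [convForm_eq, deriv_L_gform, convForm_eq]
  -- The polynomial factor of `H*` applied to `u₀(x - ·)`, written in the variable `x - z` with `x`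
  -- frozen as a coefficient.
  set R : ℝ[X] := C cG * (C (x / 2) + C (1 / 8) * X ^ 3 - C (x ^ 2 / 8) * X) with hR
  set ψ : ℝ → ℝ := fun z => polyG (C cG) (x - z) with hψ
  have hd1 : ∀ P : ℝ[X], deriv (fun z => polyG P (x - z)) = fun z => polyG (-polyD P) (x - z) := by
    intro P
    ext z
    refine (((hasDerivAt_polyG P (x - z)).comp_const_sub x z).congr_deriv ?_).deriv
    simp [polyG]
  have hc : ContDiff ℝ ∞ ψ := (contDiff_polyG _).comp (contDiff_const.sub contDiff_id)
  have hdec : ∀ P : ℝ[X], Decays (fun z => polyG P (x - z)) := fun P => (decays_polyG P).translate x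
  have hH : Hadj ψ = fun z => polyG R (x - z) := by
    ext z
    rw [Hadj_eq hc, hψ, hd1, hd1]
    simp only [polyG, polyD, hR, eval_sub, eval_mul, eval_C, eval_X, eval_neg, eval_add, eval_pow,
      derivative_C, derivative_mul, derivative_sub, derivative_X, derivative_neg, eval_zero,
      eval_one, derivative_zero]
    ring
  have hz : (fun z => z * deriv ψ z)
      = fun z => polyG ((C x - X) * -polyD (C cG)) (x - z) := by
    ext z
    rw [hψ, hd1]
    simp only [polyG, eval_mul, eval_sub, eval_C, eval_X]
    ring
  have hcR : Continuous (fun z => polyG R (x - z)) :=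
    (continuous_polyG R).comp (continuous_const.sub continuous_id)
  have hgreen := h.green hc (hdec _) (by rw [hψ, hd1]; exact hdec _) (by rw [hz]; exact hdec _)
    (by rw [hH]; exact hdec _) (by rw [hH]; exact hcR)
  have hi : ∀ P : ℝ[X], Integrable (fun z => polyG P (x - z) * w z) μneg := fun P =>
    integrable_conv (decays_polyG P) (continuous_polyG P) w x
  -- The intertwining of the two operators: `∂ₓL` in `x` and `H*` in `z` agree on the kernel `u₀(x -
  -- z)`.
  have hconv : -conv (polyG (polyD (polyD (polyD (C cG))))) w x + x / 2 * conv (polyG (C cG)) w x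
      + (x ^ 2 - 6) / 4 * conv (polyG (polyD (C cG))) w x
      = ∫ z in Iio (0 : ℝ), w z * Hadj ψ z := by
    simp only [conv]
    have j1 : Integrable (fun z => -(polyG (polyD (polyD (polyD (C cG)))) (x - z) * w z)) μneg :=
      (hi _).neg
    have j2 := (hi (C cG)).const_mul (x / 2)
    have j3 : Integrable (fun z => -(polyG (polyD (polyD (polyD (C cG)))) (x - z) * w z)
      + x / 2 * (polyG (C cG) (x - z) * w z)) μneg := j1.add j2
    rw [← integral_neg, ← integral_const_mul, ← integral_const_mul, ← integral_add j1 j2,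
      ← integral_add j3 ((hi _).const_mul _)]
    congr 1
    ext z
    simp only [hH, polyG, polyD, hR, eval_sub, eval_mul, eval_C, eval_X, eval_add, eval_pow,
      derivative_C, derivative_mul, derivative_add, derivative_one, derivative_sub, derivative_X, eval_zero,
      eval_one, derivative_zero]
    ring
  have hg : ∫ z in Iio (0 : ℝ), g z * ψ z = conv (polyG (C cG)) g x := by
    rw [conv]
    congr 1; ext z; rw [hψ]; ring
  rw [hg] at hgreen
  rw [hgreen] at hconv
  have hψ0 : ψ 0 = polyG (C cG) x := by rw [hψ]; simp
  rw [hψ0] at hconv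
  have hsolve : conv (polyG (C cG)) g x = -conv (polyG (polyD (polyD (polyD (C cG))))) w x
      + x / 2 * conv (polyG (C cG)) w x + (x ^ 2 - 6) / 4 * conv (polyG (polyD (C cG))) w x
      + gaussCoef g * polyG (C cG) x := by linarith
  -- `∂ₓL u₀ = u₁/2`, since `L u₀ = -u₀`; below, `∂ₓL u₁ = 0`, since `L u₁ = 0`.
  have hA : -polyG (polyD (polyD (polyD (C cG)))) x + x / 2 * polyG (C cG) x
      + (x ^ 2 - 6) / 4 * polyG (polyD (C cG)) x = 1 / 2 * polyG (C cG * X) x := by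
    simp [polyG, polyD, derivative_mul]
    ring
  have hB : -polyG (polyD (polyD (polyD (C cG * X)))) x + x / 2 * polyG (C cG * X) x
      + (x ^ 2 - 6) / 4 * polyG (polyD (C cG * X)) x = 0 := by
    simp [polyG, polyD, derivative_mul]
    ring
  simp only [gform, hsolve]
  linear_combination a * hA + b * hB

/-! ### Injectivity of the representation -/

/-- Uniqueness for the two-sided Laplace transform. -/
theorem ae_eq_zero_of_integral_exp_mul_eq_zero {μ : Measure ℝ} {h : ℝ → ℝ}
    (hi : ∀ t : ℝ, Integrable (fun z => Real.exp (t * z) * h z) μ)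
    (h0 : ∀ t : ℝ, ∫ z, Real.exp (t * z) * h z ∂μ = 0) : h =ᵐ[μ] 0 := by
  have hh : Integrable h μ := by simpa using hi 0
  have key : ∀ g : ℝ → ℝ, (g = h ∨ g = fun z => -h z) → ∀ t : ℝ,
      Integrable (fun z => max (g z) 0 * Real.exp (t * z)) μ := by
    intro g hg t
    refine Integrable.mono (hi t) ?_ (Eventually.of_forall fun z => ?_)
    · refine AEStronglyMeasurable.mul ?_ (by fun_prop)
      have : AEStronglyMeasurable g μ := by
        rcases hg with rfl | rfl
        · exact hh.1
        · exact hh.1.neg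
      exact this.sup aestronglyMeasurable_const
    · rw [norm_mul, norm_mul, mul_comm]
      refine mul_le_mul_of_nonneg_left ?_ (norm_nonneg _)
      rw [Real.norm_eq_abs, Real.norm_eq_abs, abs_of_nonneg (le_max_right _ _)]
      rcases hg with rfl | rfl
      · exact max_le (le_abs_self _) (abs_nonneg _)
      · exact max_le (neg_le_abs _) (abs_nonneg _)
  -- The positive and negative parts of `h` are densities of two finite measures with equal moment
  -- generating functions, finite everywhere. Analytic continuation to complex arguments identifies
  -- the measures.
  set hp := μ.withDensity fun z => ENNReal.ofReal (h z) with hhp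
  set hn := μ.withDensity fun z => ENNReal.ofReal (-h z) with hhn
  have mp : AEMeasurable (fun z => ENNReal.ofReal (h z)) μ := hh.1.aemeasurable.ennreal_ofReal
  have mn : AEMeasurable (fun z => ENNReal.ofReal (-h z)) μ := hh.neg.1.aemeasurable.ennreal_ofReal
  have : IsFiniteMeasure hp := isFiniteMeasure_withDensity_ofReal hh.2
  have : IsFiniteMeasure hn := isFiniteMeasure_withDensity_ofReal hh.neg.2
  have fp : ∀ᵐ z ∂μ, ENNReal.ofReal (h z) < ⊤ := by simp
  have fn : ∀ᵐ z ∂μ, ENNReal.ofReal (-h z) < ⊤ := by simp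
  have hmgf : ProbabilityTheory.mgf id hp = ProbabilityTheory.mgf id hn := by
    ext t
    simp only [ProbabilityTheory.mgf, hhp, hhn, id]
    rw [integral_withDensity_eq_integral_toReal_smul₀ mp fp,
      integral_withDensity_eq_integral_toReal_smul₀ mn fn, ← sub_eq_zero]
    simp only [smul_eq_mul, ENNReal.toReal_ofReal']
    rw [← integral_sub (key _ (Or.inl rfl) t) (key _ (Or.inr rfl) t)]
    refine Eq.trans ?_ (h0 t)
    congr 1
    ext z
    rcases le_total 0 (h z) with hz | hz
    · rw [max_eq_left hz, max_eq_right (by linarith)]; ring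
    · rw [max_eq_right hz, max_eq_left (by linarith)]; ring
  have hset : ProbabilityTheory.integrableExpSet id hp = univ := by
    refine eq_univ_of_forall fun t => ?_
    change Integrable (fun z => Real.exp (t * id z)) hp
    rw [hhp, integrable_withDensity_iff_integrable_smul₀' mp fp]
    simpa only [ENNReal.toReal_ofReal', smul_eq_mul, id] using key _ (Or.inl rfl) t
  have hzero : hp = 0 ↔ hn = 0 := by
    have h1 := congrFun hmgf 0
    rw [ProbabilityTheory.mgf_zero', ProbabilityTheory.mgf_zero'] at h1
    rw [← Measure.measure_univ_eq_zero, ← Measure.measure_univ_eq_zero,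
      ← measureReal_eq_zero_iff, ← measureReal_eq_zero_iff, h1]
  have hc : ProbabilityTheory.complexMGF id hp = ProbabilityTheory.complexMGF id hn := by
    ext z
    refine ProbabilityTheory.eqOn_complexMGF_of_mgf' hmgf hzero ?_
    rw [hset, interior_univ]
    trivial
  have heq := Measure.ext_of_complexMGF_id_eq hc
  rw [hhp, hhn, withDensity_eq_iff mp mn
    (by simpa [hhp] using measure_ne_top hp univ)] at heq
  filter_upwards [heq] with z hz
  rcases le_total 0 (h z) with h1 | h1
  · rw [ENNReal.ofReal_of_nonpos (by linarith : -h z ≤ 0), ENNReal.ofReal_eq_zero] at hz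
    exact le_antisymm hz h1
  · rw [ENNReal.ofReal_of_nonpos h1, eq_comm, ENNReal.ofReal_eq_zero] at hz
    exact le_antisymm h1 (neg_nonpos.1 hz)

/-- The coefficients of the representation are determined by the function. -/
theorem convForm_eq_zero {a b : ℝ} {w : L2neg} (h : ∀ x, convForm a b w x = 0) :
    a = 0 ∧ b = 0 ∧ w = 0 := by
  -- Multiplying the representation by `exp(x²/4)` turns it into `a + b x` plus the Laplace
  -- transform of `q` at `x/2`.
  set q : ℝ → ℝ := fun z => Real.exp (-z ^ 2 / 4) * w z with hq
  have hexp : ∀ x z : ℝ, Real.exp (x / 2 * z) * q z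
      = Real.exp (x ^ 2 / 4) * (polyG (C 1) (x - z) * w z) := by
    intro x z
    simp only [hq, polyG, eval_C, one_mul, ← mul_assoc, ← Real.exp_add]
    ring_nf
  have hi : ∀ t : ℝ, Integrable (fun z => Real.exp (t * z) * q z) μneg := by
    intro t
    have h1 := (integrable_conv (decays_polyG (C 1)) (continuous_polyG _) w (2 * t)).const_mul
      (Real.exp ((2 * t) ^ 2 / 4))
    refine h1.congr (Eventually.of_forall fun z => ?_)
    beta_reduce
    rw [← hexp, mul_div_cancel_left₀ t two_ne_zero]
  have hI : ∀ x : ℝ, a + b * x + ∫ z in Iio (0 : ℝ), Real.exp (x / 2 * z) * q z = 0 := by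
    intro x
    have h1 := h x
    rw [convForm_eq, gform] at h1
    have h2 : conv (polyG (C cG)) w x = cG * conv (polyG (C 1)) w x := by
      simp only [conv]
      rw [← integral_const_mul]
      congr 1; ext z; simp [polyG]; ring
    have h3 : Real.exp (x ^ 2 / 4) * Real.exp (-x ^ 2 / 4) = 1 := by
      rw [← Real.exp_add]; ring_nf; simp
    simp only [hexp]
    rw [integral_const_mul]
    rw [h2] at h1
    rw [conv] at h1
    set J := ∫ z in Iio (0 : ℝ), polyG (C 1) (x - z) * w z
    simp only [polyG, eval_C, eval_mul, eval_X] at h1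
    have h4 := cG_pos.ne'
    apply mul_left_cancel₀ h4
    linear_combination Real.exp (x ^ 2 / 4) * h1 - cG * (a + b * x) * h3
  -- Here the support in `z < 0` matters: the exponentials are at most `1` for `x ≥ 0` and tend to
  -- `0`.
  have hlim : Tendsto (fun x : ℝ => ∫ z in Iio (0 : ℝ), Real.exp (x / 2 * z) * q z) atTop (𝓝 0) := by
    have hqi : Integrable q μneg := by simpa using hi 0
    rw [show 𝓝 (0 : ℝ) = 𝓝 (∫ z in Iio (0 : ℝ), (0 : ℝ)) by simp]
    refine tendsto_integral_filter_of_dominated_convergence (fun z => |q z|)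
      (Eventually.of_forall fun x => (hi (x / 2)).1) ?_ hqi.abs ?_
    · filter_upwards [eventually_ge_atTop 0] with x hx
      filter_upwards [ae_restrict_mem measurableSet_Iio] with z hz
      rw [norm_mul, Real.norm_eq_abs, Real.norm_eq_abs, Real.abs_exp]
      refine mul_le_of_le_one_left (abs_nonneg _) (Real.exp_le_one_iff.2 ?_)
      have : z < 0 := hz
      nlinarith
    · filter_upwards [ae_restrict_mem measurableSet_Iio] with z hz
      have hz : z < 0 := hz
      rw [← zero_mul (q z)]
      refine Tendsto.mul_const _ (Real.tendsto_exp_atBot.comp ?_)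
      exact (tendsto_id.atTop_div_const two_pos).atTop_mul_const_of_neg hz
  have hab : Tendsto (fun x : ℝ => a + b * x) atTop (𝓝 0) := by
    have h1 := hlim.neg
    rw [neg_zero] at h1
    refine h1.congr fun x => ?_
    linarith [hI x]
  have hb : b = 0 := by
    have h1 : Tendsto (fun x : ℝ => a + b * (x + 1)) atTop (𝓝 0) :=
      hab.comp (tendsto_atTop_add_const_right _ _ tendsto_id)
    have h2 := (h1.sub hab)
    rw [sub_zero] at h2
    refine tendsto_nhds_unique (tendsto_const_nhds (x := b) (f := atTop (α := ℝ))) (h2.congr fun x => ?_)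
    ring
  have ha : a = 0 := by
    refine tendsto_nhds_unique (tendsto_const_nhds (x := a) (f := atTop (α := ℝ))) (hab.congr fun x => ?_)
    rw [hb]; ring
  refine ⟨ha, hb, ?_⟩
  have hq0 := ae_eq_zero_of_integral_exp_mul_eq_zero hi fun t => by
    have h1 := hI (2 * t)
    rw [ha, hb, mul_div_cancel_left₀ t two_ne_zero] at h1
    linarith
  refine (Lp.eq_zero_iff_ae_eq_zero).2 ?_
  filter_upwards [hq0] with z hz
  exact (mul_eq_zero.1 hz).resolve_left (Real.exp_ne_zero _)

theorem convForm_sub (a b a' b' : ℝ) (w w' : L2neg) (x : ℝ) :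
    convForm a b w x - convForm a' b' w' x = convForm (a - a') (b - b') (w - w') x := by
  simp only [convForm_eq, gform_sub]

theorem convForm_injective {a b a' b' : ℝ} {w w' : L2neg}
    (h : ∀ x, convForm a b w x = convForm a' b' w' x) : a = a' ∧ b = b' ∧ w = w' := by
  have h1 := convForm_eq_zero (a := a - a') (b := b - b') (w := w - w') fun x => by
    rw [← convForm_sub, h, sub_self]
  exact ⟨sub_eq_zero.1 h1.1, sub_eq_zero.1 h1.2.1, sub_eq_zero.1 h1.2.2⟩

theorem continuous_convForm (a b : ℝ) (w : L2neg) : Continuous (convForm a b w) := by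
  rw [convForm_eq]
  exact continuous_gform _ _ _ _ _

/-! ### The constraint -/

theorem integral_exp_neg_sq_half : ∫ x : ℝ, Real.exp (-x ^ 2 / 2) = √(2 * Real.pi) := by
  have h := integral_gaussian (1 / 2)
  rw [show Real.pi / (1 / 2) = 2 * Real.pi by ring] at h
  rw [← h]
  congr 1; ext x; ring_nf

theorem integrable_exp_neg_sq_half : Integrable fun x : ℝ => Real.exp (-x ^ 2 / 2) := by
  refine (integrable_exp_neg_mul_sq (b := 1 / 2) (by norm_num)).congr
    (Eventually.of_forall fun x => ?_)
  ring_nf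

/-- Completing the square in `x` isolates the factor `exp(-z²/8)`. This is why the weight in the
flux `gaussCoef` also appears in the constraint. -/
theorem V_mul_polyG_one (x z : ℝ) : V x * polyG (C cG) (x - z)
    = Real.exp (1 / 2) * cG * (Real.exp (-z ^ 2 / 8) * Real.exp (-(x - z / 2) ^ 2 / 2)) := by
  simp only [V, polyG, eval_C]
  rw [← Real.exp_add, mul_comm cG, ← mul_assoc, ← Real.exp_add, mul_comm, mul_comm _ cG, mul_assoc,
    ← Real.exp_add]
  ring_nf

theorem integral_V_mul_conv (w : L2neg) :
    Integrable (fun x => V x * conv (polyG (C cG)) w x) ∧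
    ∫ x, V x * conv (polyG (C cG)) w x
      = Real.exp (1 / 2) * cG * √(2 * Real.pi) * gaussCoef w := by
  have hA : Integrable (fun z => w z * Real.exp (-z ^ 2 / 8)) μneg :=
    integrable_mul_of_decays w decays_exp (by fun_prop)
  set K := Real.exp (1 / 2) * cG with hK
  set F : ℝ × ℝ → ℝ := fun p => K * (w p.2 * Real.exp (-p.2 ^ 2 / 8))
    * Real.exp (-(p.1 - p.2 / 2) ^ 2 / 2) with hF
  have hx : ∀ z : ℝ, Integrable fun x : ℝ => Real.exp (-(x - z / 2) ^ 2 / 2) := fun z =>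
    integrable_exp_neg_sq_half.comp_sub_right (z / 2)
  have hxI : ∀ z : ℝ, ∫ x : ℝ, Real.exp (-(x - z / 2) ^ 2 / 2) = √(2 * Real.pi) := fun z => by
    rw [← integral_exp_neg_sq_half]
    exact integral_sub_right_eq_self (fun x => Real.exp (-x ^ 2 / 2)) (z / 2)
  have hint : Integrable F (volume.prod μneg) := by
    rw [integrable_prod_iff']
    · refine ⟨Eventually.of_forall fun z => (hx z).const_mul (K * (w z * Real.exp (-z ^ 2 / 8))), ?_⟩
      have h1 : (fun z => ∫ x, ‖F (x, z)‖)
          = fun z => √(2 * Real.pi) * ‖K * (w z * Real.exp (-z ^ 2 / 8))‖ := by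
        ext z
        simp only [hF, norm_mul _ (Real.exp (-(_ - z / 2) ^ 2 / 2)), Real.norm_of_nonneg (Real.exp_nonneg _)]
        rw [integral_const_mul, hxI, mul_comm]
      rw [h1]
      exact (hA.const_mul K).norm.const_mul _
    · refine AEStronglyMeasurable.mul ?_ (by fun_prop)
      exact (hA.const_mul K).1.comp_snd
  have hFx : ∀ x, ∫ z in Iio (0 : ℝ), F (x, z) = V x * conv (polyG (C cG)) w x := by
    intro x
    rw [conv, ← integral_const_mul]
    congr 1; ext z
    rw [← mul_assoc, V_mul_polyG_one, hF]
    ring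
  refine ⟨hint.integral_prod_left.congr (Eventually.of_forall hFx), ?_⟩
  simp only [← hFx]
  rw [integral_integral_swap hint]
  have h2 : ∀ z, ∫ x, F (x, z) = K * √(2 * Real.pi) * (w z * Real.exp (-z ^ 2 / 8)) := by
    intro z
    simp only [hF]
    rw [integral_const_mul, hxI]
    ring
  simp only [h2]
  rw [integral_const_mul, gaussCoef]

theorem integral_V_mul_convForm (a b : ℝ) (w : L2neg) :
    ∫ x, V x * convForm a b w x
      = Real.exp (1 / 2) * cG * √(2 * Real.pi) * (a + gaussCoef w) := by
  have h0 : ∀ x, V x * polyG (C cG) x = Real.exp (1 / 2) * cG * Real.exp (-x ^ 2 / 2) := by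
    intro x
    have := V_mul_polyG_one x 0
    simpa using this
  have i0 : Integrable fun x => V x * polyG (C cG) x := by
    simp only [h0]
    exact integrable_exp_neg_sq_half.const_mul _
  have hV : V = polyG (C (Real.exp (1 / 2))) := by
    ext x
    simp only [V, polyG, eval_C]
    rw [← Real.exp_add]; ring_nf
  have i1 : Integrable fun x => V x * polyG (C cG * X) x := by
    rw [hV]; exact integrable_polyG_mul _ _
  -- The integrand is odd, so `b` does not enter the constraint.
  have I1 : ∫ x, V x * polyG (C cG * X) x = 0 := by
    have h1 := integral_neg_eq_self (fun x => V x * polyG (C cG * X) x) volume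
    have h2 : (fun x => V (-x) * polyG (C cG * X) (-x)) = fun x => -(V x * polyG (C cG * X) x) := by
      ext x
      simp [V, polyG]
    rw [h2, integral_neg] at h1
    linarith
  have I0 : ∫ x, V x * polyG (C cG) x = Real.exp (1 / 2) * cG * √(2 * Real.pi) := by
    simp only [h0]
    rw [integral_const_mul, integral_exp_neg_sq_half]
  obtain ⟨i2, I2⟩ := integral_V_mul_conv w
  have h3 : ∀ x, V x * convForm a b w x = a * (V x * polyG (C cG) x)
      + b * (V x * polyG (C cG * X) x) + V x * conv (polyG (C cG)) w x := by
    intro x; rw [convForm_eq, gform]; ring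
  simp only [h3]
  have i3 : Integrable fun x => a * (V x * polyG (C cG) x) + b * (V x * polyG (C cG * X) x) :=
    (i0.const_mul a).add (i1.const_mul b)
  rw [integral_add i3 i2,
    integral_add (i0.const_mul a) (i1.const_mul b), integral_const_mul, integral_const_mul, I0, I1, I2]
  ring

theorem integral_V_mul_convForm_eq_zero_iff {a b : ℝ} {w : L2neg} :
    ∫ x, V x * convForm a b w x = 0 ↔ a = -gaussCoef w := by
  have h1 : Real.exp (1 / 2) * cG * √(2 * Real.pi) ≠ 0 := by
    have := cG_pos
    positivity
  rw [integral_V_mul_convForm, mul_eq_zero, or_iff_right h1, add_eq_zero_iff_eq_neg]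

/-! ### The energy space -/

/-- Split `x = (x - z) + z` inside the convolution; `z w` is `w - (1 - z) w`, that is, `hInvL g -
hInvW g`. -/
theorem mul_convForm_hInvL (a b : ℝ) (g : L2neg) (x : ℝ) :
    x * convForm a b (hInvL g) x
      = gform (X * C cG) (X * (C cG * X)) a b (hInvL g) x
        + gform (C cG) (C cG * X) 0 0 (hInvL g - hInvW g) x := by
  have hP : ∀ (P : ℝ[X]) (y : ℝ), polyG (X * P) y = y * polyG P y := fun P y => by
    simp [polyG, mul_assoc]
  have h1 : x * conv (polyG (C cG)) (hInvL g) x = conv (polyG (X * C cG)) (hInvL g) x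
      + conv (polyG (C cG)) (hInvL g - hInvW g) x := by
    simp only [conv]
    rw [← integral_const_mul, ← integral_add (integrable_conv (decays_polyG _) (continuous_polyG _) _ x)
      (integrable_conv (decays_polyG _) (continuous_polyG _) _ x)]
    refine integral_congr_ae ?_
    filter_upwards [Lp.coeFn_sub (hInvL g) (hInvW g), hInvW_ae_eq g] with z hz hz'
    rw [hz, Pi.sub_apply, hz', hP]
    ring
  rw [convForm_eq, gform, gform, gform, hP, hP, mul_add, h1]
  ring

theorem eLpNorm_weight_mul_le {f : ℝ → ℝ} (hf : AEStronglyMeasurable f volume) :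
    eLpNorm (fun x => √(1 + x ^ 2) * f x) 2 volume
      ≤ eLpNorm f 2 volume + eLpNorm (fun x => x * f x) 2 volume := by
  have h1 : ∀ x, ‖√(1 + x ^ 2) * f x‖ ≤ ‖f x‖ + ‖x * f x‖ := by
    intro x
    rw [norm_mul, norm_mul, Real.norm_of_nonneg (Real.sqrt_nonneg _), Real.norm_eq_abs x]
    have h2 : √(1 + x ^ 2) ≤ 1 + |x| := by
      refine Real.sqrt_le_iff.2 ⟨by positivity, ?_⟩
      nlinarith [sq_abs x, abs_nonneg x]
    calc √(1 + x ^ 2) * ‖f x‖ ≤ (1 + |x|) * ‖f x‖ := by gcongr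
      _ = _ := by ring
  refine (eLpNorm_mono_real h1).trans ?_
  have hx : AEStronglyMeasurable (fun x => x * f x) volume :=
    continuous_id.aestronglyMeasurable.mul hf
  refine (eLpNorm_add_le hf.norm hx.norm (by norm_num)).trans ?_
  rw [eLpNorm_norm, eLpNorm_norm]

/-- A bound of the energy norm of `convForm a b (hInvL g)` by continuous seminorms. -/
theorem energyNorm_convForm_le (a b : ℝ) (g : L2neg) :
    energyNorm (convForm a b (hInvL g)) ≤
      ‖gformL (C cG) (C cG * X) (a, b, hInvL g)‖ₑ
      + ‖gformL (polyD (C cG)) (polyD (C cG * X)) (a, b, hInvL g)‖ₑ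
      + (‖gformL (C cG) (C cG * X) (a, b, hInvL g)‖ₑ
        + (‖gformL (X * C cG) (X * (C cG * X)) (a, b, hInvL g)‖ₑ
          + ‖gformL (C cG) (C cG * X) (0, 0, hInvL g - hInvW g)‖ₑ)) := by
  have hm := (continuous_convForm a b (hInvL g)).aestronglyMeasurable (μ := volume)
  rw [energyNorm]
  simp only [← eLpNorm_gform]
  refine add_le_add (add_le_add ?_ ?_) ((eLpNorm_weight_mul_le hm).trans (add_le_add ?_ ?_))
  · rw [convForm_eq]
  · rw [convForm_eq, deriv_gform]
  · rw [convForm_eq]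
  · simp only [mul_convForm_hInvL]
    exact eLpNorm_add_le (memLp_gform _ _ _ _ _).1 (memLp_gform _ _ _ _ _).1 (by norm_num)

/-- Parametrizing by `g = Hw` makes the energy norm continuous in the graph norm, through
boundedness of `hInvL` and `hInvW`. -/
theorem tendsto_energyNorm_convForm {l : Filter ℝ} {a b : ℝ → ℝ} {g : ℝ → L2neg}
    (ha : Tendsto a l (𝓝 0)) (hb : Tendsto b l (𝓝 0)) (hg : Tendsto g l (𝓝 0)) :
    Tendsto (fun t => energyNorm (convForm (a t) (b t) (hInvL (g t)))) l (𝓝 0) := by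
  have hS : Tendsto (fun t => hInvL (g t)) l (𝓝 0) := by
    simpa [Function.comp_def] using (hInvL.continuous.tendsto 0).comp hg
  have hW : Tendsto (fun t => hInvW (g t)) l (𝓝 0) := by
    simpa [Function.comp_def] using (hInvW.continuous.tendsto 0).comp hg
  have key : ∀ (P Q : ℝ[X]) {a b : ℝ → ℝ} {w : ℝ → L2neg}, Tendsto a l (𝓝 0) →
      Tendsto b l (𝓝 0) → Tendsto w l (𝓝 0) →
      Tendsto (fun t => ‖gformL P Q (a t, b t, w t)‖ₑ) l (𝓝 0) := by
    intro P Q a b w ha hb hw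
    have h1 := ((gformL P Q).continuous.enorm.tendsto (0, 0, 0)).comp
      (ha.prodMk_nhds (hb.prodMk_nhds hw))
    rw [show gformL P Q (0, 0, 0) = 0 from map_zero (gformL P Q), enorm_zero] at h1
    exact h1
  refine tendsto_of_tendsto_of_tendsto_of_le_of_le tendsto_const_nhds ?_ (fun _ => zero_le)
    fun t => energyNorm_convForm_le (a t) (b t) (g t)
  have h1 := ((key (C cG) (C cG * X) ha hb hS).add
    (key (polyD (C cG)) (polyD (C cG * X)) ha hb hS)).add
      ((key (C cG) (C cG * X) ha hb hS).add ((key (X * C cG) (X * (C cG * X)) ha hb hS).add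
        (key (C cG) (C cG * X) (tendsto_const_nhds (x := 0)) (tendsto_const_nhds (x := 0))
          (by simpa using hS.sub hW))))
  simpa using h1

theorem convForm_mem_H1 (a b : ℝ) (w : L2neg) : convForm a b w ∈ H1 := by
  rw [convForm_eq]
  refine ⟨memLp_gform _ _ _ _ _, gform (polyD (C cG)) (polyD (C cG * X)) a b w,
    memLp_gform _ _ _ _ _, fun φ hφ hc => ?_⟩
  have hcd : Continuous (deriv φ) := hφ.continuous_deriv (by simp)
  have hφ2 : MemLp φ 2 volume := hφ.continuous.memLp_of_hasCompactSupport hc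
  have hφ2' : MemLp (deriv φ) 2 volume := hcd.memLp_of_hasCompactSupport hc.deriv
  exact integral_mul_deriv_eq_deriv_mul_of_integrable
    (fun x _ => hasDerivAt_gform (C cG) (C cG * X) a b w x)
    (fun x _ => (hφ.differentiable (by simp) x).hasDerivAt)
    ((memLp_gform _ _ _ _ _).integrable_mul hφ2') ((memLp_gform _ _ _ _ _).integrable_mul hφ2)
    ((memLp_gform _ _ _ _ _).integrable_mul hφ2)

theorem convForm_hInvL_mem_L21 (a b : ℝ) (g : L2neg) : convForm a b (hInvL g) ∈ L21 := by
  have hc := continuous_convForm a b (hInvL g)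
  refine ⟨Continuous.aestronglyMeasurable (by fun_prop), ?_⟩
  refine (eLpNorm_weight_mul_le hc.aestronglyMeasurable).trans_lt (ENNReal.add_lt_top.2 ⟨?_, ?_⟩)
  · rw [convForm_eq]; exact (memLp_gform _ _ _ _ _).2
  · simp only [mul_convForm_hInvL]
    exact ((memLp_gform _ _ _ _ _).add (memLp_gform _ _ _ _ _)).2

theorem convForm_hInvL_mem_Xc (b : ℝ) (g : L2neg) :
    convForm (-gaussCoef (hInvL g)) b (hInvL g) ∈ Xc :=
  ⟨convForm_mem_H1 _ _ _, convForm_hInvL_mem_L21 _ _ _, integral_V_mul_convForm_eq_zero_iff.2 rfl⟩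

theorem memLp_gaussian : MemLp (fun z : ℝ => Real.exp (-z ^ 2 / 8)) 2 μneg :=
  (decays_exp.memLp_two (by fun_prop)).restrict _

/-- `gaussCoef` as a bounded functional. -/
def gaussCoefL : L2neg →L[ℝ] ℝ := innerSL ℝ (memLp_gaussian.toLp _)

theorem gaussCoefL_apply (w : L2neg) : gaussCoefL w = gaussCoef w := by
  rw [gaussCoefL, innerSL_apply_apply, real_inner_comm, inner_toLp_right, gaussCoef]

theorem hasDerivWithinAt_gaussCoef {w : ℝ → L2neg} {w' : L2neg} {s : Set ℝ} {t : ℝ}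
    (hw : HasDerivWithinAt w w' s t) :
    HasDerivWithinAt (fun t => gaussCoef (w t)) (gaussCoef w') s t := by
  simp only [← gaussCoefL_apply]
  exact gaussCoefL.hasFDerivAt.comp_hasDerivWithinAt t hw

theorem contDiffOn_one_Ici {E : Type*} [NormedAddCommGroup E] [NormedSpace ℝ E] {f f' : ℝ → E}
    (hf : ∀ t, 0 ≤ t → HasDerivWithinAt f (f' t) (Ici 0) t) (hc : ContinuousOn f' (Ici 0)) :
    ContDiffOn ℝ 1 f (Ici 0) := by
  rw [contDiffOn_one_iff_derivWithin (uniqueDiffOn_Ici 0)]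
  refine ⟨fun t ht => (hf t ht).differentiableWithinAt, hc.congr fun t ht => ?_⟩
  exact (hf t ht).derivWithin (uniqueDiffOn_Ici 0 t ht)

theorem hasDerivWithinAt_convForm {a b : ℝ → ℝ} {w : ℝ → L2neg} {a' b' : ℝ} {w' : L2neg}
    {s : Set ℝ} {t : ℝ} (ha : HasDerivWithinAt a a' s t) (hb : HasDerivWithinAt b b' s t)
    (hw : HasDerivWithinAt w w' s t) (x : ℝ) :
    HasDerivWithinAt (fun t => convForm (a t) (b t) (w t) x) (convForm a' b' w' x) s t := by
  simp only [convForm_eq, gform]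
  exact ((ha.mul_const _).add (hb.mul_const _)).add
    (hasDerivWithinAt_conv_time (decays_polyG _) (continuous_polyG _) hw x)

/-! ### Existence -/

/-- With `a = -γ(w)` imposed, the constraint holds by construction, and its time derivative `a' =
-γ(w_t)` is exactly the coefficient of `u₀` in `∂ₓL u`. No separate equation for `a` has to be
solved. -/
theorem isConvSolution_of_orbit {a b : ℝ → ℝ} {v : ℝ → L2neg} (hv : Continuous v)
    (hw : ∀ t, 0 ≤ t → HasDerivWithinAt (fun s => hInvL (v s)) (v t) (Ici 0) t)
    (ha : ∀ t, a t = -gaussCoef (hInvL (v t)))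
    (hb : ∀ t, 0 ≤ t → HasDerivWithinAt b (a t / 2) (Ici 0) t) :
    IsConvSolution a b (fun t => hInvL (v t)) := by
  have hac : Continuous a := by
    simp only [funext ha, ← gaussCoefL_apply]
    fun_prop
  have ha' : ∀ t, 0 ≤ t → HasDerivWithinAt a (-gaussCoef (v t)) (Ici 0) t := by
    intro t ht
    simp only [funext ha]
    exact (hasDerivWithinAt_gaussCoef (hw t ht)).neg
  have hvc : Continuous fun t => -gaussCoef (v t) := by
    simp only [← gaussCoefL_apply]
    fun_prop
  have hbc : ContinuousOn b (Ici 0) := fun t ht => (hb t ht).continuousWithinAt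
  have hL : ∀ t, deriv (L (convForm (a t) (b t) (hInvL (v t))))
      = convForm (-gaussCoef (v t)) (a t / 2) (v t) := fun t =>
    funext fun x => (hasH_hInvL (v t)).deriv_L_convForm (a t) (b t) x
  have hU : ∀ t, 0 ≤ t → HasDerivWithinAt
      (fun t => gformL (C cG) (C cG * X) (a t, b t, hInvL (v t)))
      (gformL (C cG) (C cG * X) (-gaussCoef (v t), a t / 2, v t)) (Ici 0) t := fun t ht =>
    (gformL (C cG) (C cG * X)).hasFDerivAt.comp_hasDerivWithinAt t
      ((ha' t ht).prodMk ((hb t ht).prodMk (hw t ht)))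
  refine ⟨contDiffOn_one_Ici ha' hvc.continuousOn,
    contDiffOn_one_Ici hb (hac.div_const 2).continuousOn,
    ⟨(hInvL.continuous.comp hv).continuousOn, v, hv.continuousOn, fun t _ => hasH_hInvL (v t)⟩,
    contDiffOn_one_Ici hw hv.continuousOn, ⟨fun t _ => ?_, fun t _ => ?_, fun s hs => ?_,
      ⟨fun t => gformL (C cG) (C cG * X) (a t, b t, hInvL (v t)), ?_, fun t ht => ⟨?_, ?_⟩⟩,
      fun t ht x => ?_⟩⟩
  · rw [ha]
    exact convForm_hInvL_mem_Xc _ _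
  · rw [convForm_eq]
    exact contDiff_gform 3 _ _ _ _ _
  · simp only [convForm_sub, ← map_sub]
    have h1 : ∀ {E : Type} [NormedAddCommGroup E] {f : ℝ → E}, ContinuousWithinAt f (Ici 0) s →
        Tendsto (fun t => f t - f s) (𝓝[Ici 0] s) (𝓝 0) := fun {_ _ f} h => by
      simpa using h.tendsto.sub_const (f s)
    exact tendsto_energyNorm_convForm (h1 hac.continuousWithinAt) (h1 (hbc s hs))
      (h1 hv.continuousWithinAt)
  · refine contDiffOn_one_Ici hU (Continuous.continuousOn ?_)
    fun_prop
  · rw [convForm_eq]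
    exact coeFn_gformL _ _ _ _ _
  · rw [(hU t ht).derivWithin (uniqueDiffOn_Ici 0 t ht), hL, convForm_eq]
    exact coeFn_gformL _ _ _ _ _
  · rw [hL]
    exact hasDerivWithinAt_convForm (ha' t ht) (hb t ht) (hw t ht) x

/-! ### Uniqueness -/

namespace IsConvSolution

variable {a b a' b' : ℝ → ℝ} {w w' : ℝ → L2neg}

/-- The modulation equations. -/
theorem modulation (h : IsConvSolution a b w) {t : ℝ} (ht : 0 ≤ t) :
    HasH (w t) (derivWithin w (Ici 0) t) ∧ HasDerivWithinAt b (a t / 2) (Ici 0) t ∧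
      a t = -gaussCoef (w t) := by
  obtain ⟨-, g, -, hg⟩ := h.cont_w
  have ha := (h.contDiff_a.differentiableOn one_ne_zero t ht).hasDerivWithinAt
  have hb := (h.contDiff_b.differentiableOn one_ne_zero t ht).hasDerivWithinAt
  have hw := (h.contDiff_w.differentiableOn one_ne_zero t ht).hasDerivWithinAt
  -- Both the time derivative of `u` and `∂ₓL u` lie in the image of the injective representation,
  -- so their coefficients agree. The formula for `a` comes instead from the constraint.
  obtain ⟨-, h2, h3⟩ := convForm_injective fun x =>
    ((uniqueDiffOn_Ici 0 t ht).eq_deriv _ (hasDerivWithinAt_convForm ha hb hw x)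
      (h.solution.classical t ht x)).trans ((hg t ht).deriv_L_convForm (a t) (b t) x)
  refine ⟨h3 ▸ hg t ht, h2 ▸ hb, ?_⟩
  exact integral_V_mul_convForm_eq_zero_iff.1 (h.solution.mem t ht).2.2

/-- The difference of the `w` components satisfies the homogeneous equation, and `⟪H w, w⟫ ≤ 0`
keeps its norm at zero. Then `a` agrees through the constraint and `b` by integration. -/
theorem unique (h : IsConvSolution a b w) (h' : IsConvSolution a' b' w')
    (h0 : ∀ x, convForm (a 0) (b 0) (w 0) x = convForm (a' 0) (b' 0) (w' 0) x) {t : ℝ}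
    (ht : 0 ≤ t) : a t = a' t ∧ b t = b' t ∧ w t = w' t := by
  obtain ⟨-, hb0, hw0⟩ := convForm_injective h0
  have hw : ∀ t, 0 ≤ t → w t = w' t := by
    intro t ht
    have h1 := norm_le_exp_mul_of_inner_le (w := fun t => w t - w' t)
      (w' := fun t => derivWithin w (Ici 0) t - derivWithin w' (Ici 0) t) (k := 0)
      (fun t ht => (h.contDiff_w.differentiableOn one_ne_zero t ht).hasDerivWithinAt.sub
        (h'.contDiff_w.differentiableOn one_ne_zero t ht).hasDerivWithinAt)
      (fun t ht => by
        rw [((h.modulation ht).1.sub (h'.modulation ht).1).eq_hInvL, neg_zero, zero_mul,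
          real_inner_comm]
        exact isDissipativeInverse_hInvL.inner_nonpos _) ht
    rw [hw0, sub_self, norm_zero, mul_zero] at h1
    exact sub_eq_zero.1 (norm_le_zero_iff.1 h1)
  have ha : ∀ t, 0 ≤ t → a t = a' t := fun t ht => by
    rw [(h.modulation ht).2.2, (h'.modulation ht).2.2, hw t ht]
  refine ⟨ha t ht, ?_, hw t ht⟩
  have h1 := norm_le_exp_mul_of_inner_le (w := fun t => b t - b' t) (w' := fun _ => (0 : ℝ)) (k := 0)
    (fun t ht => ((h.modulation ht).2.1.sub (h'.modulation ht).2.1).congr_deriv (by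
      rw [ha t ht, sub_self]))
    (fun t _ => by simp) ht
  rw [hb0, sub_self, norm_zero, mul_zero] at h1
  exact sub_eq_zero.1 (norm_le_zero_iff.1 h1)

end IsConvSolution

/-! ### Convergence -/

theorem exists_abs_convForm_le :
    ∃ M, ∀ (a b : ℝ) (w : L2neg) (x : ℝ), |convForm a b w x| ≤ M * (|a| + |b| + ‖w‖) := by
  have hb : ∀ P : ℝ[X], ∃ M, ∀ x, |polyG P x| ≤ M := fun P => by
    obtain ⟨M, hM⟩ := decays_polyG P
    refine ⟨M, fun x => (hM x).trans (mul_le_of_le_one_right (Decays.bound_nonneg hM) ?_)⟩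
    exact inv_le_one_of_one_le₀ (one_le_pow₀ (by nlinarith [sq_nonneg x]))
  obtain ⟨M₀, h₀⟩ := hb (C cG)
  obtain ⟨M₁, h₁⟩ := hb (C cG * X)
  obtain ⟨B, hB0, hB⟩ := exists_abs_conv_le (decays_polyG (C cG)) (continuous_polyG _)
  have hM₀ : 0 ≤ M₀ := (abs_nonneg _).trans (h₀ 0)
  have hM₁ : 0 ≤ M₁ := (abs_nonneg _).trans (h₁ 0)
  refine ⟨M₀ + M₁ + B, fun a b w x => ?_⟩
  rw [convForm_eq, gform]
  calc |a * polyG (C cG) x + b * polyG (C cG * X) x + conv (polyG (C cG)) w x|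
      ≤ |a| * |polyG (C cG) x| + |b| * |polyG (C cG * X) x| + |conv (polyG (C cG)) w x| := by
        rw [← abs_mul, ← abs_mul]
        exact (abs_add_le _ _).trans (add_le_add_left (abs_add_le _ _) _)
    _ ≤ |a| * M₀ + |b| * M₁ + B * ‖w‖ := by
        gcongr
        exacts [h₀ x, h₁ x, hB w x]
    _ ≤ |a| * (M₀ + M₁ + B) + |b| * (M₀ + M₁ + B) + (M₀ + M₁ + B) * ‖w‖ := by
        gcongr <;> linarith
    _ = _ := by ring

theorem tendsto_eLpNorm_convForm {l : Filter ℝ} {a b : ℝ → ℝ} {w : ℝ → L2neg}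
    (ha : Tendsto a l (𝓝 0)) (hb : Tendsto b l (𝓝 0)) (hw : Tendsto w l (𝓝 0)) :
    Tendsto (fun t => eLpNorm (convForm (a t) (b t) (w t)) 2 volume) l (𝓝 0) ∧
    Tendsto (fun t => eLpNorm (convForm (a t) (b t) (w t)) ⊤ volume) l (𝓝 0) := by
  constructor
  · simp only [convForm_eq, eLpNorm_gform]
    have h1 := ((gformL (C cG) (C cG * X)).continuous.enorm.tendsto (0, 0, 0)).comp
      (ha.prodMk_nhds (hb.prodMk_nhds hw))
    rw [show gformL (C cG) (C cG * X) (0, 0, 0) = 0 from map_zero _, enorm_zero] at h1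
    exact h1
  · obtain ⟨M, hM⟩ := exists_abs_convForm_le
    refine tendsto_of_tendsto_of_tendsto_of_le_of_le tendsto_const_nhds
      (h := fun t => ENNReal.ofReal (M * (|a t| + |b t| + ‖w t‖))) ?_ (fun _ => zero_le) fun t => ?_
    · have h1 := ENNReal.tendsto_ofReal (((ha.abs.add hb.abs).add hw.norm).const_mul M)
      simpa using h1
    · beta_reduce
      rw [eLpNorm_exponent_top]
      exact eLpNormEssSup_le_of_ae_bound (Eventually.of_forall fun x => hM _ _ _ x)

theorem convForm_sub_const_mul_u₁ (a b c : ℝ) (w : L2neg) (x : ℝ) :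
    convForm a b w x - c * u₁ x = convForm a (b - c) w x := by
  simp only [convForm]
  ring

end

end LogKdV

/-! ### Assembly of the main theorem. -/

theorem mainTheorem6 (f : ℝ → ℝ) (hf : f ∈ LogKdV.Xc)
    (a₀ b₀ : ℝ) (w₀ : LogKdV.L2neg) (hw₀ : w₀ ∈ LogKdV.DomH)
    (hrep : f =ᵐ[volume] LogKdV.convForm a₀ b₀ w₀) :
    ∃ (a b : ℝ → ℝ) (w : ℝ → LogKdV.L2neg),
      LogKdV.IsConvSolution a b w ∧
      (a 0 = a₀ ∧ b 0 = b₀ ∧ w 0 = w₀) ∧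
      (∀ t, 0 ≤ t →
        LogKdV.HasH (w t) (derivWithin w (Ici 0) t) ∧
        (∃ c : ℝ, LogKdV.HasTrace (w t) c ∧ HasDerivWithinAt a (2 * c) (Ici 0) t) ∧
        HasDerivWithinAt b (a t / 2) (Ici 0) t) ∧
      (∀ (a' b' : ℝ → ℝ) (w' : ℝ → LogKdV.L2neg),
        LogKdV.IsConvSolution a' b' w' →
        LogKdV.convForm (a' 0) (b' 0) (w' 0) =ᵐ[volume] f →
        ∀ t, 0 ≤ t → a' t = a t ∧ b' t = b t ∧ w' t = w t) ∧
      ∃ b_inf : ℝ,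
        Tendsto (fun t => eLpNorm
          (fun x => LogKdV.convForm (a t) (b t) (w t) x - b_inf * LogKdV.u₁ x) 2 volume)
          atTop (𝓝 0) ∧
        Tendsto (fun t => eLpNorm
          (fun x => LogKdV.convForm (a t) (b t) (w t) x - b_inf * LogKdV.u₁ x) ∞ volume)
          atTop (𝓝 0) := by
  obtain ⟨g₀, hg₀⟩ := hw₀
  have hw₀S := LogKdV.HasH.eq_hInvL hg₀
  have hc₀ : a₀ = -LogKdV.gaussCoef w₀ := by
    rw [← LogKdV.integral_V_mul_convForm_eq_zero_iff (b := b₀), ← hf.2.2]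
    refine integral_congr_ae ?_
    filter_upwards [hrep] with x hx
    rw [hx]
  obtain ⟨v, hv, hv0, hvd, hvn⟩ :=
    LogKdV.isDissipativeInverse_hInvL.exists_semigroup_orbit g₀
  set w : ℝ → LogKdV.L2neg := fun t => LogKdV.hInvL (v t) with hw
  have hw0 : w 0 = w₀ := by rw [hw₀S, ← hv0]
  have hwd : ∀ t, 0 ≤ t → HasDerivWithinAt w (v t) (Ici 0) t := hvd
  set a : ℝ → ℝ := fun t => -LogKdV.gaussCoef (w t) with ha
  -- Since `(S w)_t = S v = w`, this explicit formula has derivative `-γ(w)/2 = a/2`. Its limit,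
  -- reached when `w → 0`, is the constant part.
  set b : ℝ → ℝ := fun t => b₀ + LogKdV.gaussCoef (LogKdV.hInvL w₀) / 2
    - LogKdV.gaussCoef (LogKdV.hInvL (w t)) / 2 with hb
  have had : ∀ t, 0 ≤ t → HasDerivWithinAt a (-LogKdV.gaussCoef (v t)) (Ici 0) t := fun t ht =>
    (LogKdV.hasDerivWithinAt_gaussCoef (hwd t ht)).neg
  have hbd : ∀ t, 0 ≤ t → HasDerivWithinAt b (a t / 2) (Ici 0) t := fun t ht =>
    (((LogKdV.hasDerivWithinAt_gaussCoef
      (LogKdV.hInvL.hasFDerivAt.comp_hasDerivWithinAt t (hwd t ht))).div_const 2).const_sub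
        _).congr_deriv (by rw [ha, hw]; ring)
  have ha0 : a 0 = a₀ := by rw [hc₀, ← hw0]
  have hb0 : b 0 = b₀ := by simp only [hb, hw0]; ring
  have hsol : LogKdV.IsConvSolution a b w :=
    LogKdV.isConvSolution_of_orbit hv hwd (fun _ => rfl) hbd
  refine ⟨a, b, w, hsol, ⟨ha0, hb0, hw0⟩, fun t ht => ⟨?_, ?_, hbd t ht⟩, ?_,
    b₀ + LogKdV.gaussCoef (LogKdV.hInvL w₀) / 2, ?_⟩
  · rw [(hwd t ht).derivWithin (uniqueDiffOn_Ici 0 t ht)]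
    exact LogKdV.hasH_hInvL (v t)
  -- The trace of `w = S v` at `0` is `-γ(v)/2`, so `2 w(0) = -γ(w_t) = a'`.
  · refine ⟨-LogKdV.gaussCoef (v t) / 2, (LogKdV.hasH_hInvL (v t)).hasTrace, ?_⟩
    rw [mul_div_cancel₀ _ two_ne_zero]
    exact had t ht
  · intro a' b' w' h' hf' t ht
    refine h'.unique hsol (fun x => ?_) ht
    rw [ha0, hb0, hw0]
    -- Almost everywhere equality of the initial data becomes pointwise equality by continuity, as
    -- injectivity of the representation requires.
    exact congrFun ((LogKdV.continuous_convForm _ _ _).ae_eq_iff_eq volume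
      (LogKdV.continuous_convForm _ _ _) |>.1 (hf'.trans hrep)) x
  · have hvlim : Tendsto v atTop (𝓝 0) := by
      rw [tendsto_zero_iff_norm_tendsto_zero]
      refine squeeze_zero' (Eventually.of_forall fun t => norm_nonneg _)
        ((eventually_ge_atTop 0).mono fun t ht => hvn t ht) ?_
      have h1 := (Real.tendsto_exp_atBot.comp
        (tendsto_id.const_mul_atTop_of_neg (r := -(1 / 4 : ℝ)) (by norm_num))).mul_const ‖g₀‖
      rwa [zero_mul] at h1
    have hS : ∀ {u : ℝ → LogKdV.L2neg}, Tendsto u atTop (𝓝 0) →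
        Tendsto (fun t => LogKdV.hInvL (u t)) atTop (𝓝 0) := fun hu => by
      simpa [Function.comp_def] using (LogKdV.hInvL.continuous.tendsto 0).comp hu
    have hγ : ∀ {u : ℝ → LogKdV.L2neg}, Tendsto u atTop (𝓝 0) →
        Tendsto (fun t => LogKdV.gaussCoef (u t)) atTop (𝓝 0) := fun hu => by
      have h1 := (LogKdV.gaussCoefL.continuous.tendsto 0).comp hu
      rw [map_zero] at h1
      exact h1.congr fun t => LogKdV.gaussCoefL_apply _
    have hwlim : Tendsto w atTop (𝓝 0) := hS hvlim
    have halim : Tendsto a atTop (𝓝 0) := by simpa using (hγ hwlim).neg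
    have hblim : Tendsto (fun t => b t - (b₀ + LogKdV.gaussCoef (LogKdV.hInvL w₀) / 2)) atTop
        (𝓝 0) := by
      have h1 := ((hγ (hS hwlim)).div_const 2).neg
      rw [zero_div, neg_zero] at h1
      refine h1.congr fun t => ?_
      simp only [hb]
      ring
    simp only [LogKdV.convForm_sub_const_mul_u₁]
    exact LogKdV.tendsto_eLpNorm_convForm halim hblim hwlim
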